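/- Let $\Lambda=(-\Delta)^{1/2}$ on $\mathbb{R}^3$, i.e. $\Lambda^r$ is the Fourier multiplier with symbol $|\xi|^r$ ($|\xi|$ being the symbol of $\Lambda$). Let $0\le a<1$, $b>1-a$ and $s>\frac72-a$. Then the Cauchy problem for the fractionally dissipative system $$\partial_t B+\nabla\times\big((\nabla\times\Lambda^{-a}B)\times B\big)=-\Lambda^{b}B,\qquad \nabla\cdot B=0,$$ for $B(t,\cdot):\mathbb{R}^3\to\mathbb{R}^3$ is locally well-posed in $H^s(\mathbb{R}^3)$ in the following sense: for every divergence-free initial datum $B_0\in H^s(\mathbb{R}^3;\mathbb{R}^3)$ there exist $T>0$ and a unique solution $B\in C([0,T];H^s(\mathbb{R}^3))$ of the system on $[0,T]$ with $B(0)=B_0$. Here a solution satisfies $\nabla\cdot B(t)=0$ in the sense of distributions for every $t\in[0,T]$, and for every $t\in[0,T]$ the evolution equation holds as an identity of tempered distributions on $\mathbb{R}^3$, the time derivative (one-sided at $t=0$ and $t=T$) being taken after pairing with an arbitrary Schwartz function. -/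

import Mathlib

noncomputable section

namespace ActiveVector

open MeasureTheory FourierTransform LineDeriv
open scoped SchwartzMap ENNReal

/-- Physical space `ℝ³` with the Euclidean norm. -/
abbrev R3 : Type := EuclideanSpace ℝ (Fin 3)

/-- Square integrable vector fields `ℝ³ → ℝ³`, given by their three real components. -/
abbrev L2Field : Type := Fin 3 → Lp ℝ 2 (volume : Measure R3)

/-- The `i`-th standard basis vector of `ℝ³`. -/
def e (i : Fin 3) : R3 := EuclideanSpace.single i 1

/-- A real `L²` function regarded as a complex valued one. -/
def toC (u : Lp ℝ 2 (volume : Measure R3)) : Lp ℂ 2 (volume : Measure R3) :=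
  Complex.ofRealCLM.compLp u

/-- A real `L²` function regarded as a tempered distribution. -/
def toDist (u : Lp ℝ 2 (volume : Measure R3)) : 𝓢'(R3, ℂ) :=
  Lp.toTemperedDistribution (toC u)

/-- The product of two real `L²` functions (an `L¹` function) regarded as a tempered
distribution. -/
def mulDist (u v : Lp ℝ 2 (volume : Measure R3)) : 𝓢'(R3, ℂ) :=
  Lp.toTemperedDistribution (Complex.ofRealCLM.compLp (u • v : Lp ℝ 1 (volume : Measure R3)))

/-- Divergence of a vector field whose components are tempered distributions. -/
def divergence (A : Fin 3 → 𝓢'(R3, ℂ)) : 𝓢'(R3, ℂ) := ∑ i, ∂_{e i} (A i)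

/-- Curl of a vector field whose components are tempered distributions
(indices are taken modulo 3). -/
def curl (A : Fin 3 → 𝓢'(R3, ℂ)) (i : Fin 3) : 𝓢'(R3, ℂ) :=
  ∂_{e (i + 1)} (A (i + 2)) - ∂_{e (i + 2)} (A (i + 1))

/-- The cross product `G × B` of two `L²` vector fields, as a vector field of tempered
distributions (indices are taken modulo 3). -/
def cross (G B : L2Field) (i : Fin 3) : 𝓢'(R3, ℂ) :=
  mulDist (G (i + 1)) (B (i + 2)) - mulDist (G (i + 2)) (B (i + 1))

/-- `B` is divergence-free in the sense of distributions. -/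
def IsDivFree (B : L2Field) : Prop := divergence (fun i => toDist (B i)) = 0

/-- The tempered distribution `v` is (integration against) the function `h`. -/
def IsGivenBy (v : 𝓢'(R3, ℂ)) (h : R3 → ℂ) : Prop :=
  ∀ φ : 𝓢(R3, ℂ), Integrable (fun ξ => φ ξ * h ξ) ∧ v φ = ∫ ξ, φ ξ * h ξ

/-- `v = Λ^r u` where `Λ = (-Δ)^{1/2}`: the Fourier transform of the tempered distribution `v` is
the function `(2π|ξ|)^r û(ξ)`; the Fourier transform is `û(ξ) = ∫ e^{-2πi x·ξ} u(x) dx`.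
For `u ∈ L²(ℝ³)` and `r > -3/2` there is exactly one such `v`. -/
def IsFracLaplacian (r : ℝ) (u : Lp ℝ 2 (volume : Measure R3)) (v : 𝓢'(R3, ℂ)) : Prop :=
  IsGivenBy (𝓕 v) fun ξ =>
    (((2 * Real.pi * ‖ξ‖) ^ r : ℝ) : ℂ) * (𝓕 (toC u) : Lp ℂ 2 (volume : Measure R3)) ξ

/-- `B ∈ H^s(ℝ³)`. -/
def MemHs (s : ℝ) (B : L2Field) : Prop :=
  ∀ i, TemperedDistribution.MemSobolev s 2 (toDist (B i))

/-- `B ∈ C([0,T]; H^s(ℝ³))`. The Bessel potential of order `s` is an isometry of `H^s` onto `L²`,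
so this says that it carries `t ↦ B t` to a continuous curve in `L²`. -/
def MemCHs (s T : ℝ) (B : ℝ → L2Field) : Prop :=
  ∀ i, ∃ g : ℝ → Lp ℂ 2 (volume : Measure R3), ContinuousOn g (Set.Icc 0 T) ∧
    ∀ t ∈ Set.Icc 0 T,
      TemperedDistribution.besselPotential R3 ℂ s (toDist (B t i)) = Lp.toTemperedDistribution (g t)

/-- `B ∈ C([0,T]; H^s(ℝ³))` solves, on `[0,T]`,
`∂ₜB + ∇ × ((∇ × Λ^{-a}B) × B) = -Λ^b B`, `∇ · B = 0`, `B(0) = B₀`.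
At each time the equation is one between tempered distributions on `ℝ³`; there `A = Λ^{-a}B`,
`D = Λ^b B`, and `G = ∇ × A` is an `L²` vector field. The time derivative (one-sided
at the end points) is taken in the weak topology of tempered distributions. -/
structure IsSolution (a b s T : ℝ) (B₀ : L2Field) (B : ℝ → L2Field) : Prop where
  memCHs : MemCHs s T B
  initial : B 0 = B₀
  divFree : ∀ t ∈ Set.Icc 0 T, IsDivFree (B t)
  equation : ∀ t ∈ Set.Icc 0 T, ∃ (A D : Fin 3 → 𝓢'(R3, ℂ)) (G : L2Field),
    (∀ i, IsFracLaplacian (-a) (B t i) (A i)) ∧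
    (∀ i, IsFracLaplacian b (B t i) (D i)) ∧
    (∀ i, toDist (G i) = curl A i) ∧
    ∀ (i : Fin 3) (φ : 𝓢(R3, ℂ)),
      HasDerivWithinAt (fun τ => toDist (B τ i) φ)
        ((-(curl (cross G (B t)) i) - D i) φ) (Set.Icc 0 T) t

end ActiveVector

end

noncomputable section

namespace ActiveVector

open MeasureTheory FourierTransform LineDeriv
open scoped SchwartzMap ENNReal

/-! Let f be the Fourier transform of B. The system becomes f' = κ N(f,f) - (2π|ξ|)^b f with κ =
(2π)^(2-a) and N(g,u)(ξ) = ξ × ∫ (|η|^(-a) η × g(η)) × u(ξ-η) dη. Counted naively, N costs one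
derivative on the product and another 1-a on g, more than dissipation of order b need pay for. Two
cancellations in the real part of ⟨w, N(g,u)⟩ repair this.

(1) If g = w, exchanging ξ and η reverses the sign of the form except for the scalars |ξ|^(-a) and
|η|^(-a). Since ||ξ|^(-a) - |η|^(-a)| |ξ||η| ≤ |ξ-η| (|ξ||η|)^((1-a)/2), what is left costs (1-a)/2
derivatives on each copy of w (`re_tri_add_swap_le`), and b > 1-a lets the dissipation absorb it
(`absorb_le`). (2) If u = w is divergence-free, w ↦ ∇ × (J × w) with J = ∇ × Λ^(-a) g is transport
by the divergence-free field J plus terms of order zero (`re_tri_transport_le`). The price is the L¹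
norm of |ζ|^(2-a) g(ζ), controlled by the H^s norm once s > (2-a) + 3/2.

In a weighted energy the factor ψ(|ξ|) is replaced by ψ(|η|) + ψ(|ξ-η|), which leads back to (1) and
(2). The defect gains the ratio of the smaller to the larger of |η| and |ξ-η| and is estimated
absolutely (`abs_weight_sub_sub_le`, `re_integral_weight_tri_le`).

For existence, frequencies are cut off sharply. Boundedness in H^s alone would not give convergence
in H^s, so a weight slightly stronger than that of H^s is fitted to the datum (`exists_isWeight`).
The approximations keep finite energy for it on a common time interval (`exists_galerkin`), which
makes their high frequencies uniformly small in H^s. Their low frequencies are Cauchy by an L²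
stability estimate (`exists_truncEq_stability`): (1) and (2) are applied to a difference, and the
strictness of s > 7/2 - a makes the tails O(n^(-σ)). Hence convergence is uniform in time with
values in H^s (`exists_tendstoUniformlyOn`), and the limit is continuous and solves the equation
(`exists_strongEq`). The same stability estimate yields uniqueness (`StrongEq.unique`).

The rest is a dictionary: the distributional formulation is equivalent to an ordinary differential
equation in L² with a negative weight (`IsSolution.strongEq`, `StrongEq.isSolution`). -/

/-- Frequency-side vectors. -/
abbrev C3 : Type := EuclideanSpace ℂ (Fin 3)

/-! ### Vector algebra on ℂ³ -/

/-- A real vector regarded as a complex one. -/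
def cv (ξ : R3) : C3 := WithLp.toLp 2 fun i => (ξ i : ℂ)

/-- The cross product on `ℂ³`, indices being taken modulo 3. -/
def cr (x y : C3) : C3 := WithLp.toLp 2 fun i => x (i + 1) * y (i + 2) - x (i + 2) * y (i + 1)

/-- Componentwise complex conjugation. -/
def cj (x : C3) : C3 := WithLp.toLp 2 fun i => starRingEnd ℂ (x i)

/-- The bilinear dot product on `ℂ³`. -/
def dt (x y : C3) : ℂ := ∑ i, x i * y i

@[simp] lemma cv_apply (ξ : R3) (i : Fin 3) : cv ξ i = (ξ i : ℂ) := rfl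
@[simp] lemma cr_apply (x y : C3) (i : Fin 3) :
    cr x y i = x (i + 1) * y (i + 2) - x (i + 2) * y (i + 1) := rfl
@[simp] lemma cj_apply (x : C3) (i : Fin 3) : cj x i = starRingEnd ℂ (x i) := rfl

lemma fin3_one_add_one : (1 + 1 : Fin 3) = 2 := rfl
lemma fin3_one_add_two : (1 + 2 : Fin 3) = 0 := rfl
lemma fin3_two_add_one : (2 + 1 : Fin 3) = 0 := rfl
lemma fin3_two_add_two : (2 + 2 : Fin 3) = 1 := rfl

lemma norm_sq_C3 (x : C3) : ‖x‖ ^ 2 = ‖x 0‖ ^ 2 + ‖x 1‖ ^ 2 + ‖x 2‖ ^ 2 := by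
  rw [EuclideanSpace.norm_sq_eq, Fin.sum_univ_three]

lemma norm_cv (ξ : R3) : ‖cv ξ‖ = ‖ξ‖ := by
  simp [EuclideanSpace.norm_eq]

lemma norm_cj (x : C3) : ‖cj x‖ = ‖x‖ := by
  simp [EuclideanSpace.norm_eq]

lemma cj_cj (x : C3) : cj (cj x) = x := by
  ext i; simp

lemma norm_cr_le (x y : C3) : ‖cr x y‖ ≤ ‖x‖ * ‖y‖ := by
  refine le_of_sq_le_sq ?_ (by positivity)
  rw [mul_pow, norm_sq_C3, norm_sq_C3 x, norm_sq_C3 y]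
  -- Lagrange's identity over ℂ: the discarded square is that of the Hermitian product.
  have key : (‖x 0‖ ^ 2 + ‖x 1‖ ^ 2 + ‖x 2‖ ^ 2) * (‖y 0‖ ^ 2 + ‖y 1‖ ^ 2 + ‖y 2‖ ^ 2) =
      ‖cr x y 0‖ ^ 2 + ‖cr x y 1‖ ^ 2 + ‖cr x y 2‖ ^ 2 +
      ‖x 0 * starRingEnd ℂ (y 0) + x 1 * starRingEnd ℂ (y 1) + x 2 * starRingEnd ℂ (y 2)‖ ^ 2 := by
    simp only [cr_apply, Complex.sq_norm, Complex.normSq_apply, Complex.add_re, Complex.add_im,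
      Complex.sub_re, Complex.sub_im, Complex.mul_re, Complex.mul_im, Complex.conj_re,
      Complex.conj_im, zero_add, fin3_one_add_one, fin3_one_add_two, fin3_two_add_one,
      fin3_two_add_two]
    ring
  rw [key]
  nlinarith [norm_nonneg (x 0 * starRingEnd ℂ (y 0) + x 1 * starRingEnd ℂ (y 1)
    + x 2 * starRingEnd ℂ (y 2))]

lemma inner_eq_dt (x y : C3) : inner ℂ x y = dt (cj x) y := by
  simp [PiLp.inner_apply, dt, mul_comm]

lemma norm_dt_le (x y : C3) : ‖dt x y‖ ≤ ‖x‖ * ‖y‖ := by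
  have := norm_inner_le_norm (𝕜 := ℂ) (cj x) y
  rwa [inner_eq_dt, cj_cj, norm_cj] at this

lemma cr_add_left (x y z : C3) : cr (x + y) z = cr x z + cr y z := by
  ext i; simp; ring
lemma cr_add_right (x y z : C3) : cr x (y + z) = cr x y + cr x z := by
  ext i; simp; ring
lemma cr_smul_right (c : ℂ) (x y : C3) : cr x (c • y) = c • cr x y := by
  ext i; simp; ring
lemma cr_rsmul_left (c : ℝ) (x y : C3) : cr (c • x) y = c • cr x y := by
  ext i; simp; ring
lemma cr_rsmul_right (c : ℝ) (x y : C3) : cr x (c • y) = c • cr x y := by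
  ext i; simp; ring
lemma cv_neg (ξ : R3) : cv (-ξ) = -cv ξ := by
  ext i; simp
lemma cj_cr (x y : C3) : cj (cr x y) = cr (cj x) (cj y) := by
  ext i; simp
lemma cj_cv (ξ : R3) : cj (cv ξ) = cv ξ := by
  ext i; simp

/-- The cross product as a continuous bilinear map. -/
def crL : C3 →L[ℝ] C3 →L[ℝ] C3 :=
  LinearMap.mkContinuous₂ (LinearMap.mk₂ ℝ cr cr_add_left cr_rsmul_left cr_add_right
    (fun c x y => cr_rsmul_right c x y)) 1 (fun x y => by simpa using norm_cr_le x y)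

@[simp] lemma crL_apply (x y : C3) : crL x y = cr x y := rfl

lemma continuous_cr : Continuous fun p : C3 × C3 => cr p.1 p.2 := by
  have := (crL.continuous₂)
  exact this

lemma continuous_cv : Continuous cv := by
  refine (PiLp.continuous_toLp 2 _).comp ?_
  refine continuous_pi fun i => ?_
  exact Complex.continuous_ofReal.comp (by fun_prop)

lemma continuous_cj : Continuous cj := by
  refine (PiLp.continuous_toLp 2 _).comp ?_
  refine continuous_pi fun i => ?_
  exact Complex.continuous_conj.comp (by fun_prop)

lemma continuous_dt : Continuous fun p : C3 × C3 => dt p.1 p.2 := by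
  unfold dt
  fun_prop

/-! ### The trilinear symbol and its pointwise cancellations -/

/-- The integrand of the trilinear form `⟪w, ∇ × ((∇ × Λ^{-a} g) × u)⟫`. -/
def tri (a : ℝ) (ξ η : R3) (x y z : C3) : ℂ :=
  inner ℂ x (cr (cv ξ) (cr ((‖η‖ ^ (-a)) • cr (cv η) y) z))

lemma rpow_neg_mul_self {a r : ℝ} (ha : a < 1) (hr : 0 ≤ r) : r ^ (-a) * r = r ^ (1 - a) := by
  rcases hr.eq_or_lt with rfl | h
  -- At r = 0 both sides vanish, whatever value the convention gives to 0 ^ (-a).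
  · rw [Real.zero_rpow (by linarith : (1 - a) ≠ 0)]; simp
  · rw [← Real.rpow_add_one h.ne']; ring_nf

lemma norm_K_le {a : ℝ} (ha : a < 1) (η : R3) (y : C3) :
    ‖(‖η‖ ^ (-a)) • cr (cv η) y‖ ≤ ‖η‖ ^ (1 - a) * ‖y‖ := by
  rw [norm_smul, Real.norm_of_nonneg (by positivity)]
  calc _ ≤ ‖η‖ ^ (-a) * (‖η‖ * ‖y‖) := by
        gcongr; simpa [norm_cv] using norm_cr_le (cv η) y
    _ = _ := by rw [← mul_assoc, rpow_neg_mul_self ha (norm_nonneg _)]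

lemma norm_tri_le {a : ℝ} (ha : a < 1) (ξ η : R3) (x y z : C3) :
    ‖tri a ξ η x y z‖ ≤ ‖ξ‖ * ‖η‖ ^ (1 - a) * ‖x‖ * ‖y‖ * ‖z‖ := by
  refine (norm_inner_le_norm _ _).trans ?_
  have h1 := norm_cr_le (cv ξ) (cr ((‖η‖ ^ (-a)) • cr (cv η) y) z)
  have h2 := norm_cr_le ((‖η‖ ^ (-a)) • cr (cv η) y) z
  have h3 := norm_K_le ha η y
  rw [norm_cv] at h1
  calc _ ≤ ‖x‖ * (‖ξ‖ * ((‖η‖ ^ (1 - a) * ‖y‖) * ‖z‖)) := by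
        gcongr
        refine h1.trans ?_
        gcongr
        refine h2.trans ?_
        gcongr
    _ = _ := by ring

/-- This isolates the scalar ‖η‖ ^ (-a), the only obstruction to antisymmetry under exchange of (ξ,
x) and (η, y); the remaining dot product is the subject of `dt_cr_swap`. -/
lemma tri_eq (a : ℝ) (ξ η : R3) (x y z : C3) :
    tri a ξ η x y z = -((‖η‖ ^ (-a) : ℝ) : ℂ) *
      dt (cr (cr (cv η) y) z) (cr (cv ξ) (cj x)) := by
  simp only [tri, inner_eq_dt, dt, Fin.sum_univ_three, cr_apply, cj_apply, cv_apply,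
    PiLp.smul_apply, Complex.real_smul, zero_add, fin3_one_add_one, fin3_one_add_two,
    fin3_two_add_one, fin3_two_add_two]
  ring

/-- With p = η × y and q = ξ × x̄, the scalar triple product (p × z) · q changes sign when p and q
are exchanged; the conjugations turn this into minus the conjugate. -/
lemma dt_cr_swap (ξ η : R3) (x y z : C3) :
    dt (cr (cr (cv ξ) x) (cj z)) (cr (cv η) (cj y)) =
      -starRingEnd ℂ (dt (cr (cr (cv η) y) z) (cr (cv ξ) (cj x))) := by
  simp only [dt, Fin.sum_univ_three, cr_apply, cj_apply, cv_apply, map_add, map_sub, map_mul,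
    Complex.conj_conj, Complex.conj_ofReal, zero_add, fin3_one_add_one, fin3_one_add_two,
    fin3_two_add_one, fin3_two_add_two]
  ring

/-- A scalar commutator estimate. -/
lemma abs_rpow_neg_sub_mul_le {a x y : ℝ} (ha₀ : 0 ≤ a) (ha : a < 1) (hx : 0 ≤ x) (hy : 0 ≤ y) :
    |x ^ (-a) - y ^ (-a)| * (x * y) ≤ |x - y| * (x ^ ((1 - a) / 2) * y ^ ((1 - a) / 2)) := by
  wlog hxy : y ≤ x generalizing x y
  · have := this hy hx (le_of_not_ge hxy)
    rw [abs_sub_comm, mul_comm x y, abs_sub_comm x y, mul_comm (x ^ _)]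
    exact this
  rcases hy.eq_or_lt with rfl | hy
  · simp only [mul_zero]; positivity
  have hx : 0 < x := hy.trans_le hxy
  have h1 : x ^ (-a) ≤ y ^ (-a) := Real.rpow_le_rpow_of_nonpos hy hxy (by linarith)
  rw [abs_of_nonpos (by linarith), abs_of_nonneg (by linarith)]
  have h2 : y ^ ((1 - a) / 2) * y ^ ((1 - a) / 2) = y ^ (1 - a) := by
    rw [← Real.rpow_add hy]; ring_nf
  have h3 : y ^ ((1 - a) / 2) ≤ x ^ ((1 - a) / 2) :=
    Real.rpow_le_rpow hy.le hxy (by linarith)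
  have h4 : y ^ (1 - a) ≤ x ^ ((1 - a) / 2) * y ^ ((1 - a) / 2) := by
    rw [← h2]; gcongr
  -- For y ≤ x this gives x (1 - (y/x)^a) ≤ x - y, which is the whole commutator gain; the leftover
  -- y^(1-a) is at most the geometric mean by `h4`.
  have h5 : (y / x) ≤ (y / x) ^ a := by
    have h0 : y / x ≤ 1 := (div_le_one hx).2 hxy
    calc y / x = (y / x) ^ (1 : ℝ) := (Real.rpow_one _).symm
      _ ≤ _ := Real.rpow_le_rpow_of_exponent_ge (by positivity) h0 ha.le
  have h6 : (y / x) ^ a = x ^ (-a) * y ^ a := by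
    rw [Real.div_rpow hy.le hx.le, Real.rpow_neg hx.le]; field_simp
  have h7 : y ^ (-a) * y = y ^ (1 - a) := rpow_neg_mul_self ha hy.le
  have h8 : y ^ (1 - a) * y ^ a = y := by rw [← Real.rpow_add hy]; simp
  calc -(x ^ (-a) - y ^ (-a)) * (x * y) = (y ^ (-a) * y) * x - x ^ (-a) * y * x := by ring
    _ = y ^ (1 - a) * x - x ^ (-a) * (y ^ (1 - a) * y ^ a) * x := by rw [h7, h8]
    _ = y ^ (1 - a) * (x - x * (x ^ (-a) * y ^ a)) := by ring
    _ ≤ y ^ (1 - a) * (x - x * (y / x)) := by rw [← h6]; gcongr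
    _ = (x - y) * y ^ (1 - a) := by field_simp
    _ ≤ _ := by gcongr

/-- Pointwise cancellation behind the skew symmetry of `w ↦ ∇ × ((∇ × Λ^{-a} w) × u)`. -/
lemma re_tri_add_swap_le {a : ℝ} (ha₀ : 0 ≤ a) (ha : a < 1) (ξ η : R3) (x y z : C3) :
    (tri a ξ η x y z).re + (tri a η ξ y x (cj z)).re ≤
      (‖ξ‖ ^ ((1 - a) / 2) * ‖x‖) * (‖η‖ ^ ((1 - a) / 2) * ‖y‖) * (‖ξ - η‖ * ‖z‖) := by
  set D := dt (cr (cr (cv η) y) z) (cr (cv ξ) (cj x)) with hD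
  -- The swap sends D to minus its conjugate, so in real parts only the difference of the two scalar
  -- weights survives.
  have h1 : ((tri a ξ η x y z).re + (tri a η ξ y x (cj z)).re) =
      (‖ξ‖ ^ (-a) - ‖η‖ ^ (-a)) * D.re := by
    rw [tri_eq, tri_eq, dt_cr_swap, ← hD]
    simp only [Complex.mul_re, Complex.neg_re, Complex.neg_im, Complex.ofReal_re,
      Complex.ofReal_im, Complex.conj_re, Complex.conj_im]
    ring
  rw [h1]
  have h2 : |D.re| ≤ (‖ξ‖ * ‖η‖) * (‖x‖ * ‖y‖ * ‖z‖) := by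
    refine (Complex.abs_re_le_norm _).trans ((norm_dt_le _ _).trans ?_)
    have k1 := norm_cr_le (cr (cv η) y) z
    have k2 := norm_cr_le (cv η) y
    have k3 := norm_cr_le (cv ξ) (cj x)
    rw [norm_cv] at k2 k3
    rw [norm_cj] at k3
    calc _ ≤ (‖η‖ * ‖y‖ * ‖z‖) * (‖ξ‖ * ‖x‖) := by
          gcongr
          exact k1.trans (by gcongr)
      _ = _ := by ring
  have h3 := abs_rpow_neg_sub_mul_le ha₀ ha (norm_nonneg ξ) (norm_nonneg η)
  have h4 : |‖ξ‖ - ‖η‖| ≤ ‖ξ - η‖ := abs_norm_sub_norm_le ξ η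
  calc _ ≤ |‖ξ‖ ^ (-a) - ‖η‖ ^ (-a)| * |D.re| := by
        rw [← abs_mul]; exact le_abs_self _
    _ ≤ |‖ξ‖ ^ (-a) - ‖η‖ ^ (-a)| * ((‖ξ‖ * ‖η‖) * (‖x‖ * ‖y‖ * ‖z‖)) := by gcongr
    _ = |‖ξ‖ ^ (-a) - ‖η‖ ^ (-a)| * (‖ξ‖ * ‖η‖) * (‖x‖ * ‖y‖ * ‖z‖) := by ring
    _ ≤ |‖ξ‖ - ‖η‖| * (‖ξ‖ ^ ((1 - a) / 2) * ‖η‖ ^ ((1 - a) / 2)) * (‖x‖ * ‖y‖ * ‖z‖) := by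
        gcongr
    _ ≤ ‖ξ - η‖ * (‖ξ‖ ^ ((1 - a) / 2) * ‖η‖ ^ ((1 - a) / 2)) * (‖x‖ * ‖y‖ * ‖z‖) := by
        gcongr
    _ = _ := by ring

/-- Pointwise cancellation behind the skew symmetry of `w ↦ ∇ × (J × w)` up to order zero, for
divergence-free `w`. -/
lemma re_tri_transport_le {a : ℝ} (ha : a < 1) (ξ η : R3) (x y v : C3)
    (hx : dt (cv ξ) x = 0) (hy : dt (cv η) y = 0) :
    (tri a ξ (ξ - η) x v y).re + (tri a η (η - ξ) y (cj v) x).re ≤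
      2 * (‖x‖ * ‖y‖ * (‖ξ - η‖ ^ (2 - a) * ‖v‖)) := by
  set c : ℝ := ‖ξ - η‖ ^ (-a) with hc
  have hc' : ‖η - ξ‖ ^ (-a) = c := by rw [norm_sub_rev]
  set j : C3 := c • cr (cv (ξ - η)) v with hj
  -- Expand ξ × (j × y) = j (ξ · y) - y (ξ · j). Because η · y = 0, the first frequency may be
  -- replaced by ξ - η, so that derivative falls on v.
  have hA : tri a ξ (ξ - η) x v y = dt (cv (ξ - η)) y * inner ℂ x j
      - dt (cv ξ) j * inner ℂ x y := by
    have e1 : dt (cv (ξ - η)) y = dt (cv ξ) y := by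
      have : dt (cv (ξ - η)) y = dt (cv ξ) y - dt (cv η) y := by
        simp [dt, Fin.sum_univ_three]; ring
      rw [this, hy, sub_zero]
    rw [e1, tri, ← hc, ← hj]
    simp only [inner_eq_dt, dt, Fin.sum_univ_three, cr_apply, cj_apply, cv_apply,
      zero_add, fin3_one_add_one, fin3_one_add_two, fin3_two_add_one, fin3_two_add_two]
    ring
  have hj' : c • cr (cv (η - ξ)) (cj v) = -cj j := by
    ext i
    simp only [hj, PiLp.smul_apply, PiLp.neg_apply, cj_apply, cr_apply, cv_apply,
      Complex.real_smul, map_mul, map_sub, Complex.conj_ofReal, PiLp.sub_apply,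
      Complex.ofReal_sub]
    ring
  -- The field j is a curl at frequency ξ - η, hence orthogonal to it. The two transport symbols
  -- therefore coincide, and the transport terms of `hA` and `hB` cancel in the real part.
  have hξj : dt (cv ξ) j = dt (cv η) j := by
    simp only [hj, dt, Fin.sum_univ_three, cr_apply, cv_apply, PiLp.smul_apply, PiLp.sub_apply,
      Complex.real_smul, zero_add, fin3_one_add_one, fin3_one_add_two, fin3_two_add_one,
      fin3_two_add_two, Complex.ofReal_sub]
    ring
  have hB : tri a η (η - ξ) y (cj v) x = dt (cv (ξ - η)) x * inner ℂ y (cj j)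
      + starRingEnd ℂ (dt (cv ξ) j * inner ℂ x y) := by
    have e1 : dt (cv (ξ - η)) x = -dt (cv η) x := by
      have : dt (cv (ξ - η)) x = dt (cv ξ) x - dt (cv η) x := by
        simp [dt, Fin.sum_univ_three]; ring
      rw [this, hx, zero_sub]
    rw [e1, tri, hc', hj', hξj]
    simp only [inner_eq_dt, dt, Fin.sum_univ_three, cr_apply, cj_apply, cv_apply, PiLp.neg_apply,
      map_add, map_mul, Complex.conj_conj, Complex.conj_ofReal,
      zero_add, fin3_one_add_one, fin3_one_add_two, fin3_two_add_one, fin3_two_add_two]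
    ring
  have hjn : ‖j‖ ≤ ‖ξ - η‖ ^ (1 - a) * ‖v‖ := norm_K_le ha _ _
  have hpow : ‖ξ - η‖ * ‖ξ - η‖ ^ (1 - a) = ‖ξ - η‖ ^ (2 - a) := by
    rw [show (2 - a) = 1 + (1 - a) by ring,
      Real.rpow_add_of_nonneg (norm_nonneg _) zero_le_one (by linarith), Real.rpow_one]
  have b1 : (dt (cv (ξ - η)) y * inner ℂ x j).re ≤ ‖x‖ * ‖y‖ * (‖ξ - η‖ ^ (2 - a) * ‖v‖) := by
    refine (Complex.re_le_norm _).trans ?_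
    rw [norm_mul]
    have k1 := norm_dt_le (cv (ξ - η)) y
    rw [norm_cv] at k1
    have k2 := norm_inner_le_norm (𝕜 := ℂ) x j
    calc _ ≤ (‖ξ - η‖ * ‖y‖) * (‖x‖ * (‖ξ - η‖ ^ (1 - a) * ‖v‖)) := by
          gcongr; exact k2.trans (by gcongr)
      _ = _ := by rw [← hpow]; ring
  have b2 : (dt (cv (ξ - η)) x * inner ℂ y (cj j)).re ≤
      ‖x‖ * ‖y‖ * (‖ξ - η‖ ^ (2 - a) * ‖v‖) := by
    refine (Complex.re_le_norm _).trans ?_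
    rw [norm_mul]
    have k1 := norm_dt_le (cv (ξ - η)) x
    rw [norm_cv] at k1
    have k2 := norm_inner_le_norm (𝕜 := ℂ) y (cj j)
    rw [norm_cj] at k2
    calc _ ≤ (‖ξ - η‖ * ‖x‖) * (‖y‖ * (‖ξ - η‖ ^ (1 - a) * ‖v‖)) := by
          gcongr; exact k2.trans (by gcongr)
      _ = _ := by rw [← hpow]; ring
  rw [hA, hB, Complex.sub_re, Complex.add_re, Complex.conj_re]
  linarith

/-! ### Scalar inequalities for absorption and for radial weights -/

lemma rpow_le_eps_mul_rpow_add {α b ε : ℝ} (hα : 0 ≤ α) (hb : α < b) (hε : 0 < ε) :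
    ∃ C : ℝ, 0 ≤ C ∧ ∀ x : ℝ, 0 ≤ x → x ^ α ≤ ε * x ^ b + C := by
  -- The base is the threshold beyond which x^α ≤ ε x^b; below it, x^α is bounded by its value
  -- there.
  refine ⟨(ε⁻¹ ^ (1 / (b - α))) ^ α, by positivity, fun x hx => ?_⟩
  have hba : 0 < b - α := by linarith
  by_cases h : x ≤ ε⁻¹ ^ (1 / (b - α))
  · have : x ^ α ≤ (ε⁻¹ ^ (1 / (b - α))) ^ α := Real.rpow_le_rpow hx h hα
    have h0 : 0 ≤ ε * x ^ b := by positivity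
    linarith
  · push Not at h
    have hx0 : 0 < x := lt_of_le_of_lt (by positivity) h
    have h1 : ε⁻¹ ≤ x ^ (b - α) := by
      calc ε⁻¹ = (ε⁻¹ ^ (1 / (b - α))) ^ (b - α) := by
            rw [← Real.rpow_mul (by positivity), one_div_mul_cancel hba.ne', Real.rpow_one]
        _ ≤ _ := Real.rpow_le_rpow (by positivity) h.le hba.le
    have h2 : x ^ b = x ^ (b - α) * x ^ α := by rw [← Real.rpow_add hx0]; ring_nf
    have h3 : x ^ α ≤ ε * x ^ b := by
      rw [h2, ← mul_assoc]
      have : 1 ≤ ε * x ^ (b - α) := by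
        calc 1 = ε * ε⁻¹ := (mul_inv_cancel₀ hε.ne').symm
          _ ≤ _ := by gcongr
      nlinarith [Real.rpow_nonneg hx α]
    have h0 : 0 ≤ (ε⁻¹ ^ (1 / (b - α))) ^ α := by positivity
    linarith

/-- Almost additivity of a radial weight `ψ` of growth between order one and order `σ`. -/
lemma abs_weight_sub_sub_le {ψ : ℝ → ℝ} {σ : ℝ} (hσ : 1 ≤ σ) (hψ : ∀ r, 0 ≤ ψ r)
    (hup : ∀ r l, 0 ≤ r → 1 ≤ l → ψ (l * r) ≤ l ^ σ * ψ r)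
    (hlow : ∀ r l, 0 ≤ r → 1 ≤ l → l * ψ r ≤ ψ (l * r))
    {x y z : ℝ} (hx : 0 ≤ x) (hy : 0 < y) (hz : 0 ≤ z) (hzy : z ≤ y) (hxy : |x - y| ≤ z) :
    |ψ x - ψ y - ψ z| ≤ (2 ^ σ + σ + 1) * (ψ y * (z / y)) := by
  set θ := z / y with hθ
  have hθ0 : 0 ≤ θ := by positivity
  have hθ1 : θ ≤ 1 := (div_le_one hy).2 hzy
  have hzθ : z = θ * y := by rw [hθ]; field_simp
  -- Superlinear growth makes ψ(z) a small part of ψ(y), with gain z/y; taken at r = 0, it forces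
  -- ψ(0) = 0.
  have hψz : ψ z ≤ ψ y * θ := by
    rcases hz.eq_or_lt with h0 | h0
    · have h1 := hlow 0 2 le_rfl (by norm_num)
      rw [mul_zero] at h1
      have h2 := hψ 0
      rw [← h0]
      have : ψ 0 = 0 := by linarith
      rw [this]; exact mul_nonneg (hψ _) hθ0
    · have h1 := hlow z (y / z) hz ((one_le_div h0).2 hzy)
      rw [div_mul_cancel₀ _ h0.ne'] at h1
      rw [hθ]
      calc ψ z = (y / z * ψ z) * (z / y) := by field_simp
        _ ≤ _ := by gcongr
  have h2σ : (0 : ℝ) ≤ 2 ^ σ := by positivity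
  have hP : 0 ≤ ψ y * θ := mul_nonneg (hψ y) hθ0
  -- A substitute for the mean value theorem, as ψ need not be differentiable: dilation by x/y or
  -- y/x together with the chord bound for the convex function r^σ when y ≤ x, and Bernoulli's
  -- inequality when x ≤ y.
  have hbd : |ψ x - ψ y| ≤ (2 ^ σ + σ) * (ψ y * θ) := by
    rcases le_total y x with h | h
    · have hl : 1 ≤ x / y := (one_le_div hy).2 h
      have h1 := hup y (x / y) hy.le hl
      rw [div_mul_cancel₀ _ hy.ne'] at h1
      have h1' := hlow y (x / y) hy.le hl
      rw [div_mul_cancel₀ _ hy.ne'] at h1'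
      have h0 : ψ y ≤ ψ x := by nlinarith [hψ y]
      rw [abs_of_nonneg (by linarith)] at hxy ⊢
      have h3 : x / y ≤ 1 + θ := by
        rw [hθ, div_le_iff₀ hy]; field_simp; linarith
      have h4 : (x / y) ^ σ ≤ (1 + θ) ^ σ := Real.rpow_le_rpow (by positivity) h3 (by linarith)
      have h5 : (1 + θ) ^ σ ≤ (1 - θ) * 1 + θ * 2 ^ σ := by
        have := (convexOn_rpow hσ).2 (Set.mem_Ici.2 zero_le_one) (Set.mem_Ici.2 zero_le_two)
          (by linarith : 0 ≤ 1 - θ) hθ0 (by ring)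
        simp only [smul_eq_mul, Real.one_rpow] at this
        rwa [show (1 - θ) * 1 + θ * 2 = 1 + θ by ring] at this
      have h6 : (x / y) ^ σ ≤ 1 + θ * 2 ^ σ := by linarith
      have h7 : ψ x ≤ (1 + θ * 2 ^ σ) * ψ y := h1.trans (by gcongr; exact hψ y)
      nlinarith
    · rcases hx.eq_or_lt with h0 | h0
      · have h1 := hlow 0 2 le_rfl (by norm_num)
        rw [mul_zero] at h1
        have h2 := hψ 0
        have h3 : ψ 0 = 0 := by linarith
        rw [← h0, h3, zero_sub, abs_neg, abs_of_nonneg (hψ y)]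
        rw [← h0, zero_sub, abs_neg, abs_of_pos hy] at hxy
        have : θ = 1 := le_antisymm hθ1 (by rw [hθ, one_le_div hy]; exact hxy)
        rw [this]; nlinarith [hψ y]
      have hl : 1 ≤ y / x := (one_le_div h0).2 h
      have h1 := hup x (y / x) hx hl
      rw [div_mul_cancel₀ _ h0.ne'] at h1
      have h1' := hlow x (y / x) hx hl
      rw [div_mul_cancel₀ _ h0.ne'] at h1'
      have h00 : ψ x ≤ ψ y := by nlinarith [hψ x]
      rw [abs_of_nonpos (by linarith)] at hxy ⊢
      have h3 : 1 - θ ≤ x / y := by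
        rw [hθ, le_div_iff₀ hy]; field_simp; linarith
      have h4 : 1 + σ * (x / y - 1) ≤ (x / y) ^ σ := by
        have := one_add_mul_self_le_rpow_one_add (s := x / y - 1)
          (by have : 0 ≤ x / y := by positivity
              linarith) hσ
        simpa using this
      have h5 : (x / y) ^ σ * ψ y ≤ ψ x := by
        have : (x / y) ^ σ * (y / x) ^ σ = 1 := by
          rw [← Real.mul_rpow (by positivity) (by positivity)]
          rw [div_mul_div_cancel₀ hy.ne', div_self h0.ne', Real.one_rpow]
        calc _ ≤ (x / y) ^ σ * ((y / x) ^ σ * ψ x) := by gcongr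
          _ = ψ x := by rw [← mul_assoc, this, one_mul]
      have h6 : 1 - σ * θ ≤ (x / y) ^ σ := by nlinarith
      have h7 : (1 - σ * θ) * ψ y ≤ ψ x := le_trans (by gcongr; exact hψ y) h5
      nlinarith
  calc |ψ x - ψ y - ψ z| ≤ |ψ x - ψ y| + |ψ z| := abs_sub _ _
    _ ≤ (2 ^ σ + σ) * (ψ y * θ) + ψ y * θ := by
        rw [abs_of_nonneg (hψ z)]; gcongr
    _ = _ := by ring

/-! ### Bessel weights -/

/-- The Bessel weight `(1 + |ξ|²)^{s/2}`. -/
def bw (s : ℝ) (ξ : R3) : ℝ := (1 + ‖ξ‖ ^ 2) ^ (s / 2)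

lemma bw_pos (s : ℝ) (ξ : R3) : 0 < bw s ξ := by unfold bw; positivity
lemma bw_nonneg (s : ℝ) (ξ : R3) : 0 ≤ bw s ξ := (bw_pos s ξ).le
lemma bw_add (s t : ℝ) (ξ : R3) : bw (s + t) ξ = bw s ξ * bw t ξ := by
  unfold bw; rw [← Real.rpow_add (by positivity)]; ring_nf
@[simp] lemma bw_zero (ξ : R3) : bw 0 ξ = 1 := by simp [bw]
lemma bw_neg_mul (s : ℝ) (ξ : R3) : bw (-s) ξ * bw s ξ = 1 := by rw [← bw_add]; simp
lemma bw_mul_neg (s : ℝ) (ξ : R3) : bw s ξ * bw (-s) ξ = 1 := by rw [← bw_add]; simp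
lemma bw_mono {s t : ℝ} (h : s ≤ t) (ξ : R3) : bw s ξ ≤ bw t ξ := by
  unfold bw
  exact Real.rpow_le_rpow_of_exponent_le (by nlinarith [sq_nonneg ‖ξ‖]) (by linarith)
lemma one_le_bw {s : ℝ} (h : 0 ≤ s) (ξ : R3) : 1 ≤ bw s ξ := by
  rw [← bw_zero ξ]; exact bw_mono h ξ
lemma bw_le_one {s : ℝ} (h : s ≤ 0) (ξ : R3) : bw s ξ ≤ 1 := by
  rw [← bw_zero ξ]; exact bw_mono h ξ
lemma bw_neg_arg (s : ℝ) (ξ : R3) : bw s (-ξ) = bw s ξ := by simp [bw]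
lemma continuous_bw (s : ℝ) : Continuous (bw s) := by
  unfold bw
  exact Continuous.rpow_const (by fun_prop) fun ξ => Or.inl (by positivity)
lemma measurable_bw (s : ℝ) : Measurable (bw s) := (continuous_bw s).measurable
lemma norm_rpow_le_bw {r : ℝ} (hr : 0 ≤ r) (ξ : R3) : ‖ξ‖ ^ r ≤ bw r ξ := by
  unfold bw
  calc ‖ξ‖ ^ r = (‖ξ‖ ^ (2 : ℝ)) ^ (r / 2) := by
        rw [← Real.rpow_mul (norm_nonneg _)]; ring_nf
    _ ≤ _ := by
        refine Real.rpow_le_rpow (by positivity) ?_ (by linarith)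
        rw [Real.rpow_two]; linarith
lemma norm_le_bw_one (ξ : R3) : ‖ξ‖ ≤ bw 1 ξ := by
  simpa using norm_rpow_le_bw zero_le_one ξ

/-- The cost of the nonlinearity without any cancellation: since |ξ| ≤ |η| + |ξ-η|, it suffices to
have 2-a derivatives on each factor. -/
lemma norm_mul_rpow_le_bw {a : ℝ} (ha : a < 1) (ξ η : R3) :
    ‖ξ‖ * ‖η‖ ^ (1 - a) ≤ 2 * (bw (2 - a) η * bw (2 - a) (ξ - η)) := by
  have h1 : ‖ξ‖ ≤ ‖η‖ + ‖ξ - η‖ := by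
    calc ‖ξ‖ = ‖η + (ξ - η)‖ := by congr 1; abel
      _ ≤ _ := norm_add_le _ _
  have h2 := norm_le_bw_one η
  have h3 := norm_le_bw_one (ξ - η)
  have h4 := one_le_bw zero_le_one η
  have h5 := one_le_bw zero_le_one (ξ - η)
  have h6 : ‖ξ‖ ≤ 2 * (bw 1 η * bw 1 (ξ - η)) := by nlinarith
  have h7 := norm_rpow_le_bw (r := 1 - a) (by linarith) η
  have h8 : bw 1 (ξ - η) ≤ bw (2 - a) (ξ - η) := bw_mono (by linarith) _
  have h9 : bw (2 - a) η = bw 1 η * bw (1 - a) η := by rw [← bw_add]; ring_nf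
  rw [h9]
  have := bw_pos 1 η
  have := bw_pos (1 - a) η
  calc ‖ξ‖ * ‖η‖ ^ (1 - a) ≤ (2 * (bw 1 η * bw (2 - a) (ξ - η))) * bw (1 - a) η := by
        refine mul_le_mul (h6.trans ?_) h7 (by positivity) ?_
        · gcongr
        · exact (norm_nonneg ξ).trans (h6.trans (by gcongr))
    _ = _ := by ring

/-! ### Young inequalities and changes of variables -/

/-- Young's inequality `L² * L¹ ⊂ L²`. -/
lemma lintegral_conv_sq_le {p r : R3 → ℝ≥0∞} (hp : AEMeasurable p) (hr : AEMeasurable r) :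
    ∫⁻ ξ, (∫⁻ η, p η * r (ξ - η)) ^ 2 ≤ (∫⁻ η, p η ^ 2) * (∫⁻ ζ, r ζ) ^ 2 := by
  have hrs : ∀ ξ : R3, ∫⁻ η, r (ξ - η) = ∫⁻ ζ, r ζ := fun ξ => lintegral_sub_left_eq_self r ξ
  have hrm : ∀ ξ : R3, AEMeasurable fun η => r (ξ - η) := fun ξ =>
    hr.comp_quasiMeasurePreserving (quasiMeasurePreserving_sub_left_of_right_invariant volume ξ)
  have h1 : ∀ ξ : R3, (∫⁻ η, p η * r (ξ - η)) ^ 2 ≤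
      (∫⁻ η, p η ^ 2 * r (ξ - η)) * ∫⁻ ζ, r ζ := by
    intro ξ
    -- Cauchy–Schwarz after splitting the kernel as r = r^(1/2) r^(1/2), with p attached to one
    -- half.
    have h := ENNReal.lintegral_mul_le_Lp_mul_Lq volume Real.HolderConjugate.two_two
      (f := fun η => p η * r (ξ - η) ^ (1 / 2 : ℝ)) (g := fun η => r (ξ - η) ^ (1 / 2 : ℝ))
      (hp.mul ((hrm ξ).pow_const _)) ((hrm ξ).pow_const _)
    have hsq : ∀ x : ℝ≥0∞, x ^ (1 / 2 : ℝ) * x ^ (1 / 2 : ℝ) = x := by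
      intro x
      rw [← ENNReal.rpow_add_of_nonneg _ _ (by norm_num) (by norm_num)]
      norm_num
    have hsq2 : ∀ x : ℝ≥0∞, (x ^ (1 / 2 : ℝ)) ^ (2 : ℝ) = x := by
      intro x; rw [← ENNReal.rpow_mul]; norm_num
    simp only [Pi.mul_apply, mul_assoc, hsq, hsq2, hrs,
      ENNReal.mul_rpow_of_nonneg _ _ (zero_le_two : (0 : ℝ) ≤ 2)] at h
    calc _ ≤ ((∫⁻ η, p η ^ (2 : ℝ) * r (ξ - η)) ^ (1 / 2 : ℝ) *
          (∫⁻ ζ, r ζ) ^ (1 / 2 : ℝ)) ^ 2 := by gcongr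
      _ = _ := by
        rw [mul_pow, sq, sq, hsq, hsq]; simp
  calc _ ≤ ∫⁻ ξ, (∫⁻ η, p η ^ 2 * r (ξ - η)) * ∫⁻ ζ, r ζ := lintegral_mono h1
    _ = (∫⁻ ξ, ∫⁻ η, p η ^ 2 * r (ξ - η)) * ∫⁻ ζ, r ζ := by
        refine lintegral_mul_const'' _ ?_
        refine AEMeasurable.lintegral_prod_right' (f := fun z : R3 × R3 => p z.2 ^ 2 * r (z.1 - z.2))
          ?_
        exact ((hp.comp_quasiMeasurePreserving Measure.quasiMeasurePreserving_snd).pow_const 2).mul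
          (hr.comp_quasiMeasurePreserving (quasiMeasurePreserving_sub_of_right_invariant _ _))
    _ = (∫⁻ η, ∫⁻ ξ, p η ^ 2 * r (ξ - η)) * ∫⁻ ζ, r ζ := by
        congr 1
        refine lintegral_lintegral_swap ?_
        exact ((hp.comp_quasiMeasurePreserving Measure.quasiMeasurePreserving_snd).pow_const 2).mul
          (hr.comp_quasiMeasurePreserving (quasiMeasurePreserving_sub_of_right_invariant _ _))
    _ = (∫⁻ η, p η ^ 2 * ∫⁻ ζ, r ζ) * ∫⁻ ζ, r ζ := by
        congr 1
        refine lintegral_congr fun η => ?_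
        rw [lintegral_const_mul'', lintegral_sub_right_eq_self]
        exact hr.comp_quasiMeasurePreserving
          (measurePreserving_sub_right volume η).quasiMeasurePreserving
    _ = _ := by
        rw [lintegral_mul_const'' _ (hp.pow_const 2)]; ring

/-- The shear (x, y) ↦ (x, y - x) preserves Lebesgue measure and reduces the integrand to a tensor
product. -/
lemma integrable_prod_fst_sub {p r : R3 → ℝ} (hp : Integrable p) (hr : Integrable r) :
    Integrable (fun z : R3 × R3 => p z.1 * r (z.1 - z.2)) (volume.prod volume) ∧
      ∫ z : R3 × R3, p z.1 * r (z.1 - z.2) ∂(volume.prod volume) = (∫ ξ, p ξ) * ∫ ξ, r ξ := by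
  have hr' : Integrable (fun ξ => r (-ξ)) := hr.comp_neg
  have hmp := measurePreserving_prod_neg_add (volume : Measure R3) (volume : Measure R3)
  have hme : MeasurableEmbedding (fun z : R3 × R3 => (z.1, -z.1 + z.2)) :=
    (Homeomorph.mk (Equiv.mk (fun z : R3 × R3 => (z.1, -z.1 + z.2)) (fun z => (z.1, z.1 + z.2))
      (fun z => by simp) (fun z => by simp)) (by fun_prop) (by fun_prop)).measurableEmbedding
  have heq : (fun z : R3 × R3 => p z.1 * r (z.1 - z.2)) =
      (fun z : R3 × R3 => p z.1 * r (-z.2)) ∘ (fun z => (z.1, -z.1 + z.2)) := by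
    ext z; simp [sub_eq_add_neg, add_comm]
  refine ⟨?_, ?_⟩
  · rw [heq]
    exact (hmp.integrable_comp_emb hme).2 (hp.mul_prod hr')
  · rw [heq]
    have := hmp.integral_comp hme (fun z : R3 × R3 => p z.1 * r (-z.2))
    simp only [Function.comp_def]
    rw [this, integral_prod_mul p (fun ξ => r (-ξ)), integral_neg_eq_self]

lemma integrable_prod_snd_sub {p r : R3 → ℝ} (hp : Integrable p) (hr : Integrable r) :
    Integrable (fun z : R3 × R3 => p z.2 * r (z.1 - z.2)) (volume.prod volume) ∧
      ∫ z : R3 × R3, p z.2 * r (z.1 - z.2) ∂(volume.prod volume) = (∫ ξ, p ξ) * ∫ ξ, r ξ := by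
  have h := integrable_prod_fst_sub hp hr.comp_neg
  have heq : (fun z : R3 × R3 => p z.2 * r (z.1 - z.2)) =
      (fun z : R3 × R3 => p z.1 * r (-(z.1 - z.2))) ∘ Prod.swap := by
    ext z; simp
  refine ⟨?_, ?_⟩
  · rw [heq]; exact h.1.swap
  · rw [heq]
    have := integral_prod_swap (μ := (volume : Measure R3)) (ν := (volume : Measure R3))
      (fun z : R3 × R3 => p z.1 * r (-(z.1 - z.2)))
    simp only [Function.comp_def]
    rw [this, h.2, integral_neg_eq_self]

/-- The trilinear Young inequality with two equal factors. -/
lemma integral_young_le {p r : R3 → ℝ} {F : R3 × R3 → ℝ} (hp : Integrable fun ξ => p ξ ^ 2)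
    (hr : Integrable r) (hr0 : ∀ ξ, 0 ≤ r ξ) (hF : Integrable F (volume.prod volume))
    (hle : ∀ᵐ z ∂(volume.prod volume : Measure (R3 × R3)), F z ≤ p z.1 * p z.2 * r (z.1 - z.2)) :
    ∫ z, F z ∂(volume.prod volume) ≤ (∫ ξ, p ξ ^ 2) * ∫ ξ, r ξ := by
  have h1 := integrable_prod_fst_sub hp hr
  have h2 := integrable_prod_snd_sub hp hr
  -- The elementary bound 2 p(ξ) p(η) ≤ p(ξ)² + p(η)² decouples the two equal factors; each half is
  -- then computed exactly.
  calc _ ≤ ∫ z : R3 × R3, (1 / 2) * (p z.1 ^ 2 * r (z.1 - z.2) + p z.2 ^ 2 * r (z.1 - z.2))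
          ∂(volume.prod volume) := by
        refine integral_mono_ae hF ((h1.1.add h2.1).const_mul _) ?_
        filter_upwards [hle] with z hz
        refine hz.trans ?_
        have := hr0 (z.1 - z.2)
        nlinarith [mul_nonneg (sq_nonneg (p z.1 - p z.2)) this]
    _ = _ := by
        rw [integral_const_mul, integral_add h1.1 h2.1, h1.2, h2.2]; ring

lemma integrable_young {p q r : R3 → ℝ} (hp : Integrable fun ξ => p ξ ^ 2)
    (hq : Integrable fun ξ => q ξ ^ 2)
    (hr : Integrable r) (hr0 : ∀ ξ, 0 ≤ r ξ)
    {G : Type*} [NormedAddCommGroup G] {F : R3 × R3 → G}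
    (hF : AEStronglyMeasurable F (volume.prod volume))
    (hle : ∀ᵐ z ∂(volume.prod volume : Measure (R3 × R3)),
      ‖F z‖ ≤ p z.1 * q z.2 * r (z.1 - z.2)) :
    Integrable F (volume.prod volume) := by
  have h1 := integrable_prod_fst_sub hp hr
  have h2 := integrable_prod_snd_sub hq hr
  refine Integrable.mono' (h1.1.add h2.1) hF ?_
  filter_upwards [hle] with z hz
  refine hz.trans ?_
  have := hr0 (z.1 - z.2)
  simp only [Pi.add_apply]
  nlinarith [mul_nonneg (sq_nonneg (p z.1 - q z.2)) this, mul_nonneg (sq_nonneg (p z.1)) this,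
    mul_nonneg (sq_nonneg (q z.2)) this]

/-- The substitution `η ↦ ξ - η` in a double integral. -/
lemma measurePreserving_sub_snd :
    MeasurePreserving (fun z : R3 × R3 => (z.1, z.1 - z.2)) (volume.prod volume)
      (volume.prod volume) := by
  have h1 := measurePreserving_prod_neg_add (volume : Measure R3) (volume : Measure R3)
  have h2 : MeasurePreserving (fun z : R3 × R3 => (z.1, -z.2)) (volume.prod volume)
      (volume.prod volume) :=
    (MeasurePreserving.id (volume : Measure R3)).prod (Measure.measurePreserving_neg volume)
  have := h2.comp h1
  convert this using 1
  ext z <;> simp [sub_eq_add_neg, add_comm]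

lemma measurableEmbedding_sub_snd :
    MeasurableEmbedding (fun z : R3 × R3 => (z.1, z.1 - z.2)) :=
  (Homeomorph.mk (Equiv.mk (fun z : R3 × R3 => (z.1, z.1 - z.2)) (fun z => (z.1, z.1 - z.2))
      (fun z => by simp) (fun z => by simp)) (by fun_prop) (by fun_prop)).measurableEmbedding

/-! ### Weighted L² spaces on the frequency side -/

/-- `f` is square integrable with respect to the weight `(1 + |ξ|²)^s`. -/
abbrev Hs (s : ℝ) (f : R3 → C3) : Prop := MemLp (fun ξ => bw s ξ • f ξ) 2 volume

/-- The weighted norm going with `Hs`. -/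
def hsNorm (s : ℝ) (f : R3 → C3) : ℝ := √(∫ ξ, (bw s ξ * ‖f ξ‖) ^ 2)

lemma Hs.aesm {s : ℝ} {f : R3 → C3} (hf : Hs s f) : AEStronglyMeasurable f volume := by
  have h := (measurable_bw (-s)).aestronglyMeasurable.smul hf.1
  refine h.congr (Filter.Eventually.of_forall fun ξ => ?_)
  simp [smul_smul, bw_neg_mul]

lemma Hs.memLp_smul {s : ℝ} {f : R3 → C3} (hf : Hs s f) {m : R3 → ℝ} (hm : Measurable m) {C : ℝ}
    (hC : ∀ ξ, |m ξ| ≤ C * bw s ξ) : MemLp (fun ξ => m ξ • f ξ) 2 volume := by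
  refine MemLp.of_le_mul (c := C) hf (hm.aestronglyMeasurable.smul hf.aesm)
    (Filter.Eventually.of_forall fun ξ => ?_)
  rw [norm_smul, norm_smul, Real.norm_eq_abs, Real.norm_of_nonneg (bw_nonneg s ξ), ← mul_assoc]
  gcongr
  exact hC ξ

lemma Hs.integrable_sq {s : ℝ} {f : R3 → C3} (hf : Hs s f) {m : R3 → ℝ} (hm : Measurable m)
    {C : ℝ} (hC : ∀ ξ, |m ξ| ≤ C * bw s ξ) : Integrable fun ξ => (m ξ * ‖f ξ‖) ^ 2 := by
  have h := (hf.memLp_smul hm hC).integrable_norm_pow (by norm_num)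
  refine h.congr (Filter.Eventually.of_forall fun ξ => ?_)
  simp [norm_smul, mul_pow]

lemma Hs.integrable_hsNorm {s : ℝ} {f : R3 → C3} (hf : Hs s f) :
    Integrable fun ξ => (bw s ξ * ‖f ξ‖) ^ 2 :=
  hf.integrable_sq (measurable_bw s) (C := 1) fun ξ => by
    rw [one_mul, abs_of_pos (bw_pos s ξ)]

lemma hsNorm_nonneg (s : ℝ) (f : R3 → C3) : 0 ≤ hsNorm s f := Real.sqrt_nonneg _

lemma hsNorm_sq (s : ℝ) (f : R3 → C3) : hsNorm s f ^ 2 = ∫ ξ, (bw s ξ * ‖f ξ‖) ^ 2 :=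
  Real.sq_sqrt (integral_nonneg fun _ => sq_nonneg _)

lemma integrable_bw_sq {r : ℝ} (hr : r < -(3 / 2)) : Integrable fun ξ => bw r ξ ^ 2 := by
  have h := integrable_rpow_neg_one_add_norm_sq (E := R3) (μ := volume) (r := -2 * r)
    (by simp; linarith)
  refine h.congr (Filter.Eventually.of_forall fun ξ => ?_)
  have : bw r ξ ^ 2 = bw (r + r) ξ := by rw [bw_add, sq]
  change _ = bw r ξ ^ 2
  rw [this]
  simp only [bw]
  ring_nf

/-- The Sobolev constant of the embedding of `Hs s` into the weighted `L¹` space. -/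
def sobConst (q s : ℝ) : ℝ := √(∫ ξ, bw (q - s) ξ ^ 2)

lemma sobConst_nonneg (q s : ℝ) : 0 ≤ sobConst q s := Real.sqrt_nonneg _

/-- Cauchy–Schwarz between `bw (q - s)` and `bw s` times f; the gap 3/2 is half the dimension. With
q = 2 - a this is the source of the threshold 7/2 - a. -/
lemma Hs.integrable_bw {q s : ℝ} {f : R3 → C3} (hf : Hs s f) (hqs : q + 3 / 2 < s) :
    Integrable (fun ξ => bw q ξ * ‖f ξ‖) ∧
      ∫ ξ, bw q ξ * ‖f ξ‖ ≤ sobConst q s * hsNorm s f := by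
  have h1 : MemLp (fun ξ => bw (q - s) ξ) 2 volume := by
    rw [memLp_two_iff_integrable_sq (measurable_bw _).aestronglyMeasurable]
    exact integrable_bw_sq (by linarith)
  have h2 : MemLp (fun ξ => bw s ξ * ‖f ξ‖) 2 volume := by
    refine hf.norm.congr_norm ?_ (Filter.Eventually.of_forall fun ξ => ?_)
    · exact (measurable_bw _).aestronglyMeasurable.mul hf.aesm.norm
    · rw [norm_norm, norm_smul, norm_mul, norm_norm]
  have heq : ∀ ξ, bw (q - s) ξ * (bw s ξ * ‖f ξ‖) = bw q ξ * ‖f ξ‖ := fun ξ => by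
    rw [← mul_assoc, ← bw_add]; ring_nf
  refine ⟨?_, ?_⟩
  · exact (h1.integrable_mul h2).congr (Filter.Eventually.of_forall heq)
  · have := integral_mul_le_Lp_mul_Lq_of_nonneg (μ := volume) Real.HolderConjugate.two_two
      (f := fun ξ => bw (q - s) ξ) (g := fun ξ => bw s ξ * ‖f ξ‖)
      (Filter.Eventually.of_forall fun ξ => bw_nonneg _ _)
      (Filter.Eventually.of_forall fun ξ => mul_nonneg (bw_nonneg _ _) (norm_nonneg _))
      (by simpa using h1) (by simpa using h2)
    simp only [heq, Real.rpow_two, ← Real.sqrt_eq_rpow] at this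
    exact this

lemma Hs.integrable_mul_norm {q s : ℝ} {f : R3 → C3} (hf : Hs s f) (hqs : q + 3 / 2 < s)
    {m : R3 → ℝ} (hm : Measurable m) (hm0 : ∀ ξ, 0 ≤ m ξ) (hmq : ∀ ξ, m ξ ≤ bw q ξ) :
    Integrable (fun ξ => m ξ * ‖f ξ‖) ∧ ∫ ξ, m ξ * ‖f ξ‖ ≤ sobConst q s * hsNorm s f := by
  have h := hf.integrable_bw hqs
  have h1 : Integrable (fun ξ => m ξ * ‖f ξ‖) := by
    refine h.1.mono' (hm.aestronglyMeasurable.mul hf.aesm.norm)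
      (Filter.Eventually.of_forall fun ξ => ?_)
    rw [Real.norm_of_nonneg (mul_nonneg (hm0 ξ) (norm_nonneg _))]
    gcongr
    exact hmq ξ
  refine ⟨h1, le_trans (integral_mono h1 h.1 fun ξ => ?_) h.2⟩
  simp only
  gcongr
  exact hmq ξ

/-! ### Integrated cancellations and the weighted energy estimate -/

/-- `f` is (almost everywhere) the Fourier transform of a real valued function. -/
def Herm (f : R3 → C3) : Prop := ∀ᵐ ξ, f (-ξ) = cj (f ξ)

/-- `f` is (almost everywhere) the Fourier transform of a divergence-free field. -/
def DivFree (f : R3 → C3) : Prop := ∀ᵐ ξ, dt (cv ξ) (f ξ) = 0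

lemma Herm.ae_sub {f : R3 → C3} (hf : Herm f) :
    ∀ᵐ z ∂(volume.prod volume : Measure (R3 × R3)), f (z.2 - z.1) = cj (f (z.1 - z.2)) := by
  have := (quasiMeasurePreserving_sub_of_right_invariant (volume : Measure R3)
    (volume : Measure R3)).ae hf
  filter_upwards [this] with z hz
  rw [← hz, neg_sub]

lemma aesm_fst {f : R3 → C3} (hf : AEStronglyMeasurable f volume) :
    AEStronglyMeasurable (fun z : R3 × R3 => f z.1) (volume.prod volume) :=
  hf.comp_quasiMeasurePreserving Measure.quasiMeasurePreserving_fst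

lemma aesm_snd {f : R3 → C3} (hf : AEStronglyMeasurable f volume) :
    AEStronglyMeasurable (fun z : R3 × R3 => f z.2) (volume.prod volume) :=
  hf.comp_quasiMeasurePreserving Measure.quasiMeasurePreserving_snd

lemma aesm_sub {f : R3 → C3} (hf : AEStronglyMeasurable f volume) :
    AEStronglyMeasurable (fun z : R3 × R3 => f (z.1 - z.2)) (volume.prod volume) :=
  hf.comp_quasiMeasurePreserving (quasiMeasurePreserving_sub_of_right_invariant _ _)

lemma aesm_cr {α : Type*} [MeasurableSpace α] {μ : Measure α} {f g : α → C3}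
    (hf : AEStronglyMeasurable f μ) (hg : AEStronglyMeasurable g μ) :
    AEStronglyMeasurable (fun z => cr (f z) (g z)) μ :=
  continuous_cr.comp_aestronglyMeasurable (hf.prodMk hg)

lemma aesm_tri {a : ℝ} {x y u : R3 → C3} (hx : AEStronglyMeasurable x volume)
    (hy : AEStronglyMeasurable y volume) (hu : AEStronglyMeasurable u volume) :
    AEStronglyMeasurable (fun z : R3 × R3 => tri a z.1 z.2 (x z.1) (y z.2) (u (z.1 - z.2)))
      (volume.prod volume) := by
  unfold tri
  have h1 : AEStronglyMeasurable (fun z : R3 × R3 => ‖z.2‖ ^ (-a)) (volume.prod volume) :=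
    (Measurable.pow_const (by fun_prop) _).aestronglyMeasurable
  have h2 : AEStronglyMeasurable (fun z : R3 × R3 => cv z.2) (volume.prod volume) :=
    (continuous_cv.comp continuous_snd).aestronglyMeasurable
  have h3 : AEStronglyMeasurable (fun z : R3 × R3 => cv z.1) (volume.prod volume) :=
    (continuous_cv.comp continuous_fst).aestronglyMeasurable
  exact (aesm_fst hx).inner (aesm_cr h3 (aesm_cr (h1.smul (aesm_cr h2 (aesm_snd hy)))
    (aesm_sub hu)))

/-- The factor |ξ| is given to x and |η|^(1-a) to y, both then in L², while u is in L¹: the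
trilinear Young inequality applies. This absolute convergence justifies all later symmetrizations.
-/
lemma integrable_tri {a s : ℝ} (ha : a < 1) (hs : 7 / 2 - a < s)
    {x y u : R3 → C3} (hx : Hs s x) (hy : Hs s y) (hu : Hs s u) :
    Integrable (fun z : R3 × R3 => tri a z.1 z.2 (x z.1) (y z.2) (u (z.1 - z.2)))
      (volume.prod volume) := by
  have h1 : Integrable fun ξ => (‖ξ‖ * ‖x ξ‖) ^ 2 :=
    hx.integrable_sq measurable_norm (C := 1) fun ξ => by
      rw [abs_norm, one_mul]; exact (norm_le_bw_one ξ).trans (bw_mono (by linarith) ξ)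
  have h2 : Integrable fun ξ => (‖ξ‖ ^ (1 - a) * ‖y ξ‖) ^ 2 :=
    hy.integrable_sq (measurable_norm.pow_const _) (C := 1) fun ξ => by
      rw [abs_of_nonneg (by positivity), one_mul]
      exact (norm_rpow_le_bw (by linarith) ξ).trans (bw_mono (by linarith) ξ)
  have h3 : Integrable fun ξ => ‖u ξ‖ := by
    simpa using (hu.integrable_bw (q := 0) (by linarith)).1
  refine integrable_young h1 h2 h3 (fun ξ => norm_nonneg _) (aesm_tri hx.aesm hy.aesm hu.aesm)
    (Filter.Eventually.of_forall fun z => ?_)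
  refine (norm_tri_le ha _ _ _ _ _).trans (le_of_eq (by ring))

/-- Exchanging the variables leaves the integral unchanged, and the Hermitian symmetry of u turns
u(η-ξ) into the conjugate of u(ξ-η). Twice the integral is thus governed by the pointwise
cancellation `re_tri_add_swap_le`. -/
lemma re_integral_tri_skew_le {a s : ℝ} (ha₀ : 0 ≤ a) (ha : a < 1) (hs : 7 / 2 - a < s)
    {w u : R3 → C3} (hw : Hs s w) (hu : Hs s u) (hherm : Herm u) :
    (∫ z : R3 × R3, tri a z.1 z.2 (w z.1) (w z.2) (u (z.1 - z.2)) ∂(volume.prod volume)).re ≤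
      (∫ ξ, (‖ξ‖ ^ ((1 - a) / 2) * ‖w ξ‖) ^ 2) * ∫ ξ, ‖ξ‖ * ‖u ξ‖ := by
  set Φ : R3 × R3 → ℂ := fun z => tri a z.1 z.2 (w z.1) (w z.2) (u (z.1 - z.2)) with hΦ
  have hint : Integrable Φ (volume.prod volume) := integrable_tri ha hs hw hw hu
  have hre : Integrable (fun z => (Φ z).re) (volume.prod volume) := hint.re
  have hre' : Integrable (fun z : R3 × R3 => (Φ z.swap).re) (volume.prod volume) := hre.swap
  have hsw : ∫ z, (Φ z.swap).re ∂(volume.prod volume : Measure (R3 × R3)) =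
      ∫ z, (Φ z).re ∂(volume.prod volume) :=
    integral_prod_swap (μ := (volume : Measure R3)) (ν := (volume : Measure R3))
      (fun z => (Φ z).re)
  have h0 : (∫ z, Φ z ∂(volume.prod volume)).re = ∫ z, (Φ z).re ∂(volume.prod volume) :=
    (integral_re hint).symm
  have hp : Integrable fun ξ => (‖ξ‖ ^ ((1 - a) / 2) * ‖w ξ‖) ^ 2 :=
    hw.integrable_sq (measurable_norm.pow_const _) (C := 1) fun ξ => by
      rw [abs_of_nonneg (by positivity), one_mul]
      exact (norm_rpow_le_bw (by linarith) ξ).trans (bw_mono (by linarith) ξ)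
  have hr := (hu.integrable_mul_norm (q := 1) (by linarith) measurable_norm
    (fun ξ => norm_nonneg ξ) norm_le_bw_one).1
  have key := integral_young_le (F := fun z => (Φ z).re + (Φ z.swap).re) hp hr
    (fun ξ => by positivity) (hre.add hre') (by
      filter_upwards [hherm.ae_sub] with z hz
      simp only [hΦ, Prod.fst_swap, Prod.snd_swap, hz]
      exact re_tri_add_swap_le ha₀ ha _ _ _ _ _)
  rw [integral_add hre hre', hsw] at key
  have hnn : 0 ≤ (∫ ξ, (‖ξ‖ ^ ((1 - a) / 2) * ‖w ξ‖) ^ 2) * ∫ ξ, ‖ξ‖ * ‖u ξ‖ :=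
    mul_nonneg (integral_nonneg fun _ => sq_nonneg _) (integral_nonneg fun _ => by positivity)
  rw [h0]
  linarith

/-- The substitution η ↦ ξ - η places the two copies of w at ξ and η and leaves v at ξ - η; the form
can then be symmetrized. The factor 2 of the pointwise bound is consumed by the symmetrization. -/
lemma re_integral_tri_transport_le {a s : ℝ} (ha : a < 1) (hs : 7 / 2 - a < s)
    {w v : R3 → C3} (hw : Hs s w) (hv : Hs s v) (hherm : Herm v)
    (hdiv : DivFree w) :
    (∫ z : R3 × R3, tri a z.1 z.2 (w z.1) (v z.2) (w (z.1 - z.2)) ∂(volume.prod volume)).re ≤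
      (∫ ξ, ‖w ξ‖ ^ 2) * ∫ ξ, ‖ξ‖ ^ (2 - a) * ‖v ξ‖ := by
  set Φ₀ : R3 × R3 → ℂ := fun z => tri a z.1 z.2 (w z.1) (v z.2) (w (z.1 - z.2)) with hΦ₀
  have hint₀ : Integrable Φ₀ (volume.prod volume) := integrable_tri ha hs hw hv hw
  set Φ : R3 × R3 → ℂ := fun z => Φ₀ (z.1, z.1 - z.2) with hΦ
  have hint : Integrable Φ (volume.prod volume) :=
    (measurePreserving_sub_snd.integrable_comp_emb measurableEmbedding_sub_snd).2 hint₀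
  have heq : ∫ z, Φ₀ z ∂(volume.prod volume) = ∫ z, Φ z ∂(volume.prod volume) :=
    (measurePreserving_sub_snd.integral_comp measurableEmbedding_sub_snd Φ₀).symm
  have hre : Integrable (fun z => (Φ z).re) (volume.prod volume) := hint.re
  have hre' : Integrable (fun z : R3 × R3 => (Φ z.swap).re) (volume.prod volume) := hre.swap
  have hsw : ∫ z, (Φ z.swap).re ∂(volume.prod volume : Measure (R3 × R3)) =
      ∫ z, (Φ z).re ∂(volume.prod volume) :=
    integral_prod_swap (μ := (volume : Measure R3)) (ν := (volume : Measure R3))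
      (fun z => (Φ z).re)
  have h0 : (∫ z, Φ z ∂(volume.prod volume)).re = ∫ z, (Φ z).re ∂(volume.prod volume) :=
    (integral_re hint).symm
  have hp : Integrable fun ξ => ‖w ξ‖ ^ 2 := by
    have := hw.integrable_sq (measurable_const (a := (1 : ℝ))) (C := 1) fun ξ => by
      rw [abs_one, one_mul]; exact one_le_bw (by linarith) ξ
    simpa using this
  have hr := ((hv.integrable_mul_norm (q := 2 - a) (m := fun ξ => ‖ξ‖ ^ (2 - a)) (by linarith)
    (measurable_norm.pow_const _) (fun ξ => by positivity)
    (norm_rpow_le_bw (by linarith))).1).const_mul 2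
  have key := integral_young_le (F := fun z => (Φ z).re + (Φ z.swap).re) hp hr
    (fun ξ => by positivity) (hre.add hre') (by
      filter_upwards [hherm.ae_sub, Measure.quasiMeasurePreserving_fst.ae hdiv,
        Measure.quasiMeasurePreserving_snd.ae hdiv] with z hz hz1 hz2
      simp only [hΦ, hΦ₀, Prod.fst_swap, Prod.snd_swap, hz, sub_sub_cancel]
      refine (re_tri_transport_le ha _ _ _ _ _ hz1 hz2).trans (le_of_eq (by ring)))
  rw [integral_add hre hre', hsw, integral_const_mul] at key
  rw [heq, h0]
  linarith

/-- Here x, y, z stand for |ξ|, |η|, |ξ-η|. If z ≤ y, the gain z/y in the defect trades a derivative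
at η for one at ξ-η and leaves half of the order 1-a on each of ξ and η. If y ≤ z, the gain y/z
removes the factor z bounding x and leaves y^(2-a). These are the two costs already produced by the
cancellations. -/
lemma weight_defect_mul_le {a σ : ℝ} {ψ : ℝ → ℝ} (ha₀ : 0 ≤ a) (ha : a < 1) (hσ : 1 ≤ σ)
    (hψ : ∀ r, 0 ≤ ψ r)
    (hup : ∀ r l, 0 ≤ r → 1 ≤ l → ψ (l * r) ≤ l ^ σ * ψ r)
    (hlow : ∀ r l, 0 ≤ r → 1 ≤ l → l * ψ r ≤ ψ (l * r))
    {x y z : ℝ} (hx : 0 ≤ x) (hy : 0 ≤ y) (hz : 0 ≤ z) (hxy : |x - y| ≤ z) (hxz : |x - z| ≤ y) :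
    |ψ x - ψ y - ψ z| * (x * y ^ (1 - a)) ≤ (2 ^ σ + σ + 1) *
      (2 * (x ^ ((1 - a) / 2) * y ^ ((1 - a) / 2) * z * ψ y) + 2 * (y ^ (2 - a) * ψ z)) := by
  have hCp : 0 ≤ (2 : ℝ) ^ σ + σ + 1 := by positivity
  rcases le_total z y with hzy | hyz
  · rcases hy.eq_or_lt with h0 | h0
    · rw [← h0, Real.zero_rpow (by linarith : 1 - a ≠ 0), mul_zero, mul_zero]
      have := hψ z
      have := hψ 0
      positivity
    have h1 := abs_weight_sub_sub_le hσ hψ hup hlow hx h0 hz hzy hxy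
    have hx2 : x ≤ 2 * y := by have := (abs_le.1 hxy).2; linarith
    -- As x ≤ 2y, all but the power (1-a)/2 of x is moved onto y.
    have h2 : x * y ^ (1 - a) ≤ 2 * (x ^ ((1 - a) / 2) * y ^ ((1 - a) / 2)) * y := by
      have e1 : x = x ^ ((1 - a) / 2) * x ^ ((1 + a) / 2) := by
        rw [← Real.rpow_add_of_nonneg hx (by linarith) (by linarith)]
        rw [show (1 - a) / 2 + (1 + a) / 2 = 1 by ring, Real.rpow_one]
      have e2 : x ^ ((1 + a) / 2) ≤ 2 * y ^ ((1 + a) / 2) := by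
        calc x ^ ((1 + a) / 2) ≤ (2 * y) ^ ((1 + a) / 2) :=
              Real.rpow_le_rpow hx hx2 (by linarith)
          _ = 2 ^ ((1 + a) / 2) * y ^ ((1 + a) / 2) := Real.mul_rpow (by norm_num) hy
          _ ≤ 2 ^ (1 : ℝ) * y ^ ((1 + a) / 2) := by
              gcongr
              · norm_num
              · linarith
          _ = _ := by rw [Real.rpow_one]
      have e3 : y ^ ((1 + a) / 2) * y ^ (1 - a) = y ^ ((1 - a) / 2) * y := by
        rw [← Real.rpow_add h0, ← Real.rpow_add_one h0.ne']; ring_nf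
      calc x * y ^ (1 - a) = x ^ ((1 - a) / 2) * x ^ ((1 + a) / 2) * y ^ (1 - a) := by rw [← e1]
        _ ≤ x ^ ((1 - a) / 2) * (2 * y ^ ((1 + a) / 2)) * y ^ (1 - a) := by gcongr
        _ = 2 * x ^ ((1 - a) / 2) * (y ^ ((1 + a) / 2) * y ^ (1 - a)) := by ring
        _ = _ := by rw [e3]; ring
    have h3 := hψ y
    have h4 := hψ z
    calc _ ≤ ((2 ^ σ + σ + 1) * (ψ y * (z / y))) *
          (2 * (x ^ ((1 - a) / 2) * y ^ ((1 - a) / 2)) * y) := by gcongr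
      _ = (2 ^ σ + σ + 1) * (2 * (x ^ ((1 - a) / 2) * y ^ ((1 - a) / 2) * z * ψ y) + 0) := by
          field_simp; ring
      _ ≤ _ := by gcongr; positivity
  · rcases hz.eq_or_lt with h0 | h0
    · have hy0 : y = 0 := by linarith
      rw [hy0, Real.zero_rpow (by linarith : 1 - a ≠ 0), mul_zero, mul_zero]
      have := hψ z
      have := hψ 0
      positivity
    have h1 := abs_weight_sub_sub_le hσ hψ hup hlow hx h0 hy hyz hxz
    have hx2 : x ≤ 2 * z := by have := (abs_le.1 hxz).2; linarith
    have e : y * y ^ (1 - a) = y ^ (2 - a) := by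
      rw [show (2 - a) = 1 + (1 - a) by ring,
        Real.rpow_add_of_nonneg hy zero_le_one (by linarith), Real.rpow_one]
    have h3 := hψ y
    have h4 := hψ z
    have hsw : |ψ x - ψ y - ψ z| = |ψ x - ψ z - ψ y| := by congr 1; ring
    rw [hsw]
    calc _ ≤ ((2 ^ σ + σ + 1) * (ψ z * (y / z))) * ((2 * z) * y ^ (1 - a)) := by gcongr
      _ = (2 ^ σ + σ + 1) * (0 + 2 * ((y * y ^ (1 - a)) * ψ z)) := by field_simp; ring
      _ ≤ _ := by rw [e]; gcongr; positivity

/-- Energy estimate for a weight `ψ`. -/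
lemma re_integral_weight_tri_le {a s σ : ℝ} {ψ : ℝ → ℝ} (ha₀ : 0 ≤ a) (ha : a < 1)
    (hs : 7 / 2 - a < s) (hσ : 1 ≤ σ) (hψm : Measurable ψ) (hψ : ∀ r, 0 ≤ ψ r)
    (hup : ∀ r l, 0 ≤ r → 1 ≤ l → ψ (l * r) ≤ l ^ σ * ψ r)
    (hlow : ∀ r l, 0 ≤ r → 1 ≤ l → l * ψ r ≤ ψ (l * r))
    {f F : R3 → C3} (hf : Hs s f) (hF : Hs s F) (hFf : ∀ ξ, F ξ = ψ ‖ξ‖ • f ξ) (hherm : Herm f)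
    (hdiv : DivFree f) :
    (∫ z : R3 × R3, (ψ ‖z.1‖ : ℂ) * tri a z.1 z.2 (F z.1) (f z.2) (f (z.1 - z.2))
        ∂(volume.prod volume)).re ≤
      (2 * (2 ^ σ + σ + 1) + 1) *
        ((∫ ξ, (‖ξ‖ ^ ((1 - a) / 2) * ‖F ξ‖) ^ 2) * (∫ ξ, ‖ξ‖ * ‖f ξ‖) +
          (∫ ξ, ‖F ξ‖ ^ 2) * ∫ ξ, ‖ξ‖ ^ (2 - a) * ‖f ξ‖) := by
  set C : ℝ := 2 ^ σ + σ + 1 with hC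
  have hCp : 0 ≤ C := by positivity
  -- In A and B the outer factor ψ(|ξ|) has become ψ(|η|) and ψ(|ξ-η|), absorbed into F; R carries
  -- the defect. A is estimated by skew symmetry, B by the transport cancellation, R in absolute
  -- value.
  set A : R3 × R3 → ℂ := fun z => tri a z.1 z.2 (F z.1) (F z.2) (f (z.1 - z.2)) with hA
  set B : R3 × R3 → ℂ := fun z => tri a z.1 z.2 (F z.1) (f z.2) (F (z.1 - z.2)) with hB
  set R : R3 × R3 → ℂ := fun z => ((ψ ‖z.1‖ - ψ ‖z.2‖ - ψ ‖z.1 - z.2‖ : ℝ) : ℂ) *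
    tri a z.1 z.2 (F z.1) (f z.2) (f (z.1 - z.2)) with hR
  set p : R3 → ℝ := fun ξ => ‖ξ‖ ^ ((1 - a) / 2) * ‖F ξ‖ with hp
  set r₁ : R3 → ℝ := fun ξ => ‖ξ‖ * ‖f ξ‖ with hr₁
  set r₂ : R3 → ℝ := fun ξ => ‖ξ‖ ^ (2 - a) * ‖f ξ‖ with hr₂
  have hAi : Integrable A (volume.prod volume) := integrable_tri ha hs hF hF hf
  have hBi : Integrable B (volume.prod volume) := integrable_tri ha hs hF hf hF
  have hpi : Integrable fun ξ => p ξ ^ 2 :=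
    hF.integrable_sq (measurable_norm.pow_const _) (C := 1) fun ξ => by
      rw [abs_of_nonneg (by positivity), one_mul]
      exact (norm_rpow_le_bw (by linarith) ξ).trans (bw_mono (by linarith) ξ)
  have hFi : Integrable fun ξ => ‖F ξ‖ ^ 2 := by
    have := hF.integrable_sq (measurable_const (a := (1 : ℝ))) (C := 1) fun ξ => by
      rw [abs_one, one_mul]; exact one_le_bw (by linarith) ξ
    simpa using this
  have hr₁i := (hf.integrable_mul_norm (q := 1) (by linarith) measurable_norm
    (fun ξ => norm_nonneg ξ) norm_le_bw_one).1
  have hr₂i := ((hf.integrable_mul_norm (q := 2 - a) (m := fun ξ => ‖ξ‖ ^ (2 - a)) (by linarith)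
    (measurable_norm.pow_const _) (fun ξ => by positivity)
    (norm_rpow_le_bw (by linarith))).1)
  set G₁ : R3 × R3 → ℝ := fun z => p z.1 * p z.2 * r₁ (z.1 - z.2) with hG₁
  set G₂ : R3 × R3 → ℝ := fun z => ‖F z.1‖ * ‖F z.2‖ * r₂ (z.1 - z.2) with hG₂
  have hpm : AEStronglyMeasurable p volume :=
    (measurable_norm.pow_const _).aestronglyMeasurable.mul hF.aesm.norm
  have hG₁i : Integrable G₁ (volume.prod volume) := by
    refine integrable_young hpi hpi hr₁i (fun ξ => by positivity) ?_
      (Filter.Eventually.of_forall fun z => le_of_eq ?_)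
    · exact ((hpm.comp_quasiMeasurePreserving Measure.quasiMeasurePreserving_fst).mul
        (hpm.comp_quasiMeasurePreserving Measure.quasiMeasurePreserving_snd)).mul
        (hr₁i.1.comp_quasiMeasurePreserving (quasiMeasurePreserving_sub_of_right_invariant _ _))
    · exact Real.norm_of_nonneg (by positivity)
  have hG₂i : Integrable G₂ (volume.prod volume) := by
    refine integrable_young (p := fun ξ => ‖F ξ‖) (q := fun ξ => ‖F ξ‖) hFi hFi hr₂i
      (fun ξ => by positivity) ?_ (Filter.Eventually.of_forall fun z => le_of_eq ?_)
    · exact (((aesm_fst hF.aesm).norm).mul ((aesm_snd hF.aesm).norm)).mul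
        (hr₂i.1.comp_quasiMeasurePreserving (quasiMeasurePreserving_sub_of_right_invariant _ _))
    · exact Real.norm_of_nonneg (by positivity)
  have hG₁le : ∫ z, G₁ z ∂(volume.prod volume) ≤ (∫ ξ, p ξ ^ 2) * ∫ ξ, r₁ ξ :=
    integral_young_le hpi hr₁i (fun ξ => by positivity) hG₁i
      (Filter.Eventually.of_forall fun z => le_rfl)
  have hG₂le : ∫ z, G₂ z ∂(volume.prod volume) ≤ (∫ ξ, ‖F ξ‖ ^ 2) * ∫ ξ, r₂ ξ :=
    integral_young_le hFi hr₂i (fun ξ => by positivity) hG₂i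
      (Filter.Eventually.of_forall fun z => le_rfl)
  -- The second defect term has its weight at ξ-η, so it is `G₂` after the substitution η ↦ ξ - η.
  set G₂' : R3 × R3 → ℝ := fun z => G₂ (z.1, z.1 - z.2) with hG₂'
  have hG₂'i : Integrable G₂' (volume.prod volume) :=
    (measurePreserving_sub_snd.integrable_comp_emb measurableEmbedding_sub_snd).2 hG₂i
  have hG₂'eq : ∫ z, G₂' z ∂(volume.prod volume) = ∫ z, G₂ z ∂(volume.prod volume) :=
    measurePreserving_sub_snd.integral_comp measurableEmbedding_sub_snd G₂
  have hnF : ∀ ξ, ‖F ξ‖ = ψ ‖ξ‖ * ‖f ξ‖ := fun ξ => by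
    rw [hFf, norm_smul, Real.norm_of_nonneg (hψ _)]
  have hRle : ∀ z, ‖R z‖ ≤ 2 * C * (G₁ z + G₂' z) := by
    intro z
    have h1 := norm_tri_le ha z.1 z.2 (F z.1) (f z.2) (f (z.1 - z.2))
    have hxy : |‖z.1‖ - ‖z.2‖| ≤ ‖z.1 - z.2‖ := abs_norm_sub_norm_le _ _
    have hxz : |‖z.1‖ - ‖z.1 - z.2‖| ≤ ‖z.2‖ := by
      have := abs_norm_sub_norm_le z.1 (z.1 - z.2)
      rwa [sub_sub_cancel] at this
    have h2 := weight_defect_mul_le ha₀ ha hσ hψ hup hlow (norm_nonneg z.1) (norm_nonneg z.2)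
      (norm_nonneg (z.1 - z.2)) hxy hxz
    rw [hR]
    simp only [norm_mul, Complex.norm_real, Real.norm_eq_abs]
    calc _ ≤ |ψ ‖z.1‖ - ψ ‖z.2‖ - ψ ‖z.1 - z.2‖| *
          (‖z.1‖ * ‖z.2‖ ^ (1 - a) * ‖F z.1‖ * ‖f z.2‖ * ‖f (z.1 - z.2)‖) := by gcongr
      _ = (|ψ ‖z.1‖ - ψ ‖z.2‖ - ψ ‖z.1 - z.2‖| * (‖z.1‖ * ‖z.2‖ ^ (1 - a))) *
          (‖F z.1‖ * ‖f z.2‖ * ‖f (z.1 - z.2)‖) := by ring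
      _ ≤ _ := by
        refine (mul_le_mul_of_nonneg_right h2 (by positivity)).trans (le_of_eq ?_)
        simp only [hG₁, hG₂', hG₂, hp, hr₁, hr₂, sub_sub_cancel, hnF z.2, hnF (z.1 - z.2)]
        ring
  have hsum : ∀ z, (ψ ‖z.1‖ : ℂ) * tri a z.1 z.2 (F z.1) (f z.2) (f (z.1 - z.2)) =
      A z + B z + R z := by
    intro z
    have e1 : A z = (ψ ‖z.2‖ : ℂ) * tri a z.1 z.2 (F z.1) (f z.2) (f (z.1 - z.2)) := by
      simp only [hA, hFf z.2, tri, cr_rsmul_right, cr_rsmul_left, smul_comm (‖z.2‖ ^ (-a))]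
      rw [← Complex.coe_smul (ψ ‖z.2‖), inner_smul_right]
    have e2 : B z = (ψ ‖z.1 - z.2‖ : ℂ) * tri a z.1 z.2 (F z.1) (f z.2) (f (z.1 - z.2)) := by
      simp only [hB, hFf (z.1 - z.2), tri, cr_rsmul_right]
      rw [← Complex.coe_smul (ψ ‖z.1 - z.2‖), inner_smul_right]
    rw [e1, e2, hR]
    push_cast
    ring
  have hRm : AEStronglyMeasurable R (volume.prod volume) := by
    refine AEStronglyMeasurable.mul (Measurable.aestronglyMeasurable ?_)
      (aesm_tri hF.aesm hf.aesm hf.aesm)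
    exact Complex.measurable_ofReal.comp (((hψm.comp (by fun_prop)).sub
      (hψm.comp (by fun_prop))).sub (hψm.comp (by fun_prop)))
  have hRi : Integrable R (volume.prod volume) :=
    ((hG₁i.add hG₂'i).const_mul (2 * C)).mono' hRm (Filter.Eventually.of_forall hRle)
  have hRre : (∫ z, R z ∂(volume.prod volume)).re ≤ 2 * C *
      ((∫ ξ, p ξ ^ 2) * (∫ ξ, r₁ ξ) + (∫ ξ, ‖F ξ‖ ^ 2) * ∫ ξ, r₂ ξ) := by
    refine (Complex.re_le_norm _).trans ((norm_integral_le_integral_norm _).trans ?_)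
    refine (integral_mono hRi.norm ((hG₁i.add hG₂'i).const_mul (2 * C)) hRle).trans ?_
    rw [integral_const_mul]
    simp only [Pi.add_apply]
    rw [integral_add hG₁i hG₂'i, hG₂'eq]
    gcongr
  have hhermF : Herm F := by
    filter_upwards [hherm] with ξ h
    rw [hFf, hFf, norm_neg, h]
    ext i; simp
  have hdivF : DivFree F := by
    filter_upwards [hdiv] with ξ h
    rw [hFf]
    have : dt (cv ξ) (ψ ‖ξ‖ • f ξ) = (ψ ‖ξ‖ : ℂ) * dt (cv ξ) (f ξ) := by
      simp [dt, Finset.mul_sum]; congr 1; ext i; ring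
    rw [this, h, mul_zero]
  have hAle := re_integral_tri_skew_le ha₀ ha hs hF hf hherm
  have hBle := re_integral_tri_transport_le ha hs hF hf hherm hdivF
  simp only [hsum]
  have hABi : Integrable (fun z => A z + B z) (volume.prod volume) := hAi.add hBi
  rw [integral_add hABi hRi, integral_add hAi hBi, Complex.add_re, Complex.add_re]
  linarith

/-! ### Bounded multipliers on L² and the bilinear operator -/

/-- Square integrable vector fields on the frequency side. -/
abbrev VL2 : Type := Lp C3 2 (volume : Measure R3)

lemma norm_sq_VL2 (g : VL2) : ‖g‖ ^ 2 = ∫ ξ, ‖g ξ‖ ^ 2 := by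
  have h : (inner ℂ g g : ℂ) = ∫ ξ, inner ℂ (g ξ) (g ξ) := L2.inner_def g g
  have h2 : ‖g‖ ^ 2 = (inner ℂ g g : ℂ).re := by
    rw [← inner_self_eq_norm_sq (𝕜 := ℂ)]; rfl
  rw [h2, h]
  have h3 : ∀ ξ, (inner ℂ (g ξ) (g ξ) : ℂ) = ((‖g ξ‖ ^ 2 : ℝ) : ℂ) := fun ξ => by
    rw [inner_self_eq_norm_sq_to_K]; norm_cast
  simp only [h3]
  rw [integral_complex_ofReal, Complex.ofReal_re]

/-- `m` is measurable and bounded by `C`. -/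
def BddBy (m : R3 → ℝ) (C : ℝ) : Prop := Measurable m ∧ ∀ ξ, |m ξ| ≤ C

lemma BddBy.nonneg {m : R3 → ℝ} {C : ℝ} (h : BddBy m C) : 0 ≤ C := (abs_nonneg _).trans (h.2 0)

lemma BddBy.mul {m n : R3 → ℝ} {C D : ℝ} (hm : BddBy m C) (hn : BddBy n D) :
    BddBy (fun ξ => m ξ * n ξ) (C * D) :=
  ⟨hm.1.mul hn.1, fun ξ => by
    rw [abs_mul]; exact mul_le_mul (hm.2 ξ) (hn.2 ξ) (abs_nonneg _) hm.nonneg⟩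

lemma BddBy.memLp {m : R3 → ℝ} {C : ℝ} (h : BddBy m C) (g : VL2) :
    MemLp (fun ξ => m ξ • g ξ) 2 volume := by
  refine MemLp.of_le_mul (c := C) (Lp.memLp g)
    (h.1.aestronglyMeasurable.smul (Lp.aestronglyMeasurable g))
    (Filter.Eventually.of_forall fun ξ => ?_)
  rw [norm_smul, Real.norm_eq_abs]
  gcongr
  exact h.2 ξ

open Classical in
/-- Multiplication by a bounded measurable function (zero if `m` is not such a function). -/
def bmul (m : R3 → ℝ) : VL2 →L[ℝ] VL2 :=
  if h : ∃ C, BddBy m C then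
    LinearMap.mkContinuous
      { toFun := fun g => (h.choose_spec.memLp g).toLp _
        map_add' := fun f g => by
          refine Lp.ext ?_
          filter_upwards [(h.choose_spec.memLp (f + g)).coeFn_toLp,
            (h.choose_spec.memLp f).coeFn_toLp, (h.choose_spec.memLp g).coeFn_toLp,
            Lp.coeFn_add f g, Lp.coeFn_add ((h.choose_spec.memLp f).toLp _)
              ((h.choose_spec.memLp g).toLp _)] with ξ h1 h2 h3 h4 h5
          rw [h1, h5, Pi.add_apply, h2, h3, h4, Pi.add_apply, smul_add]
        map_smul' := fun c g => by
          refine Lp.ext ?_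
          filter_upwards [(h.choose_spec.memLp (c • g)).coeFn_toLp,
            (h.choose_spec.memLp g).coeFn_toLp, Lp.coeFn_smul c g,
            Lp.coeFn_smul c ((h.choose_spec.memLp g).toLp _)] with ξ h1 h2 h3 h4
          rw [h1, RingHom.id_apply, h4, Pi.smul_apply, h2, h3, Pi.smul_apply, smul_comm] }
      h.choose (fun g => by
        refine Lp.norm_le_mul_norm_of_ae_le_mul ?_
        filter_upwards [(h.choose_spec.memLp g).coeFn_toLp] with ξ h1
        simp only [LinearMap.coe_mk, AddHom.coe_mk]
        rw [h1, norm_smul, Real.norm_eq_abs]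
        gcongr
        exact h.choose_spec.2 ξ)
  else 0

lemma bmul_ae {m : R3 → ℝ} {C : ℝ} (h : BddBy m C) (g : VL2) :
    bmul m g =ᵐ[volume] fun ξ => m ξ • g ξ := by
  have h' : ∃ C, BddBy m C := ⟨C, h⟩
  rw [bmul, dif_pos h']
  exact (h'.choose_spec.memLp g).coeFn_toLp

lemma norm_bmul_le {m : R3 → ℝ} {C : ℝ} (h : BddBy m C) (g : VL2) : ‖bmul m g‖ ≤ C * ‖g‖ := by
  refine Lp.norm_le_mul_norm_of_ae_le_mul ?_
  filter_upwards [bmul_ae h g] with ξ h1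
  rw [h1, norm_smul, Real.norm_eq_abs]
  gcongr
  exact h.2 ξ

lemma bmul_bmul {m n : R3 → ℝ} {C D : ℝ} (hm : BddBy m C) (hn : BddBy n D) (g : VL2) :
    bmul m (bmul n g) = bmul (fun ξ => m ξ * n ξ) g := by
  refine Lp.ext ?_
  filter_upwards [bmul_ae hm (bmul n g), bmul_ae hn g, bmul_ae (hm.mul hn) g] with ξ h1 h2 h3
  rw [h1, h2, h3, smul_smul]

lemma inner_bmul_left {m : R3 → ℝ} {C : ℝ} (h : BddBy m C) (f g : VL2) :
    (inner ℂ (bmul m f) g : ℂ) = inner ℂ f (bmul m g) := by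
  rw [L2.inner_def, L2.inner_def]
  refine integral_congr_ae ?_
  filter_upwards [bmul_ae h f, bmul_ae h g] with ξ h1 h2
  rw [h1, h2, ← Complex.coe_smul, ← Complex.coe_smul, inner_smul_left, inner_smul_right,
    Complex.conj_ofReal]

lemma bddBy_bw {s : ℝ} (hs : s ≤ 0) : BddBy (bw s) 1 :=
  ⟨measurable_bw s, fun ξ => by rw [abs_of_pos (bw_pos s ξ)]; exact bw_le_one hs ξ⟩

/-- The field whose weighted norm of order `s` is the `L²` norm of `g`. -/
def fld (s : ℝ) (g : VL2) (ξ : R3) : C3 := bw (-s) ξ • g ξ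

lemma bw_smul_fld (s : ℝ) (g : VL2) (ξ : R3) : bw s ξ • fld s g ξ = g ξ := by
  rw [fld, smul_smul, bw_mul_neg, one_smul]

lemma hs_fld (s : ℝ) (g : VL2) : Hs s (fld s g) := by
  unfold Hs
  simp only [bw_smul_fld]
  exact Lp.memLp g

lemma bw_mul_norm_fld (s : ℝ) (g : VL2) (ξ : R3) : bw s ξ * ‖fld s g ξ‖ = ‖g ξ‖ := by
  rw [← bw_smul_fld s g ξ, norm_smul, Real.norm_of_nonneg (bw_nonneg s ξ)]

lemma hsNorm_fld (s : ℝ) (g : VL2) : hsNorm s (fld s g) = ‖g‖ := by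
  rw [hsNorm]
  simp only [bw_mul_norm_fld]
  rw [← norm_sq_VL2, Real.sqrt_sq (norm_nonneg g)]

/-- `∇ × ((∇ × Λ^{-a} g) × u)` on the frequency side, up to a constant. -/
def Nl (a : ℝ) (g u : R3 → C3) (ξ : R3) : C3 :=
  cr (cv ξ) (∫ η, cr ((‖η‖ ^ (-a)) • cr (cv η) (g η)) (u (ξ - η)))

/-- Equality holds at every ξ because g and u enter only under the integral sign. -/
lemma Nl_congr {a : ℝ} {g g' u u' : R3 → C3} (hg : g =ᵐ[volume] g') (hu : u =ᵐ[volume] u') :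
    Nl a g u = Nl a g' u' := by
  ext1 ξ
  unfold Nl
  congr 1
  refine integral_congr_ae ?_
  filter_upwards [hg, (quasiMeasurePreserving_sub_left_of_right_invariant volume ξ).ae hu]
    with η h1 h2
  rw [h1, h2]

lemma Hs.memLp_K {a s : ℝ} (ha : a < 1) (hs : 1 - a ≤ s) {g : R3 → C3} (hg : Hs s g) :
    MemLp (fun η => (‖η‖ ^ (-a)) • cr (cv η) (g η)) 2 volume := by
  refine MemLp.of_le_mul (c := 1) hg ?_ (Filter.Eventually.of_forall fun η => ?_)
  · exact (measurable_norm.pow_const _).aestronglyMeasurable.smul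
      (aesm_cr continuous_cv.aestronglyMeasurable hg.aesm)
  · refine (norm_K_le ha η _).trans ?_
    rw [one_mul, norm_smul, Real.norm_of_nonneg (bw_nonneg s η)]
    gcongr
    exact (norm_rpow_le_bw (by linarith) η).trans (bw_mono hs η)

lemma Hs.memLp_self {s : ℝ} (hs : 0 ≤ s) {g : R3 → C3} (hg : Hs s g) : MemLp g 2 volume := by
  simpa using hg.memLp_smul (measurable_const (a := (1 : ℝ))) (C := 1) fun ξ => by
    rw [abs_one, one_mul]; exact one_le_bw hs ξ

lemma integrable_cr_sub {x u : R3 → C3} (hx : MemLp x 2 volume) (hu : MemLp u 2 volume) (ξ : R3) :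
    Integrable fun η => cr (x η) (u (ξ - η)) := by
  have hu' : MemLp (fun η => u (ξ - η)) 2 volume :=
    hu.comp_measurePreserving (Measure.measurePreserving_sub_left volume ξ)
  refine (hx.norm.integrable_mul hu'.norm).mono' (aesm_cr hx.1 hu'.1)
    (Filter.Eventually.of_forall fun η => norm_cr_le _ _)

lemma integrable_Nl_integrand {a s : ℝ} (ha : a < 1) (hs : 1 - a ≤ s) {g u : R3 → C3}
    (hg : Hs s g) (hu : Hs s u) (ξ : R3) :
    Integrable fun η => cr ((‖η‖ ^ (-a)) • cr (cv η) (g η)) (u (ξ - η)) :=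
  integrable_cr_sub (hg.memLp_K ha hs) (hu.memLp_self (by linarith)) ξ

lemma Nl_add_left {a s : ℝ} (ha : a < 1) (hs : 1 - a ≤ s) {f g u : R3 → C3}
    (hf : Hs s f) (hg : Hs s g) (hu : Hs s u) :
    Nl a (fun ξ => f ξ + g ξ) u = fun ξ => Nl a f u ξ + Nl a g u ξ := by
  ext1 ξ
  unfold Nl
  rw [← cr_add_right, ← integral_add (integrable_Nl_integrand ha hs hf hu ξ)
    (integrable_Nl_integrand ha hs hg hu ξ)]
  simp only [cr_add_right, smul_add, cr_add_left]

lemma Nl_add_right {a s : ℝ} (ha : a < 1) (hs : 1 - a ≤ s) {g u v : R3 → C3}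
    (hg : Hs s g) (hu : Hs s u) (hv : Hs s v) :
    Nl a g (fun ξ => u ξ + v ξ) = fun ξ => Nl a g u ξ + Nl a g v ξ := by
  ext1 ξ
  unfold Nl
  rw [← cr_add_right, ← integral_add (integrable_Nl_integrand ha hs hg hu ξ)
    (integrable_Nl_integrand ha hs hg hv ξ)]
  simp only [cr_add_right]

lemma Nl_smul_left {a : ℝ} (c : ℝ) (g u : R3 → C3) :
    Nl a (fun ξ => c • g ξ) u = fun ξ => c • Nl a g u ξ := by
  ext1 ξ
  unfold Nl
  simp only [cr_rsmul_right, cr_rsmul_left, smul_comm _ c]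
  rw [integral_smul, cr_rsmul_right]

lemma Nl_smul_right {a : ℝ} (c : ℝ) (g u : R3 → C3) :
    Nl a g (fun ξ => c • u ξ) = fun ξ => c • Nl a g u ξ := by
  ext1 ξ
  unfold Nl
  simp only [cr_rsmul_right]
  rw [integral_smul, cr_rsmul_right]

lemma aesm_Nl {a : ℝ} {g u : R3 → C3} (hg : AEStronglyMeasurable g volume)
    (hu : AEStronglyMeasurable u volume) : AEStronglyMeasurable (Nl a g u) volume := by
  refine aesm_cr continuous_cv.aestronglyMeasurable ?_
  have h1 : AEStronglyMeasurable (fun z : R3 × R3 => ‖z.2‖ ^ (-a)) (volume.prod volume) :=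
    (Measurable.pow_const (by fun_prop) _).aestronglyMeasurable
  have h2 : AEStronglyMeasurable (fun z : R3 × R3 => cv z.2) (volume.prod volume) :=
    (continuous_cv.comp continuous_snd).aestronglyMeasurable
  exact (aesm_cr (h1.smul (aesm_cr h2 (aesm_snd hg))) (aesm_sub hu)).integral_prod_right'

/-- Boundedness from H^s × H^s to L²: the kernel bound `norm_mul_rpow_le_bw` leaves a convolution of
an L² function built from g with an L¹ function built from u, and Young's inequality concludes. -/
lemma lintegral_enorm_Nl_sq_le {a s : ℝ} (ha : a < 1) (hs : 7 / 2 - a < s) {g u : R3 → C3}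
    (hg : Hs s g) (hu : Hs s u) :
    ∫⁻ ξ, ‖Nl a g u ξ‖ₑ ^ 2 ≤
      ENNReal.ofReal ((2 * (sobConst (2 - a) s * hsNorm s u) * hsNorm s g) ^ 2) := by
  set P : R3 → ℝ≥0∞ := fun η => ENNReal.ofReal (2 * (bw s η * ‖g η‖)) with hP
  set r : R3 → ℝ≥0∞ := fun η => ENNReal.ofReal (bw (2 - a) η * ‖u η‖) with hr
  have hPm : AEMeasurable P := by
    have := ((measurable_bw s).aestronglyMeasurable (μ := volume)).mul hg.aesm.norm
    exact (this.aemeasurable.const_mul 2).ennreal_ofReal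
  have hrm : AEMeasurable r := by
    have := ((measurable_bw (2 - a)).aestronglyMeasurable (μ := volume)).mul hu.aesm.norm
    exact this.aemeasurable.ennreal_ofReal
  have h1 : ∀ ξ, ‖Nl a g u ξ‖ₑ ≤ ∫⁻ η, P η * r (ξ - η) := by
    intro ξ
    set I := ∫ η, cr ((‖η‖ ^ (-a)) • cr (cv η) (g η)) (u (ξ - η)) with hI
    have e1 : ‖Nl a g u ξ‖ₑ ≤ ENNReal.ofReal ‖ξ‖ * ‖I‖ₑ := by
      rw [← ofReal_norm, ← ofReal_norm, ← ENNReal.ofReal_mul (norm_nonneg _)]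
      refine ENNReal.ofReal_le_ofReal ?_
      have := norm_cr_le (cv ξ) I
      rwa [norm_cv] at this
    refine e1.trans ?_
    calc _ ≤ ENNReal.ofReal ‖ξ‖ * ∫⁻ η, ‖cr ((‖η‖ ^ (-a)) • cr (cv η) (g η)) (u (ξ - η))‖ₑ := by
          gcongr; exact enorm_integral_le_lintegral_enorm _
      _ = ∫⁻ η, ENNReal.ofReal ‖ξ‖ * ‖cr ((‖η‖ ^ (-a)) • cr (cv η) (g η)) (u (ξ - η))‖ₑ :=
          (lintegral_const_mul' _ _ ENNReal.ofReal_ne_top).symm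
      _ ≤ _ := by
          refine lintegral_mono fun η => ?_
          rw [← ofReal_norm, ← ENNReal.ofReal_mul (norm_nonneg _), hP, hr]
          simp only
          rw [← ENNReal.ofReal_mul (by have := bw_nonneg s η; positivity)]
          refine ENNReal.ofReal_le_ofReal ?_
          have k1 := norm_cr_le ((‖η‖ ^ (-a)) • cr (cv η) (g η)) (u (ξ - η))
          have k2 := norm_K_le ha η (g η)
          have k3 := norm_mul_rpow_le_bw ha ξ η
          have k4 : bw (2 - a) η ≤ bw s η := bw_mono (by linarith) η
          have k5 := bw_nonneg (2 - a) (ξ - η)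
          calc _ ≤ ‖ξ‖ * ((‖η‖ ^ (1 - a) * ‖g η‖) * ‖u (ξ - η)‖) := by
                gcongr; exact k1.trans (by gcongr)
            _ = (‖ξ‖ * ‖η‖ ^ (1 - a)) * (‖g η‖ * ‖u (ξ - η)‖) := by ring
            _ ≤ (2 * (bw (2 - a) η * bw (2 - a) (ξ - η))) * (‖g η‖ * ‖u (ξ - η)‖) := by gcongr
            _ ≤ (2 * (bw s η * bw (2 - a) (ξ - η))) * (‖g η‖ * ‖u (ξ - η)‖) := by gcongr
            _ = _ := by ring
  have h2 : ∫⁻ η, P η ^ 2 = ENNReal.ofReal ((2 * hsNorm s g) ^ 2) := by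
    have : ∀ η, P η ^ 2 = ENNReal.ofReal (4 * (bw s η * ‖g η‖) ^ 2) := fun η => by
      rw [hP]; simp only
      rw [← ENNReal.ofReal_pow (by have := bw_nonneg s η; positivity)]
      congr 1; ring
    simp only [this]
    rw [← ofReal_integral_eq_lintegral_ofReal (hg.integrable_hsNorm.const_mul 4)
      (Filter.Eventually.of_forall fun η => by positivity), integral_const_mul, ← hsNorm_sq]
    congr 1; ring
  have h3 : ∫⁻ η, r η ≤ ENNReal.ofReal (sobConst (2 - a) s * hsNorm s u) := by
    have := hu.integrable_bw (q := 2 - a) (by linarith)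
    rw [← ofReal_integral_eq_lintegral_ofReal this.1
      (Filter.Eventually.of_forall fun η => mul_nonneg (bw_nonneg _ _) (norm_nonneg _))]
    exact ENNReal.ofReal_le_ofReal this.2
  calc _ ≤ ∫⁻ ξ, (∫⁻ η, P η * r (ξ - η)) ^ 2 := by
        refine lintegral_mono fun ξ => ?_
        exact pow_le_pow_left' (h1 ξ) 2
    _ ≤ _ := lintegral_conv_sq_le hPm hrm
    _ ≤ ENNReal.ofReal ((2 * hsNorm s g) ^ 2) *
        ENNReal.ofReal (sobConst (2 - a) s * hsNorm s u) ^ 2 := by rw [h2]; gcongr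
    _ = _ := by
        rw [← ENNReal.ofReal_pow (mul_nonneg (sobConst_nonneg _ _) (hsNorm_nonneg _ _)),
          ← ENNReal.ofReal_mul (by positivity)]
        congr 1; ring

lemma eLpNorm_Nl_le {a s : ℝ} (ha : a < 1) (hs : 7 / 2 - a < s) {g u : R3 → C3}
    (hg : Hs s g) (hu : Hs s u) :
    eLpNorm (Nl a g u) 2 volume ≤
      ENNReal.ofReal (2 * (sobConst (2 - a) s * hsNorm s u) * hsNorm s g) := by
  have h := lintegral_enorm_Nl_sq_le ha hs hg hu
  have hnn : 0 ≤ 2 * (sobConst (2 - a) s * hsNorm s u) * hsNorm s g :=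
    mul_nonneg (mul_nonneg zero_le_two (mul_nonneg (sobConst_nonneg _ _) (hsNorm_nonneg _ _)))
      (hsNorm_nonneg _ _)
  rw [eLpNorm_eq_lintegral_rpow_enorm_toReal (by norm_num) (by norm_num)]
  simp only [ENNReal.toReal_ofNat, ENNReal.rpow_ofNat]
  calc _ ≤ (ENNReal.ofReal ((2 * (sobConst (2 - a) s * hsNorm s u) * hsNorm s g) ^ 2)) ^
        (1 / (2 : ℝ)) := by gcongr
    _ = _ := by
      rw [ENNReal.ofReal_pow hnn, ← ENNReal.rpow_ofNat, ← ENNReal.rpow_mul]; simp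

lemma memLp_Nl {a s : ℝ} (ha : a < 1) (hs : 7 / 2 - a < s) {g u : R3 → C3}
    (hg : Hs s g) (hu : Hs s u) : MemLp (Nl a g u) 2 volume :=
  ⟨aesm_Nl hg.aesm hu.aesm, (eLpNorm_Nl_le ha hs hg hu).trans_lt ENNReal.ofReal_lt_top⟩

/-- `B` is the bounded bilinear operator on `L²` induced by the nonlinearity in the weighted space
of order `s`. -/
def IsBilin (a s : ℝ) (B : VL2 →L[ℝ] VL2 →L[ℝ] VL2) : Prop :=
  ∀ g h : VL2, B g h =ᵐ[volume] Nl a (fld s g) (fld s h)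

lemma fld_add_ae (s : ℝ) (f g : VL2) :
    fld s (f + g) =ᵐ[volume] fun ξ => fld s f ξ + fld s g ξ := by
  filter_upwards [Lp.coeFn_add f g] with ξ h
  rw [fld, h, Pi.add_apply, smul_add, fld, fld]

lemma fld_smul_ae (s c : ℝ) (g : VL2) : fld s (c • g) =ᵐ[volume] fun ξ => c • fld s g ξ := by
  filter_upwards [Lp.coeFn_smul c g] with ξ h
  rw [fld, h, Pi.smul_apply, smul_comm, fld]

/-- Taking g = `bw s` • f as unknown makes the nonlinearity a bounded bilinear map on the single
space L², so that continuity and Lipschitz bounds reduce to operator norms. -/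
theorem exists_isBilin {a s : ℝ} (ha : a < 1) (hs : 7 / 2 - a < s) :
    ∃ B : VL2 →L[ℝ] VL2 →L[ℝ] VL2, IsBilin a s B := by
  have hs' : 1 - a ≤ s := by linarith
  have hm : ∀ g h : VL2, MemLp (Nl a (fld s g) (fld s h)) 2 volume := fun g h =>
    memLp_Nl ha hs (hs_fld s g) (hs_fld s h)
  let L : VL2 →ₗ[ℝ] VL2 →ₗ[ℝ] VL2 := LinearMap.mk₂ ℝ (fun g h => (hm g h).toLp _)
    (fun f g h => by
      rw [← MemLp.toLp_add]
      congr 1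
      rw [Nl_congr (fld_add_ae s f g) (Filter.EventuallyEq.refl _ _),
        Nl_add_left ha hs' (hs_fld s f) (hs_fld s g) (hs_fld s h)]
      rfl)
    (fun c g h => by
      rw [← MemLp.toLp_const_smul]
      congr 1
      rw [Nl_congr (fld_smul_ae s c g) (Filter.EventuallyEq.refl _ _), Nl_smul_left]
      rfl)
    (fun f g h => by
      rw [← MemLp.toLp_add]
      congr 1
      rw [Nl_congr (Filter.EventuallyEq.refl _ _) (fld_add_ae s g h),
        Nl_add_right ha hs' (hs_fld s f) (hs_fld s g) (hs_fld s h)]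
      rfl)
    (fun c g h => by
      rw [← MemLp.toLp_const_smul]
      congr 1
      rw [Nl_congr (Filter.EventuallyEq.refl _ _) (fld_smul_ae s c h), Nl_smul_right]
      rfl)
  refine ⟨L.mkContinuous₂ (2 * sobConst (2 - a) s) fun g h => ?_, fun g h => ?_⟩
  · change ‖(hm g h).toLp _‖ ≤ _
    rw [Lp.norm_toLp]
    refine ENNReal.toReal_le_of_le_ofReal ?_ ?_
    · have := sobConst_nonneg (2 - a) s
      positivity
    · refine (eLpNorm_Nl_le ha hs (hs_fld s g) (hs_fld s h)).trans (le_of_eq ?_)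
      rw [hsNorm_fld, hsNorm_fld]
      congr 1; ring
  · exact (hm g h).coeFn_toLp

/-- The nonlinearity tested against a field. -/
lemma inner_bilin_eq {a s : ℝ} (ha : a < 1) (hs : 7 / 2 - a < s)
    {B : VL2 →L[ℝ] VL2 →L[ℝ] VL2} (hB : IsBilin a s B) {W g h : VL2} {w g' h' : R3 → C3}
    (hW : W =ᵐ[volume] w) (hg : fld s g =ᵐ[volume] g') (hh : fld s h =ᵐ[volume] h')
    (hw : Hs s w) :
    (inner ℂ W (B g h) : ℂ) =
      ∫ z : R3 × R3, tri a z.1 z.2 (w z.1) (g' z.2) (h' (z.1 - z.2)) ∂(volume.prod volume) := by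
  have hg' : Hs s g' := (hs_fld s g).ae_eq (by filter_upwards [hg] with ξ h; rw [h])
  have hh' : Hs s h' := (hs_fld s h).ae_eq (by filter_upwards [hh] with ξ h; rw [h])
  rw [integral_prod _ (integrable_tri ha hs hw hg' hh'), L2.inner_def]
  refine integral_congr_ae ?_
  filter_upwards [hW, hB g h] with ξ h1 h2
  rw [h1, h2, Nl_congr hg hh]
  have hi := integrable_Nl_integrand ha (by linarith) hg' hh' ξ
  have := ((innerSL ℂ (w ξ)).restrictScalars ℝ ∘L crL (cv ξ)).integral_comp_comm hi
  simpa [tri, Nl] using this.symm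

/-! ### The closed real subspace of Hermitian divergence-free fields -/

lemma dt_rsmul_right (x y : C3) (c : ℝ) : dt x (c • y) = (c : ℂ) * dt x y := by
  simp only [dt, PiLp.smul_apply, Complex.real_smul, Finset.mul_sum]
  exact Finset.sum_congr rfl fun i _ => by ring

lemma dt_add_right (x y z : C3) : dt x (y + z) = dt x y + dt x z := by
  simp only [dt, PiLp.add_apply, mul_add, Finset.sum_add_distrib]

lemma dt_cr_self (x y : C3) : dt x (cr x y) = 0 := by
  simp only [dt, Fin.sum_univ_three, cr_apply, zero_add, fin3_one_add_one, fin3_one_add_two,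
    fin3_two_add_one, fin3_two_add_two]
  ring

/-- Complex conjugation as a real continuous linear map. -/
def cjL : C3 →L[ℝ] C3 where
  toFun := cj
  map_add' x y := by ext i; simp
  map_smul' c x := by ext i; simp
  cont := continuous_cj

@[simp] lemma cjL_apply (x : C3) : cjL x = cj x := rfl

lemma Herm.rsmul {f : R3 → C3} (hf : Herm f) {m : R3 → ℝ} (hm : ∀ ξ, m (-ξ) = m ξ) :
    Herm fun ξ => m ξ • f ξ := by
  filter_upwards [hf] with ξ h
  rw [hm, h]
  exact (cjL.map_smul (m ξ) (f ξ)).symm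

lemma DivFree.rsmul {f : R3 → C3} (hf : DivFree f) (m : R3 → ℝ) : DivFree fun ξ => m ξ • f ξ := by
  filter_upwards [hf] with ξ h
  rw [dt_rsmul_right, h, mul_zero]

lemma Herm.congr {f g : R3 → C3} (hf : Herm f) (h : f =ᵐ[volume] g) : Herm g := by
  have h' := (Measure.measurePreserving_neg (volume : Measure R3)).quasiMeasurePreserving.ae h
  filter_upwards [hf, h, h'] with ξ h1 h2 h3
  rw [← h2, ← h3, h1]

lemma DivFree.congr {f g : R3 → C3} (hf : DivFree f) (h : f =ᵐ[volume] g) : DivFree g := by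
  filter_upwards [hf, h] with ξ h1 h2
  rw [← h2, h1]

/-- Under reflection of all frequencies each of the two curls contributes a sign, and the signs
cancel. -/
lemma Herm.Nl {a : ℝ} {g u : R3 → C3} (hg : Herm g) (hu : Herm u) : Herm (Nl a g u) := by
  refine Filter.Eventually.of_forall fun ξ => ?_
  unfold ActiveVector.Nl
  rw [cj_cr, cj_cv, cv_neg]
  have h1 : ∫ η, cr ((‖η‖ ^ (-a)) • cr (cv η) (g η)) (u (-ξ - η)) =
      ∫ η, -cj (cr ((‖η‖ ^ (-a)) • cr (cv η) (g η)) (u (ξ - η))) := by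
    rw [← integral_neg_eq_self]
    refine integral_congr_ae ?_
    filter_upwards [hg, (quasiMeasurePreserving_sub_left_of_right_invariant volume ξ).ae hu]
      with η k1 k2
    have k3 : -ξ - -η = -(ξ - η) := by abel
    rw [k3, k2, k1, norm_neg, cv_neg, cj_cr]
    ext i
    simp
    ring
  have h2 : ∫ η, cj (cr ((‖η‖ ^ (-a)) • cr (cv η) (g η)) (u (ξ - η))) =
      cj (∫ η, cr ((‖η‖ ^ (-a)) • cr (cv η) (g η)) (u (ξ - η))) := by
    have e : ∀ x : C3, cj x = (LinearIsometryEquiv.mk (LinearEquiv.mk cjL.toLinearMap cj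
      cj_cj cj_cj) norm_cj : C3 ≃ₗᵢ[ℝ] C3).toContinuousLinearEquiv x := fun x => rfl
    simp only [e]
    exact ContinuousLinearEquiv.integral_comp_comm _ _
  rw [h1, integral_neg, h2]
  ext i
  simp

lemma divFree_Nl (a : ℝ) (g u : R3 → C3) : DivFree (Nl a g u) :=
  Filter.Eventually.of_forall fun _ => dt_cr_self _ _

/-- Transforms of real divergence-free square integrable fields. -/
def solenoidal : Submodule ℝ VL2 where
  carrier := {g | Herm g ∧ DivFree g}
  zero_mem' := by
    have h0 := Lp.coeFn_zero C3 2 (volume : Measure R3)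
    refine ⟨Herm.congr (f := fun _ => 0) ?_ h0.symm, DivFree.congr (f := fun _ => 0) ?_ h0.symm⟩
    · exact Filter.Eventually.of_forall fun ξ => (cjL.map_zero).symm
    · exact Filter.Eventually.of_forall fun ξ => by simp [dt]
  add_mem' := fun {f g} hf hg => by
    have h0 := Lp.coeFn_add f g
    refine ⟨Herm.congr ?_ h0.symm, DivFree.congr ?_ h0.symm⟩
    · filter_upwards [hf.1, hg.1] with ξ h1 h2
      rw [Pi.add_apply, Pi.add_apply, h1, h2]
      exact (cjL.map_add _ _).symm
    · filter_upwards [hf.2, hg.2] with ξ h1 h2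
      rw [Pi.add_apply, dt_add_right, h1, h2, add_zero]
  smul_mem' := fun c g hg => by
    have h0 := Lp.coeFn_smul c g
    exact ⟨Herm.congr (hg.1.rsmul (m := fun _ => c) fun _ => rfl) h0.symm,
      DivFree.congr (hg.2.rsmul fun _ => c) h0.symm⟩

/-- L² convergence gives almost everywhere convergence along a subsequence, and both constraints are
pointwise and closed. Completeness is needed in order to solve the approximate equations inside the
subspace. -/
lemma isClosed_solenoidal : IsClosed (solenoidal : Set VL2) := by
  refine isClosed_of_closure_subset fun g hg => ?_
  obtain ⟨u, hu, hlim⟩ := mem_closure_iff_seq_limit.1 hg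
  have hm := tendstoInMeasure_of_tendsto_Lp hlim
  obtain ⟨ns, -, hns⟩ := hm.exists_seq_tendsto_ae
  have hns' := (Measure.measurePreserving_neg (volume : Measure R3)).quasiMeasurePreserving.ae hns
  have h1 : ∀ᵐ ξ, ∀ n, u n (-ξ) = cj (u n ξ) := ae_all_iff.2 fun n => (hu n).1
  have h2 : ∀ᵐ ξ, ∀ n, dt (cv ξ) (u n ξ) = 0 := ae_all_iff.2 fun n => (hu n).2
  refine ⟨?_, ?_⟩
  · filter_upwards [hns, hns', h1] with ξ k1 k2 k3
    refine tendsto_nhds_unique k2 ?_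
    simp only [k3]
    exact (continuous_cj.tendsto _).comp k1
  · filter_upwards [hns, h2] with ξ k1 k2
    have k3 : Filter.Tendsto (fun n => dt (cv ξ) (u (ns n) ξ)) Filter.atTop
        (nhds (dt (cv ξ) (g ξ))) :=
      ((continuous_dt.comp (Continuous.prodMk_right (cv ξ))).tendsto _).comp k1
    simp only [k2] at k3
    exact (tendsto_nhds_unique k3 tendsto_const_nhds)

instance : CompleteSpace solenoidal := isClosed_solenoidal.completeSpace_coe

lemma bmul_mem_solenoidal {m : R3 → ℝ} {C : ℝ} (h : BddBy m C) (hm : ∀ ξ, m (-ξ) = m ξ) {g : VL2}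
    (hg : g ∈ solenoidal) : bmul m g ∈ solenoidal :=
  ⟨(hg.1.rsmul hm).congr (bmul_ae h g).symm, (hg.2.rsmul m).congr (bmul_ae h g).symm⟩

lemma herm_fld {s : ℝ} {g : VL2} (hg : g ∈ solenoidal) : Herm (fld s g) :=
  hg.1.rsmul (bw_neg_arg _)

lemma divFree_fld {s : ℝ} {g : VL2} (hg : g ∈ solenoidal) : DivFree (fld s g) :=
  hg.2.rsmul _

lemma bilin_mem_solenoidal {a s : ℝ} {B : VL2 →L[ℝ] VL2 →L[ℝ] VL2} (hB : IsBilin a s B)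
    {g h : VL2} (hg : g ∈ solenoidal) (hh : h ∈ solenoidal) : B g h ∈ solenoidal :=
  ⟨((herm_fld hg).Nl (herm_fld hh)).congr (hB g h).symm,
    (divFree_Nl _ _ _).congr (hB g h).symm⟩

/-! ### Frequency cut-offs and energy inequalities for the bilinear operator -/

/-- Sharp frequency cut-off. -/
def cut (n : ℝ) (ξ : R3) : ℝ := if ‖ξ‖ ≤ n then 1 else 0

lemma measurable_cut (n : ℝ) : Measurable (cut n) :=
  Measurable.ite (measurableSet_le measurable_norm measurable_const) measurable_const
    measurable_const

lemma cut_nonneg (n : ℝ) (ξ : R3) : 0 ≤ cut n ξ := by unfold cut; split_ifs <;> norm_num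
lemma cut_le_one (n : ℝ) (ξ : R3) : cut n ξ ≤ 1 := by unfold cut; split_ifs <;> norm_num
lemma cut_neg_arg (n : ℝ) (ξ : R3) : cut n (-ξ) = cut n ξ := by simp [cut]
lemma cut_mul_self (n : ℝ) (ξ : R3) : cut n ξ * cut n ξ = cut n ξ := by
  unfold cut; split_ifs <;> norm_num
lemma cut_mul_cut {m n : ℝ} (h : m ≤ n) (ξ : R3) : cut m ξ * cut n ξ = cut m ξ := by
  unfold cut
  split_ifs with h1 h2 <;> first | exact absurd (h1.trans h) h2 | norm_num

lemma bddBy_cut (n : ℝ) : BddBy (cut n) 1 :=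
  ⟨measurable_cut n, fun ξ => by rw [abs_of_nonneg (cut_nonneg n ξ)]; exact cut_le_one n ξ⟩

/-- A function that is bounded on a ball gives a bounded multiplier after cut-off. -/
lemma bddBy_cut_mul {m : R3 → ℝ} (hm : Measurable m) {n C : ℝ} (hC : 0 ≤ C)
    (h : ∀ ξ, ‖ξ‖ ≤ n → |m ξ| ≤ C) : BddBy (fun ξ => cut n ξ * m ξ) C :=
  ⟨(measurable_cut n).mul hm, fun ξ => by
    simp only [cut]
    split_ifs with h1
    · simpa using h ξ h1
    · simpa using hC⟩

/-- The multiplier `bw (-s)` turns h back into its field, so this is the unweighted L² pairing.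
Together with `inner_bilin_transport_le` it serves the difference of two solutions, for which no
control of order s is available. -/
lemma inner_bilin_skew_le {a s : ℝ} (ha₀ : 0 ≤ a) (ha : a < 1) (hs : 7 / 2 - a < s)
    {B : VL2 →L[ℝ] VL2 →L[ℝ] VL2} (hB : IsBilin a s B) {h g : VL2} (hg : g ∈ solenoidal) :
    (inner ℂ (bmul (bw (-s)) h) (B h g) : ℂ).re ≤
      (∫ ξ, (‖ξ‖ ^ ((1 - a) / 2) * ‖fld s h ξ‖) ^ 2) * (sobConst 1 s * ‖g‖) := by
  rw [inner_bilin_eq ha hs hB (bmul_ae (bddBy_bw (by linarith)) h) (Filter.EventuallyEq.refl _ _)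
    (Filter.EventuallyEq.refl _ _) (hs_fld s h)]
  refine (re_integral_tri_skew_le ha₀ ha hs (hs_fld s h) (hs_fld s g) (herm_fld hg)).trans ?_
  refine mul_le_mul_of_nonneg_left ?_ (integral_nonneg fun _ => sq_nonneg _)
  have := ((hs_fld s g).integrable_mul_norm (q := 1) (by linarith) measurable_norm
    (fun ξ => norm_nonneg ξ) norm_le_bw_one).2
  rwa [hsNorm_fld] at this

lemma inner_bilin_transport_le {a s : ℝ} (ha : a < 1) (hs : 7 / 2 - a < s)
    {B : VL2 →L[ℝ] VL2 →L[ℝ] VL2} (hB : IsBilin a s B) {h g : VL2} (hg : g ∈ solenoidal)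
    (hh : h ∈ solenoidal) :
    (inner ℂ (bmul (bw (-s)) h) (B g h) : ℂ).re ≤
      (∫ ξ, ‖fld s h ξ‖ ^ 2) * (sobConst (2 - a) s * ‖g‖) := by
  rw [inner_bilin_eq ha hs hB (bmul_ae (bddBy_bw (by linarith)) h) (Filter.EventuallyEq.refl _ _)
    (Filter.EventuallyEq.refl _ _) (hs_fld s h)]
  refine (re_integral_tri_transport_le ha hs (hs_fld s h) (hs_fld s g) (herm_fld hg)
    (divFree_fld hh)).trans ?_
  refine mul_le_mul_of_nonneg_left ?_ (integral_nonneg fun _ => sq_nonneg _)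
  have := ((hs_fld s g).integrable_mul_norm (q := 2 - a) (m := fun ξ => ‖ξ‖ ^ (2 - a))
    (by linarith) (measurable_norm.pow_const _) (fun ξ => by positivity)
    (norm_rpow_le_bw (by linarith))).2
  rwa [hsNorm_fld] at this

/-- A radial weight growing slightly faster than `r ^ s`. -/
structure IsWeight (s : ℝ) (ψ : ℝ → ℝ) : Prop where
  measurable : Measurable ψ
  nonneg : ∀ r, 0 ≤ ψ r
  up : ∀ r l, 0 ≤ r → 1 ≤ l → ψ (l * r) ≤ l ^ (s + 1) * ψ r
  low : ∀ r l, 0 ≤ r → 1 ≤ l → l * ψ r ≤ ψ (l * r)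
  rpow_le : ∀ r, 0 ≤ r → r ^ s ≤ ψ r

lemma IsWeight.mono {s : ℝ} {ψ : ℝ → ℝ} (h : IsWeight s ψ) {r n : ℝ} (hr : 0 ≤ r) (hrn : r ≤ n) :
    ψ r ≤ ψ n := by
  rcases hr.eq_or_lt with h0 | h0
  · have h1 := h.low 0 2 le_rfl (by norm_num)
    rw [mul_zero] at h1
    have h2 := h.nonneg 0
    rw [← h0]
    linarith [h.nonneg n]
  · have hl : 1 ≤ n / r := (one_le_div h0).2 hrn
    have h1 := h.low r (n / r) hr hl
    rw [div_mul_cancel₀ _ h0.ne'] at h1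
    nlinarith [h.nonneg r]

/-- The weighted energy estimate for frequency-localized fields. -/
lemma inner_bilin_weight_le {a s : ℝ} {ψ : ℝ → ℝ} (ha₀ : 0 ≤ a) (ha : a < 1) (hs : 7 / 2 - a < s)
    (hψ : IsWeight s ψ) {B : VL2 →L[ℝ] VL2 →L[ℝ] VL2} (hB : IsBilin a s B) {g W : VL2} {n : ℝ}
    (hg : g ∈ solenoidal) (hcut : ∀ᵐ ξ, g ξ = cut n ξ • g ξ)
    (hW : W =ᵐ[volume] fun ξ => (1 + ψ ‖ξ‖ ^ 2) • fld s g ξ) :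
    (inner ℂ W (B g g) : ℂ).re ≤
      ((2 * (2 ^ (s + 1) + (s + 1) + 1) + 1) * (sobConst 1 s + sobConst (2 - a) s) * ‖g‖) *
        ∫ ξ, (‖ξ‖ ^ (1 - a) + 1) * ((1 + ψ ‖ξ‖ ^ 2) * ‖fld s g ξ‖ ^ 2) := by
  -- With the cut-off written into the representative, multiplication by ψ preserves `Hs s`. This is
  -- purely qualitative: n and ψ(n) do not enter the final bound.
  set f : R3 → C3 := fun ξ => cut n ξ • fld s g ξ with hf
  have hff : fld s g =ᵐ[volume] f := by
    filter_upwards [hcut] with ξ h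
    rw [hf]; simp only [fld]
    rw [smul_comm, ← h]
  have hfHs : Hs s f := (hs_fld s g).ae_eq (by filter_upwards [hff] with ξ h; rw [h])
  have hψn : ∀ ξ, cut n ξ * ψ ‖ξ‖ ≤ cut n ξ * ψ n := fun ξ => by
    unfold cut
    split_ifs with h
    · simpa using hψ.mono (norm_nonneg ξ) h
    · simp
  have hψm : Measurable fun ξ : R3 => ψ ‖ξ‖ := hψ.measurable.comp measurable_norm
  set F : R3 → C3 := fun ξ => ψ ‖ξ‖ • f ξ with hF
  have hmulHs : ∀ {u : R3 → C3}, Hs s u → (∀ ξ, u ξ = cut n ξ • u ξ) →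
      Hs s (fun ξ => ψ ‖ξ‖ • u ξ) := by
    intro u hu hcu
    have := hu.memLp_smul (m := fun ξ => bw s ξ * (cut n ξ * ψ ‖ξ‖)) (C := ψ n)
      ((measurable_bw s).mul ((measurable_cut n).mul hψm)) (fun ξ => by
        rw [abs_of_nonneg (mul_nonneg (bw_nonneg _ _)
          (mul_nonneg (cut_nonneg _ _) (hψ.nonneg _))), mul_comm]
        have h1 : cut n ξ * ψ ‖ξ‖ ≤ ψ n := (hψn ξ).trans (by
          have := cut_le_one n ξ
          nlinarith [hψ.nonneg n])
        exact mul_le_mul_of_nonneg_right h1 (bw_nonneg _ _))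
    refine this.ae_eq (Filter.Eventually.of_forall fun ξ => ?_)
    simp only
    rw [mul_smul, mul_comm, mul_smul, ← hcu]
  have hcf : ∀ ξ, f ξ = cut n ξ • f ξ := fun ξ => by
    rw [hf]; simp only [smul_smul, cut_mul_self]
  have hFHs : Hs s F := hmulHs hfHs hcf
  have hcF : ∀ ξ, F ξ = cut n ξ • F ξ := fun ξ => by
    calc ψ ‖ξ‖ • f ξ = ψ ‖ξ‖ • (cut n ξ • f ξ) := by rw [← hcf]
      _ = _ := smul_comm _ _ _
  have hψF : Hs s (fun ξ => ψ ‖ξ‖ • F ξ) := hmulHs hFHs hcF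
  have hW' : W =ᵐ[volume] fun ξ => f ξ + ψ ‖ξ‖ • F ξ := by
    filter_upwards [hW, hff] with ξ h1 h2
    rw [h1, h2, hF, add_smul, one_smul, sq, mul_smul]
  have hWs : Hs s (fun ξ => f ξ + ψ ‖ξ‖ • F ξ) := by
    have := hfHs.add hψF
    refine this.ae_eq (Filter.Eventually.of_forall fun ξ => ?_)
    simp [smul_add]
  have hherm : Herm f := (herm_fld hg).congr hff
  have hdiv : DivFree f := (divFree_fld hg).congr hff
  have hσ : 1 ≤ s + 1 := by linarith
  set K : ℝ := 2 * (2 ^ (s + 1) + (s + 1) + 1) + 1 with hK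
  have hK1 : 1 ≤ K := by
    have : (0 : ℝ) ≤ 2 ^ (s + 1) := by positivity
    rw [hK]; linarith
  have e1 := re_integral_weight_tri_le ha₀ ha hs hσ hψ.measurable hψ.nonneg hψ.up hψ.low hfHs hFHs
    (fun ξ => rfl) hherm hdiv
  have e2 := re_integral_tri_skew_le ha₀ ha hs hfHs hfHs hherm
  have hn : hsNorm s f = ‖g‖ := by
    rw [← hsNorm_fld s g]
    unfold hsNorm
    congr 1
    refine integral_congr_ae ?_
    filter_upwards [hff] with ξ h; rw [h]
  have r1 := (hfHs.integrable_mul_norm (q := 1) (by linarith) measurable_norm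
    (fun ξ => norm_nonneg ξ) norm_le_bw_one).2
  have r2 := (hfHs.integrable_mul_norm (q := 2 - a) (m := fun ξ => ‖ξ‖ ^ (2 - a))
    (by linarith) (measurable_norm.pow_const _) (fun ξ => by positivity)
    (norm_rpow_le_bw (by linarith))).2
  rw [hn] at r1 r2
  -- In the weight 1 + ψ² the 1 controls low frequencies, where ψ degenerates, and is handled by
  -- skew symmetry alone; ψ² = ψ · ψ is handled by the weighted estimate.
  have hsplit : (inner ℂ W (B g g) : ℂ) =
      (∫ z : R3 × R3, tri a z.1 z.2 (f z.1) (f z.2) (f (z.1 - z.2)) ∂(volume.prod volume)) +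
      ∫ z : R3 × R3, (ψ ‖z.1‖ : ℂ) * tri a z.1 z.2 (F z.1) (f z.2) (f (z.1 - z.2))
        ∂(volume.prod volume) := by
    rw [inner_bilin_eq ha hs hB hW' hff hff hWs]
    have ht : ∀ z : R3 × R3, tri a z.1 z.2 (ψ ‖z.1‖ • F z.1) (f z.2) (f (z.1 - z.2)) =
        (ψ ‖z.1‖ : ℂ) * tri a z.1 z.2 (F z.1) (f z.2) (f (z.1 - z.2)) := fun z => by
      rw [tri, tri, ← Complex.coe_smul (ψ ‖z.1‖), inner_smul_left, Complex.conj_ofReal]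
    simp only [← ht]
    rw [← integral_add (integrable_tri ha hs hfHs hfHs hfHs)
      (integrable_tri ha hs hψF hfHs hfHs)]
    refine integral_congr_ae (Filter.Eventually.of_forall fun z => ?_)
    simp only [tri, inner_add_left]
  have hα : ∀ u : R3 → C3, ∀ ξ, (‖ξ‖ ^ ((1 - a) / 2) * ‖u ξ‖) ^ 2 = ‖ξ‖ ^ (1 - a) * ‖u ξ‖ ^ 2 :=
    fun u ξ => by
      rw [mul_pow, ← Real.rpow_natCast, ← Real.rpow_mul (norm_nonneg _)]
      norm_num
  have hint : ∀ {u : R3 → C3}, Hs s u → Integrable (fun ξ => ‖ξ‖ ^ (1 - a) * ‖u ξ‖ ^ 2) ∧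
      Integrable fun ξ => ‖u ξ‖ ^ 2 := by
    intro u hu
    constructor
    · have := hu.integrable_sq (m := fun ξ => ‖ξ‖ ^ ((1 - a) / 2)) (measurable_norm.pow_const _)
        (C := 1) fun ξ => by
        rw [abs_of_nonneg (by positivity), one_mul]
        exact (norm_rpow_le_bw (by linarith) ξ).trans (bw_mono (by linarith) ξ)
      simpa only [hα] using this
    · have := hu.integrable_sq (measurable_const (a := (1 : ℝ))) (C := 1) fun ξ => by
        rw [abs_one, one_mul]; exact one_le_bw (by linarith) ξ
      simpa using this
  have hlast : ∫ ξ, (‖ξ‖ ^ (1 - a) + 1) * ((1 + ψ ‖ξ‖ ^ 2) * ‖fld s g ξ‖ ^ 2) =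
      (∫ ξ, ‖ξ‖ ^ (1 - a) * ‖f ξ‖ ^ 2) + (∫ ξ, ‖f ξ‖ ^ 2) +
        ((∫ ξ, ‖ξ‖ ^ (1 - a) * ‖F ξ‖ ^ 2) + ∫ ξ, ‖F ξ‖ ^ 2) := by
    have k1 : Integrable fun ξ => ‖ξ‖ ^ (1 - a) * ‖f ξ‖ ^ 2 + ‖f ξ‖ ^ 2 :=
      (hint hfHs).1.add (hint hfHs).2
    have k2 : Integrable fun ξ => ‖ξ‖ ^ (1 - a) * ‖F ξ‖ ^ 2 + ‖F ξ‖ ^ 2 :=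
      (hint hFHs).1.add (hint hFHs).2
    rw [← integral_add (hint hfHs).1 (hint hfHs).2, ← integral_add (hint hFHs).1 (hint hFHs).2,
      ← integral_add k1 k2]
    refine integral_congr_ae ?_
    filter_upwards [hff] with ξ h
    have : ‖F ξ‖ = ψ ‖ξ‖ * ‖f ξ‖ := by
      rw [hF, norm_smul, Real.norm_of_nonneg (hψ.nonneg _)]
    simp only [h, this]
    ring
  rw [hsplit, Complex.add_re, hlast]
  simp only [hα] at e1 e2
  have i1 : 0 ≤ ∫ ξ, ‖ξ‖ ^ (1 - a) * ‖f ξ‖ ^ 2 := integral_nonneg fun _ => by positivity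
  have i2 : 0 ≤ ∫ ξ, ‖f ξ‖ ^ 2 := integral_nonneg fun _ => by positivity
  have i3 : 0 ≤ ∫ ξ, ‖ξ‖ ^ (1 - a) * ‖F ξ‖ ^ 2 := integral_nonneg fun _ => by positivity
  have i4 : 0 ≤ ∫ ξ, ‖F ξ‖ ^ 2 := integral_nonneg fun _ => by positivity
  set I1 := ∫ ξ, ‖ξ‖ ^ (1 - a) * ‖f ξ‖ ^ 2
  set I2 := ∫ ξ, ‖f ξ‖ ^ 2
  set I3 := ∫ ξ, ‖ξ‖ ^ (1 - a) * ‖F ξ‖ ^ 2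
  set I4 := ∫ ξ, ‖F ξ‖ ^ 2
  have s1 := sobConst_nonneg 1 s
  have s2 := sobConst_nonneg (2 - a) s
  have hg0 := norm_nonneg g
  set S := sobConst 1 s + sobConst (2 - a) s with hS
  have t1 : ∫ ξ, ‖ξ‖ * ‖f ξ‖ ≤ S * ‖g‖ := r1.trans (by gcongr; linarith)
  have t2 : ∫ ξ, ‖ξ‖ ^ (2 - a) * ‖f ξ‖ ≤ S * ‖g‖ := r2.trans (by gcongr; linarith)
  have t3 : 0 ≤ S * ‖g‖ := by positivity
  calc _ ≤ I1 * (S * ‖g‖) + K * (I3 * (S * ‖g‖) + I4 * (S * ‖g‖)) := by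
        refine add_le_add (e2.trans (by gcongr)) (e1.trans ?_)
        gcongr
    _ ≤ K * (I1 * (S * ‖g‖)) + K * (I3 * (S * ‖g‖) + I4 * (S * ‖g‖)) + K * (I2 * (S * ‖g‖)) := by
        have : 0 ≤ K * (I2 * (S * ‖g‖)) := by positivity
        have : I1 * (S * ‖g‖) ≤ K * (I1 * (S * ‖g‖)) := le_mul_of_one_le_left (by positivity) hK1
        linarith
    _ = _ := by ring

/-! ### Truncated ordinary differential equations and Gronwall's inequality -/

/-- The radial retraction onto the ball of radius `R`. -/
def retr {Y : Type*} [NormedAddCommGroup Y] [NormedSpace ℝ Y] (R : ℝ) (x : Y) : Y :=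
  (R / max R ‖x‖) • x

section Retraction

variable {Y : Type*} [NormedAddCommGroup Y] [NormedSpace ℝ Y]

lemma norm_retr_le {R : ℝ} (hR : 0 < R) (x : Y) : ‖retr R x‖ ≤ R := by
  have hm : 0 < max R ‖x‖ := lt_max_of_lt_left hR
  rw [retr, norm_smul, Real.norm_of_nonneg (by positivity), div_mul_eq_mul_div, div_le_iff₀ hm]
  gcongr
  exact le_max_right _ _

lemma retr_of_norm_le {R : ℝ} (hR : 0 < R) {x : Y} (hx : ‖x‖ ≤ R) : retr R x = x := by
  rw [retr, max_eq_left hx, div_self hR.ne', one_smul]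

lemma norm_retr_sub_le {R : ℝ} (hR : 0 < R) (x y : Y) :
    ‖retr R x - retr R y‖ ≤ 2 * ‖x - y‖ := by
  have hx : 0 < max R ‖x‖ := lt_max_of_lt_left hR
  have hy : 0 < max R ‖y‖ := lt_max_of_lt_left hR
  set l := R / max R ‖x‖ with hl
  set k := R / max R ‖y‖ with hk
  have hl1 : l ≤ 1 := (div_le_one hx).2 (le_max_left _ _)
  have hl0 : 0 ≤ l := by positivity
  have hdiff : |l - k| * ‖y‖ ≤ ‖x - y‖ := by
    have e : l - k = l * ((max R ‖y‖ - max R ‖x‖) / max R ‖y‖) := by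
      rw [hl, hk]; field_simp
    have h1 : |max R ‖y‖ - max R ‖x‖| ≤ ‖x - y‖ := by
      refine (abs_max_sub_max_le_max _ _ _ _).trans ?_
      rw [sub_self, abs_zero, max_eq_right (abs_nonneg _), abs_sub_comm]
      exact abs_norm_sub_norm_le x y
    rw [e, abs_mul, abs_of_nonneg hl0, abs_div, abs_of_pos hy]
    have h2 : ‖y‖ / max R ‖y‖ ≤ 1 := (div_le_one hy).2 (le_max_right _ _)
    calc _ = l * (|max R ‖y‖ - max R ‖x‖| * (‖y‖ / max R ‖y‖)) := by ring
      _ ≤ 1 * (‖x - y‖ * 1) := by gcongr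
      _ = _ := by ring
  have e : retr R x - retr R y = l • (x - y) + (l - k) • y := by
    rw [retr, retr, ← hl, ← hk, smul_sub, sub_smul]; abel
  rw [e]
  calc _ ≤ ‖l • (x - y)‖ + ‖(l - k) • y‖ := norm_add_le _ _
    _ ≤ 1 * ‖x - y‖ + ‖x - y‖ := by
        rw [norm_smul, norm_smul, Real.norm_of_nonneg hl0, Real.norm_eq_abs]
        gcongr
    _ = _ := by ring

/-- Solvability on a given time interval of an equation truncated by the radial retraction. -/
lemma exists_ode_retr [CompleteSpace Y] {Φ : Y → Y} {R K : ℝ} (hR : 0 < R) (hK : 0 ≤ K)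
    (hΦ : ∀ x y : Y, ‖x‖ ≤ R → ‖y‖ ≤ R → ‖Φ x - Φ y‖ ≤ K * ‖x - y‖) (x₀ : Y) {T : ℝ}
    (hT : 0 ≤ T) :
    ∃ G : ℝ → Y, G 0 = x₀ ∧
      ∀ t ∈ Set.Icc 0 T, HasDerivWithinAt G (Φ (retr R (G t))) (Set.Icc 0 T) t := by
  set L : ℝ := ‖Φ 0‖ + K * R with hL
  have hL0 : 0 ≤ L := by positivity
  have hb : ∀ x : Y, ‖Φ (retr R x)‖ ≤ L := fun x => by
    have h1 := hΦ (retr R x) 0 (norm_retr_le hR x) (by simpa using hR.le)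
    rw [sub_zero] at h1
    calc _ = ‖(Φ (retr R x) - Φ 0) + Φ 0‖ := by rw [sub_add_cancel]
      _ ≤ ‖Φ (retr R x) - Φ 0‖ + ‖Φ 0‖ := norm_add_le _ _
      _ ≤ K * ‖retr R x‖ + ‖Φ 0‖ := by gcongr
      _ ≤ K * R + ‖Φ 0‖ := by gcongr; exact norm_retr_le hR x
      _ = _ := by rw [hL]; ring
  -- The retracted field is bounded by L and globally Lipschitz. In time T a solution moves at most
  -- L T, so that radius makes the whole interval admissible.
  have hPL : IsPicardLindelof (fun _ : ℝ => fun x : Y => Φ (retr R x))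
      (⟨0, le_rfl, hT⟩ : Set.Icc (0 : ℝ) T) x₀ (Real.toNNReal (L * T)) 0 (Real.toNNReal L)
      (Real.toNNReal (K * 2)) := by
    refine IsPicardLindelof.of_time_independent (fun x _ => ?_) ?_ ?_
    · rw [Real.coe_toNNReal _ hL0]; exact hb x
    · refine LipschitzWith.lipschitzOnWith (LipschitzWith.of_dist_le_mul fun x y => ?_)
      rw [Real.coe_toNNReal _ (by positivity), dist_eq_norm, dist_eq_norm]
      refine (hΦ _ _ (norm_retr_le hR x) (norm_retr_le hR y)).trans ?_
      rw [mul_assoc]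
      gcongr
      exact norm_retr_sub_le hR x y
    · rw [Real.coe_toNNReal _ hL0, Real.coe_toNNReal _ (by positivity)]
      simp [hT]
  obtain ⟨G, hG0, hG⟩ := hPL.exists_eq_forall_mem_Icc_hasDerivWithinAt₀
  exact ⟨G, hG0, hG⟩

end Retraction

lemma re_inner_rsmul_right (c : ℝ) (x y : VL2) :
    (inner ℂ x (c • y) : ℂ).re = c * (inner ℂ x y : ℂ).re := by
  have : c • y = (c : ℂ) • y := by
    refine Lp.ext ?_
    filter_upwards [Lp.coeFn_smul c y, Lp.coeFn_smul (c : ℂ) y] with ξ h1 h2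
    rw [h1, h2, Pi.smul_apply, Pi.smul_apply, Complex.coe_smul]
  rw [this, inner_smul_right, Complex.re_ofReal_mul]

lemma re_inner_symm (x y : VL2) : (inner ℂ x y : ℂ).re = (inner ℂ y x : ℂ).re :=
  inner_re_symm (𝕜 := ℂ) x y

lemma re_inner_rsmul_left (c : ℝ) (x y : VL2) :
    (inner ℂ (c • x) y : ℂ).re = c * (inner ℂ x y : ℂ).re := by
  rw [re_inner_symm, re_inner_rsmul_right, re_inner_symm]

lemma hasDerivWithinAt_norm_sq {u : ℝ → VL2} {u' : VL2} {S : Set ℝ} {t : ℝ}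
    (h : HasDerivWithinAt u u' S t) :
    HasDerivWithinAt (fun τ => ‖u τ‖ ^ 2) (2 * (inner ℂ (u t) u' : ℂ).re) S t := by
  have h1 := h.inner ℂ h
  have h2 : HasDerivWithinAt (fun τ => (inner ℂ (u τ) (u τ) : ℂ).re)
      (inner ℂ (u t) u' + inner ℂ u' (u t) : ℂ).re S t :=
    (Complex.reCLM.hasFDerivAt.comp_hasDerivWithinAt t h1)
  have h3 : (inner ℂ u' (u t) : ℂ).re = (inner ℂ (u t) u' : ℂ).re :=
    inner_re_symm (𝕜 := ℂ) u' (u t)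
  rw [Complex.add_re, h3, ← two_mul] at h2
  have e : (fun τ => ‖u τ‖ ^ 2) = fun τ => (inner ℂ (u τ) (u τ) : ℂ).re := funext fun τ => by
    rw [← inner_self_eq_norm_sq (𝕜 := ℂ)]; rfl
  rwa [e]

lemma gronwall_Icc {y y' : ℝ → ℝ} {C ε T : ℝ}
    (hy : ∀ t ∈ Set.Icc 0 T, HasDerivWithinAt y (y' t) (Set.Icc 0 T) t)
    (hle : ∀ t ∈ Set.Icc 0 T, y' t ≤ C * y t + ε) :
    ∀ t ∈ Set.Icc 0 T, y t ≤ gronwallBound (y 0) C ε t := by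
  intro t ht
  have := le_gronwallBound_of_liminf_deriv_right_le (f := y) (f' := y') (δ := y 0) (K := C)
    (ε := ε) (a := 0) (b := T) (fun x hx => (hy x hx).continuousWithinAt) (fun x hx r hr => ?_)
    le_rfl (fun x hx => hle x (Set.Ico_subset_Icc_self hx)) t ht
  · simpa using this
  · have h1 : HasDerivWithinAt y (y' x) (Set.Ici x) x :=
      (hy x (Set.Ico_subset_Icc_self hx)).mono_of_mem_nhdsWithin
        (Filter.mem_of_superset (Icc_mem_nhdsGE hx.2) (Set.Icc_subset_Icc_left hx.1))
    have := h1.liminf_right_slope_le hr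
    simpa [slope_def_field, div_eq_inv_mul] using this

lemma BddBy.integrable_mul_sq {m : R3 → ℝ} {C : ℝ} (h : BddBy m C) (g : VL2) :
    Integrable fun ξ => m ξ * ‖g ξ‖ ^ 2 := by
  have h1 : Integrable fun ξ => ‖g ξ‖ ^ 2 := (Lp.memLp g).integrable_norm_pow (by norm_num)
  exact h1.bdd_mul (c := C) h.1.aestronglyMeasurable (Filter.Eventually.of_forall h.2)

lemma re_inner_bmul_self {m : R3 → ℝ} {C : ℝ} (h : BddBy m C) (g : VL2) :
    (inner ℂ g (bmul m g) : ℂ).re = ∫ ξ, m ξ * ‖g ξ‖ ^ 2 := by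
  have h3 : (inner ℂ g (bmul m g) : ℂ) = ∫ ξ, ((m ξ * ‖g ξ‖ ^ 2 : ℝ) : ℂ) := by
    rw [L2.inner_def]
    refine integral_congr_ae ?_
    filter_upwards [bmul_ae h g] with ξ h1
    rw [h1, ← Complex.coe_smul, inner_smul_right, inner_self_eq_norm_sq_to_K]
    push_cast
    rfl
  rw [h3, integral_complex_ofReal, Complex.ofReal_re]

/-! ### Frequency-localized approximations with uniform energy bounds -/

/-- The energy weight `(1 + ψ²)^{1/2}`. -/
def Vw (ψ : ℝ → ℝ) (ξ : R3) : ℝ := √(1 + ψ ‖ξ‖ ^ 2)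

lemma Vw_sq (ψ : ℝ → ℝ) (ξ : R3) : Vw ψ ξ ^ 2 = 1 + ψ ‖ξ‖ ^ 2 := Real.sq_sqrt (by positivity)
lemma Vw_pos (ψ : ℝ → ℝ) (ξ : R3) : 0 < Vw ψ ξ := Real.sqrt_pos.2 (by positivity)
lemma one_le_Vw (ψ : ℝ → ℝ) (ξ : R3) : 1 ≤ Vw ψ ξ :=
  Real.one_le_sqrt.2 (by nlinarith [sq_nonneg (ψ ‖ξ‖)])
lemma Vw_neg_arg (ψ : ℝ → ℝ) (ξ : R3) : Vw ψ (-ξ) = Vw ψ ξ := by simp [Vw]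

lemma IsWeight.measurable_Vw {s : ℝ} {ψ : ℝ → ℝ} (h : IsWeight s ψ) : Measurable (Vw ψ) :=
  (((h.measurable.comp measurable_norm).pow_const 2).const_add 1).sqrt

lemma IsWeight.bw_le_Vw {s : ℝ} (hs : 0 ≤ s) {ψ : ℝ → ℝ} (h : IsWeight s ψ) (ξ : R3) :
    bw s ξ ≤ 2 ^ s * Vw ψ ξ := by
  have h1 := h.rpow_le ‖ξ‖ (norm_nonneg ξ)
  have h2 : ‖ξ‖ ^ s ≤ Vw ψ ξ := h1.trans (Real.le_sqrt_of_sq_le (by linarith))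
  have h3 := one_le_Vw ψ ξ
  have h4 : bw s ξ ≤ (1 + ‖ξ‖) ^ s := by
    unfold bw
    calc (1 + ‖ξ‖ ^ 2) ^ (s / 2) ≤ ((1 + ‖ξ‖) ^ (2 : ℝ)) ^ (s / 2) := by
          refine Real.rpow_le_rpow (by positivity) ?_ (by linarith)
          rw [Real.rpow_two]; nlinarith [norm_nonneg ξ]
      _ = _ := by rw [← Real.rpow_mul (by positivity)]; ring_nf
  refine h4.trans ?_
  rcases le_total ‖ξ‖ 1 with h5 | h5
  · calc (1 + ‖ξ‖) ^ s ≤ 2 ^ s := Real.rpow_le_rpow (by positivity) (by linarith) hs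
      _ = 2 ^ s * 1 := by ring
      _ ≤ _ := by gcongr
  · calc (1 + ‖ξ‖) ^ s ≤ (2 * ‖ξ‖) ^ s := Real.rpow_le_rpow (by positivity) (by linarith) hs
      _ = 2 ^ s * ‖ξ‖ ^ s := Real.mul_rpow (by norm_num) (norm_nonneg _)
      _ ≤ _ := by gcongr

lemma IsWeight.bddBy_ratio {s : ℝ} (hs : 0 ≤ s) {ψ : ℝ → ℝ} (h : IsWeight s ψ) (n : ℝ) :
    BddBy (fun ξ => cut n ξ * (bw s ξ / Vw ψ ξ)) (2 ^ s) := by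
  refine bddBy_cut_mul (m := fun ξ => bw s ξ / Vw ψ ξ) ((measurable_bw s).div h.measurable_Vw)
    (by positivity) fun ξ _ => ?_
  rw [abs_of_nonneg (div_nonneg (bw_nonneg _ _) (Vw_pos _ _).le), div_le_iff₀ (Vw_pos _ _)]
  exact h.bw_le_Vw hs ξ

lemma IsWeight.bddBy_cut_Vw {s : ℝ} {ψ : ℝ → ℝ} (h : IsWeight s ψ) (n : ℝ) :
    BddBy (fun ξ => cut n ξ * Vw ψ ξ) (√(1 + ψ n ^ 2)) := by
  refine bddBy_cut_mul h.measurable_Vw (by positivity) fun ξ hξ => ?_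
  rw [abs_of_pos (Vw_pos _ _), Vw]
  have := h.mono (norm_nonneg ξ) hξ
  have := h.nonneg ‖ξ‖
  gcongr

/-- The symbol of `Λ^b`. -/
def lam (b : ℝ) (ξ : R3) : ℝ := (2 * Real.pi * ‖ξ‖) ^ b

lemma lam_nonneg (b : ℝ) (ξ : R3) : 0 ≤ lam b ξ := by unfold lam; positivity
lemma lam_neg_arg (b : ℝ) (ξ : R3) : lam b (-ξ) = lam b ξ := by simp [lam]
lemma measurable_lam (b : ℝ) : Measurable (lam b) :=
  (measurable_norm.const_mul _).pow_const _

lemma bddBy_cut_lam {b : ℝ} (hb : 0 ≤ b) (n : ℝ) :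
    BddBy (fun ξ => cut n ξ * lam b ξ) ((2 * Real.pi * |n|) ^ b) := by
  refine bddBy_cut_mul (measurable_lam b) (by positivity) fun ξ hξ => ?_
  rw [abs_of_nonneg (lam_nonneg _ _), lam]
  have : ‖ξ‖ ≤ |n| := hξ.trans (le_abs_self n)
  gcongr

lemma le_lam {b : ℝ} (hb : 0 ≤ b) (ξ : R3) : ‖ξ‖ ^ b ≤ lam b ξ := by
  refine Real.rpow_le_rpow (norm_nonneg _) ?_ hb
  have : 1 ≤ 2 * Real.pi := by linarith [Real.pi_gt_three]
  exact le_mul_of_one_le_left (norm_nonneg _) this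

lemma bddBy_cut_rpow_add_one {α : ℝ} (hα : 0 ≤ α) (n : ℝ) :
    BddBy (fun ξ => cut n ξ * (‖ξ‖ ^ α + 1)) (|n| ^ α + 1) := by
  refine bddBy_cut_mul (m := fun ξ => ‖ξ‖ ^ α + 1)
    ((measurable_norm.pow_const _).add_const 1) (by positivity) fun ξ hξ => ?_
  rw [abs_of_nonneg (by positivity)]
  have : ‖ξ‖ ≤ |n| := hξ.trans (le_abs_self n)
  gcongr

/-- Absorption of the nonlinear growth of order `1 - a` into the dissipation. -/
lemma absorb_le {a b Q M₀ : ℝ} (ha : a < 1) (hb : 1 - a < b) (hQ : 0 ≤ Q) (hM₀ : 0 ≤ M₀)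
    (hM : ∀ x : ℝ, 0 ≤ x → x ^ (1 - a) ≤ 1 / (Q + 1) * x ^ b + M₀) (n : ℝ) (G : VL2) :
    Q * (∫ ξ, (cut n ξ * (‖ξ‖ ^ (1 - a) + 1)) * ‖G ξ‖ ^ 2) -
      (∫ ξ, (cut n ξ * lam b ξ) * ‖G ξ‖ ^ 2) ≤ Q * (M₀ + 1) * ‖G‖ ^ 2 := by
  have hα := bddBy_cut_rpow_add_one (α := 1 - a) (by linarith) n
  have hD := bddBy_cut_lam (b := b) (by linarith) n
  rw [norm_sq_VL2, ← integral_const_mul, ← integral_const_mul,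
    ← integral_sub ((hα.integrable_mul_sq G).const_mul Q) (hD.integrable_mul_sq G)]
  refine integral_mono (((hα.integrable_mul_sq G).const_mul Q).sub (hD.integrable_mul_sq G))
    (((Lp.memLp G).integrable_norm_pow (by norm_num)).const_mul _) fun ξ => ?_
  have k1 := mul_le_mul_of_nonneg_left (hM ‖ξ‖ (norm_nonneg ξ)) hQ
  have k2 := le_lam (b := b) (by linarith) ξ
  -- The denominator is Q + 1 rather than Q so that Q = 0 is allowed; all that matters is Q/(Q+1) ≤
  -- 1.
  have k3 : Q * (1 / (Q + 1) * ‖ξ‖ ^ b) ≤ ‖ξ‖ ^ b := by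
    rw [← mul_assoc]
    refine mul_le_of_le_one_left (by positivity) ?_
    rw [mul_one_div, div_le_one (by positivity)]
    linarith
  have k4 : Q * (‖ξ‖ ^ (1 - a) + 1) - lam b ξ ≤ Q * (M₀ + 1) := by
    rw [mul_add] at k1 ⊢
    linarith
  have k5 := cut_nonneg n ξ
  have k6 : 0 ≤ Q * (M₀ + 1) := by positivity
  calc _ = (cut n ξ * (Q * (‖ξ‖ ^ (1 - a) + 1) - lam b ξ)) * ‖G ξ‖ ^ 2 := by ring
    _ ≤ (cut n ξ * (Q * (M₀ + 1))) * ‖G ξ‖ ^ 2 := by gcongr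
    _ ≤ _ := mul_le_mul_of_nonneg_right (mul_le_of_le_one_left k6 (cut_le_one n ξ)) (by positivity)

/-- The frequency-localized vector field, in the unknown weighted by `Vw ψ`. -/
def galerkinField (b s κ : ℝ) (ψ : ℝ → ℝ) (B : VL2 →L[ℝ] VL2 →L[ℝ] VL2) (n : ℝ) (G : VL2) : VL2 :=
  κ • bmul (fun ξ => cut n ξ * Vw ψ ξ)
      (B (bmul (fun ξ => cut n ξ * (bw s ξ / Vw ψ ξ)) G)
        (bmul (fun ξ => cut n ξ * (bw s ξ / Vw ψ ξ)) G)) -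
    bmul (fun ξ => cut n ξ * lam b ξ) G

lemma galerkinField_mem {a b s κ : ℝ} {ψ : ℝ → ℝ} (hs : 0 ≤ s) (hb : 0 ≤ b) (hψ : IsWeight s ψ)
    {B : VL2 →L[ℝ] VL2 →L[ℝ] VL2} (hB : IsBilin a s B) (n : ℝ) {G : VL2} (hG : G ∈ solenoidal) :
    galerkinField b s κ ψ B n G ∈ solenoidal := by
  have h1 := bmul_mem_solenoidal (hψ.bddBy_ratio hs n)
    (fun ξ => by simp [cut_neg_arg, bw_neg_arg, Vw_neg_arg]) hG
  refine solenoidal.sub_mem (solenoidal.smul_mem _ (bmul_mem_solenoidal (hψ.bddBy_cut_Vw n)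
    (fun ξ => by simp [cut_neg_arg, Vw_neg_arg]) (bilin_mem_solenoidal hB h1 h1))) ?_
  exact bmul_mem_solenoidal (bddBy_cut_lam hb n)
    (fun ξ => by simp [cut_neg_arg, lam_neg_arg]) hG

/-- The constant may depend on n: it is used only to solve the equation for fixed n, while
uniformity comes from `galerkinField_energy`. -/
lemma galerkinField_lipschitz {b s κ : ℝ} {ψ : ℝ → ℝ} (B : VL2 →L[ℝ] VL2 →L[ℝ] VL2) (n : ℝ)
    {R : ℝ} (hR : 0 ≤ R) :
    ∃ K : ℝ, 0 ≤ K ∧ ∀ x y : VL2, ‖x‖ ≤ R → ‖y‖ ≤ R →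
      ‖galerkinField b s κ ψ B n x - galerkinField b s κ ψ B n y‖ ≤ K * ‖x - y‖ := by
  set P := bmul (fun ξ => cut n ξ * Vw ψ ξ)
  set Q := bmul (fun ξ => cut n ξ * (bw s ξ / Vw ψ ξ))
  set D := bmul (fun ξ => cut n ξ * lam b ξ)
  refine ⟨|κ| * (‖P‖ * (2 * (‖B‖ * (‖Q‖ * R) * ‖Q‖))) + ‖D‖, by positivity, fun x y hx hy => ?_⟩
  have e : galerkinField b s κ ψ B n x - galerkinField b s κ ψ B n y =
      κ • P (B (Q x) (Q (x - y)) + B (Q (x - y)) (Q y)) - D (x - y) := by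
    simp only [galerkinField, map_sub, sub_apply, map_add, smul_add, smul_sub,
      P, Q, D]
    abel
  have h1 : ‖B (Q x) (Q (x - y))‖ ≤ ‖B‖ * (‖Q‖ * R) * (‖Q‖ * ‖x - y‖) :=
    (B.le_opNorm₂ _ _).trans (by
      have := (Q.le_opNorm x).trans (mul_le_mul_of_nonneg_left hx (norm_nonneg _))
      have := Q.le_opNorm (x - y)
      gcongr)
  have h2 : ‖B (Q (x - y)) (Q y)‖ ≤ ‖B‖ * (‖Q‖ * ‖x - y‖) * (‖Q‖ * R) :=
    (B.le_opNorm₂ _ _).trans (by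
      have := (Q.le_opNorm y).trans (mul_le_mul_of_nonneg_left hy (norm_nonneg _))
      have := Q.le_opNorm (x - y)
      gcongr)
  rw [e]
  calc _ ≤ ‖κ • P (B (Q x) (Q (x - y)) + B (Q (x - y)) (Q y))‖ + ‖D (x - y)‖ := norm_sub_le _ _
    _ ≤ |κ| * (‖P‖ * (‖B‖ * (‖Q‖ * R) * (‖Q‖ * ‖x - y‖) +
          ‖B‖ * (‖Q‖ * ‖x - y‖) * (‖Q‖ * R))) + ‖D‖ * ‖x - y‖ := by
        rw [norm_smul, Real.norm_eq_abs]
        have k1 := (P.le_opNorm (B (Q x) (Q (x - y)) + B (Q (x - y)) (Q y))).trans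
          (mul_le_mul_of_nonneg_left ((norm_add_le _ _).trans (add_le_add h1 h2)) (norm_nonneg _))
        have k2 := D.le_opNorm (x - y)
        gcongr
    _ = _ := by ring

/-- The energy estimate for the localized vector field, uniform in the localization. -/
lemma galerkinField_energy {a b s κ : ℝ} {ψ : ℝ → ℝ} (ha₀ : 0 ≤ a) (ha : a < 1) (hb : 1 - a < b)
    (hs : 7 / 2 - a < s) (hκ : 0 ≤ κ) (hψ : IsWeight s ψ) {B : VL2 →L[ℝ] VL2 →L[ℝ] VL2}
    (hB : IsBilin a s B) {R : ℝ} (hR : 0 ≤ R) :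
    ∃ M : ℝ, 0 ≤ M ∧ ∀ (n : ℝ) (G : VL2), G ∈ solenoidal → ‖G‖ ≤ R →
      (inner ℂ G (galerkinField b s κ ψ B n G) : ℂ).re ≤ M * ‖G‖ ^ 2 := by
  have hs0 : 0 ≤ s := by linarith
  set C₁ : ℝ := (2 * (2 ^ (s + 1) + (s + 1) + 1) + 1) * (sobConst 1 s + sobConst (2 - a) s)
    with hC₁
  have hC₁0 : 0 ≤ C₁ := by
    have := sobConst_nonneg 1 s
    have := sobConst_nonneg (2 - a) s
    positivity
  set Q : ℝ := κ * (C₁ * (2 ^ s * R)) with hQ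
  have hQ0 : 0 ≤ Q := by positivity
  obtain ⟨M₀, hM₀, hM⟩ := rpow_le_eps_mul_rpow_add (α := 1 - a) (b := b) (ε := 1 / (Q + 1))
    (by linarith) hb (by positivity)
  refine ⟨Q * (M₀ + 1), by positivity, fun n G hG hGR => ?_⟩
  have hrat := hψ.bddBy_ratio hs0 n
  have hVn := hψ.bddBy_cut_Vw n
  have hD := bddBy_cut_lam (b := b) (by linarith) n
  set g := bmul (fun ξ => cut n ξ * (bw s ξ / Vw ψ ξ)) G with hg
  have hgmem : g ∈ solenoidal := bmul_mem_solenoidal hrat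
    (fun ξ => by simp [cut_neg_arg, bw_neg_arg, Vw_neg_arg]) hG
  have hgn : ‖g‖ ≤ 2 ^ s * R := (norm_bmul_le hrat G).trans (by gcongr)
  have hcut : ∀ᵐ ξ, g ξ = cut n ξ • g ξ := by
    filter_upwards [bmul_ae hrat G] with ξ h
    rw [h, smul_smul, ← mul_assoc, cut_mul_self]
  have hfld : ∀ᵐ ξ, fld s g ξ = (cut n ξ / Vw ψ ξ) • G ξ := by
    filter_upwards [bmul_ae hrat G] with ξ h
    rw [fld, h, smul_smul]
    congr 1
    calc _ = (bw (-s) ξ * bw s ξ) * (cut n ξ / Vw ψ ξ) := by ring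
      _ = _ := by rw [bw_neg_mul, one_mul]
  -- Moving the self-adjoint outer multiplier onto G produces exactly the test field (1 + ψ²) f of
  -- the weighted energy estimate.
  have hW : bmul (fun ξ => cut n ξ * Vw ψ ξ) G =ᵐ[volume]
      fun ξ => (1 + ψ ‖ξ‖ ^ 2) • fld s g ξ := by
    filter_upwards [bmul_ae hVn G, hfld] with ξ h1 h2
    rw [h1, h2, smul_smul, ← Vw_sq]
    congr 1
    have := (Vw_pos ψ ξ).ne'
    field_simp
  have key := inner_bilin_weight_le ha₀ ha hs hψ hB hgmem hcut hW
  have hint : ∫ ξ, (‖ξ‖ ^ (1 - a) + 1) * ((1 + ψ ‖ξ‖ ^ 2) * ‖fld s g ξ‖ ^ 2) =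
      ∫ ξ, (cut n ξ * (‖ξ‖ ^ (1 - a) + 1)) * ‖G ξ‖ ^ 2 := by
    refine integral_congr_ae ?_
    filter_upwards [hfld] with ξ h
    have hV := (Vw_pos ψ ξ).ne'
    rw [h, norm_smul, Real.norm_of_nonneg (div_nonneg (cut_nonneg _ _) (Vw_pos _ _).le), ← Vw_sq]
    have := cut_mul_self n ξ
    field_simp
    rw [sq, this]
  have hI0 : 0 ≤ ∫ ξ, (cut n ξ * (‖ξ‖ ^ (1 - a) + 1)) * ‖G ξ‖ ^ 2 :=
    integral_nonneg fun ξ => by have := cut_nonneg n ξ; positivity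
  have e : (inner ℂ G (galerkinField b s κ ψ B n G) : ℂ).re =
      κ * (inner ℂ (bmul (fun ξ => cut n ξ * Vw ψ ξ) G) (B g g) : ℂ).re -
        ∫ ξ, (cut n ξ * lam b ξ) * ‖G ξ‖ ^ 2 := by
    rw [galerkinField, ← hg, inner_sub_right, Complex.sub_re, re_inner_bmul_self hD,
      inner_bmul_left hVn, re_inner_rsmul_right]
  rw [e]
  rw [hint] at key
  have h1 : κ * (inner ℂ (bmul (fun ξ => cut n ξ * Vw ψ ξ) G) (B g g) : ℂ).re ≤
      Q * ∫ ξ, (cut n ξ * (‖ξ‖ ^ (1 - a) + 1)) * ‖G ξ‖ ^ 2 := by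
    calc _ ≤ κ * ((C₁ * ‖g‖) * ∫ ξ, (cut n ξ * (‖ξ‖ ^ (1 - a) + 1)) * ‖G ξ‖ ^ 2) := by gcongr
      _ ≤ κ * ((C₁ * (2 ^ s * R)) * ∫ ξ, (cut n ξ * (‖ξ‖ ^ (1 - a) + 1)) * ‖G ξ‖ ^ 2) := by
          gcongr
      _ = _ := by rw [hQ]; ring
  have h2 := absorb_le (a := a) ha hb hQ0 hM₀ hM n G
  linarith

/-- The retracted equation is solved in the solenoidal subspace, and the energy estimate shows that
the retraction is never active up to T. The bound M depends on R but not on n, hence neither does T.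
The datum itself is not cut off: frequencies of G above n remain stationary. -/
theorem exists_galerkin {a b s κ : ℝ} {ψ : ℝ → ℝ} (ha₀ : 0 ≤ a) (ha : a < 1) (hb : 1 - a < b)
    (hs : 7 / 2 - a < s) (hκ : 0 ≤ κ) (hψ : IsWeight s ψ) {B : VL2 →L[ℝ] VL2 →L[ℝ] VL2}
    (hB : IsBilin a s B) {G₀ : VL2} (hG₀ : G₀ ∈ solenoidal) :
    ∃ T R : ℝ, 0 < T ∧ 0 < R ∧ ∀ n : ℝ, ∃ G : ℝ → VL2, G 0 = G₀ ∧ ∀ t ∈ Set.Icc 0 T,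
      G t ∈ solenoidal ∧ ‖G t‖ ≤ R ∧
      HasDerivWithinAt G (galerkinField b s κ ψ B n (G t)) (Set.Icc 0 T) t := by
  set R : ℝ := 2 * ‖G₀‖ + 1 with hR
  have hR0 : 0 < R := by positivity
  obtain ⟨M, hM0, hM⟩ := galerkinField_energy ha₀ ha hb hs hκ hψ hB hR0.le
  -- With this T one has 2MT ≤ 1, so ‖G‖² grows by a factor at most exp 1 ≤ 4 and ‖G‖ stays below R
  -- = 2‖G₀‖ + 1.
  have hT : 0 < 1 / (2 * M + 1) := by positivity
  refine ⟨1 / (2 * M + 1), R, hT, hR0, fun n => ?_⟩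
  set T := 1 / (2 * M + 1) with hTdef
  obtain ⟨K, hK0, hK⟩ := galerkinField_lipschitz (b := b) (s := s) (κ := κ) (ψ := ψ) B n hR0.le
  let Φ : solenoidal → solenoidal := fun x =>
    ⟨galerkinField b s κ ψ B n x, galerkinField_mem (by linarith) (by linarith) hψ hB n x.2⟩
  obtain ⟨G, hG0, hG⟩ := exists_ode_retr (Φ := Φ) hR0 hK0 (fun x y hx hy => hK x y hx hy)
    ⟨G₀, hG₀⟩ hT.le
  have hder : ∀ t ∈ Set.Icc 0 T, HasDerivWithinAt (fun τ => (G τ : VL2))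
      (galerkinField b s κ ψ B n (retr R (G t) : solenoidal)) (Set.Icc 0 T) t := fun t ht =>
    (solenoidal.subtypeL.hasFDerivAt.comp_hasDerivWithinAt t (hG t ht))
  have hbound : ∀ t ∈ Set.Icc 0 T, ‖(G t : VL2)‖ ≤ R := by
    have hen : ∀ t ∈ Set.Icc 0 T,
        2 * (inner ℂ (G t : VL2) (galerkinField b s κ ψ B n (retr R (G t) : solenoidal)) : ℂ).re ≤
          (2 * M) * ‖(G t : VL2)‖ ^ 2 + 0 := by
      intro t ht
      -- The energy inequality is available for the retracted state l • G only. It reads l ⟨G, X⟩ ≤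
      -- M l² ‖G‖² in real parts; dividing by l and using l ≤ 1 gives it for G.
      set l : ℝ := R / max R ‖G t‖ with hl
      have hm : 0 < max R ‖G t‖ := lt_max_of_lt_left hR0
      have hl0 : 0 < l := by positivity
      have hl1 : l ≤ 1 := (div_le_one hm).2 (le_max_left _ _)
      have e1 : ((retr R (G t) : solenoidal) : VL2) = l • (G t : VL2) := rfl
      have h1 := hM n (retr R (G t) : solenoidal) (retr R (G t)).2 (norm_retr_le hR0 (G t))
      set X := galerkinField b s κ ψ B n (retr R (G t) : solenoidal)
      rw [e1, re_inner_rsmul_left, norm_smul, Real.norm_of_nonneg hl0.le] at h1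
      have h2 : (inner ℂ (G t : VL2) X : ℂ).re ≤ M * ‖(G t : VL2)‖ ^ 2 := by
        refine le_of_mul_le_mul_left (h1.trans ?_) hl0
        have h3 : l ^ 2 ≤ l := by nlinarith
        calc _ = M * ‖(G t : VL2)‖ ^ 2 * l ^ 2 := by ring
          _ ≤ M * ‖(G t : VL2)‖ ^ 2 * l := by gcongr
          _ = _ := by ring
      linarith
    intro t ht
    have h1 := gronwall_Icc (fun t ht => hasDerivWithinAt_norm_sq (hder t ht)) hen t ht
    rw [gronwallBound_ε0, hG0] at h1
    have h2 : Real.exp (2 * M * t) ≤ 4 := by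
      have h3 : 2 * M * t ≤ 1 := by
        calc 2 * M * t ≤ 2 * M * T := by gcongr; exact ht.2
          _ ≤ 1 := by rw [hTdef, mul_one_div, div_le_one (by positivity)]; linarith
      calc _ ≤ Real.exp 1 := Real.exp_le_exp.2 h3
        _ ≤ 4 := by linarith [Real.exp_one_lt_d9]
    refine le_of_sq_le_sq ?_ hR0.le
    refine h1.trans ?_
    calc ‖G₀‖ ^ 2 * Real.exp (2 * M * t) ≤ ‖G₀‖ ^ 2 * 4 := by gcongr
      _ ≤ R ^ 2 := by rw [hR]; nlinarith [norm_nonneg G₀]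
  refine ⟨fun t => G t, congrArg Subtype.val hG0, fun t ht => ⟨(G t).2, hbound t ht, ?_⟩⟩
  have h1 := hder t ht
  rwa [retr_of_norm_le hR0 (x := G t) (hbound t ht)] at h1

/-! ### A weight adapted to the datum -/

/-- The ramp `min(1, |r| / R)`. -/
def ramp (R r : ℝ) : ℝ := min 1 (|r| / R)

lemma ramp_nonneg {R : ℝ} (hR : 0 < R) (r : ℝ) : 0 ≤ ramp R r := le_min zero_le_one (by positivity)
lemma ramp_le_one (R r : ℝ) : ramp R r ≤ 1 := min_le_left _ _
lemma ramp_eq_one {R r : ℝ} (hR : 0 < R) (h : R ≤ r) : ramp R r = 1 :=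
  min_eq_left ((one_le_div hR).2 (h.trans (le_abs_self r)))
lemma measurable_ramp (R : ℝ) : Measurable (ramp R) :=
  measurable_const.min (measurable_norm.div_const R)

lemma ramp_mono {R : ℝ} (hR : 0 < R) {r l : ℝ} (hl : 1 ≤ l) : ramp R r ≤ ramp R (l * r) := by
  refine min_le_min le_rfl ?_
  rw [abs_mul, abs_of_pos (show 0 < l by linarith)]
  gcongr
  exact le_mul_of_one_le_left (abs_nonneg r) hl

lemma ramp_mul_le {R r l : ℝ} (hl : 1 ≤ l) : ramp R (l * r) ≤ l * ramp R r := by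
  rw [ramp, ramp, abs_mul, abs_of_pos (show 0 < l by linarith), mul_min_of_nonneg _ _ (by linarith)]
  exact min_le_min (by linarith) (by rw [mul_div_assoc])

lemma tendsto_integral_ramp (g : VL2) :
    Filter.Tendsto (fun n : ℕ => ∫ ξ, ramp (n + 1) ‖ξ‖ * ‖g ξ‖ ^ 2) Filter.atTop (nhds 0) := by
  have hg : Integrable fun ξ => ‖g ξ‖ ^ 2 := (Lp.memLp g).integrable_norm_pow (by norm_num)
  have h := tendsto_integral_of_dominated_convergence (μ := (volume : Measure R3))
    (F := fun (n : ℕ) ξ => ramp (n + 1) ‖ξ‖ * ‖g ξ‖ ^ 2) (f := fun _ => (0 : ℝ))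
    (fun ξ => ‖g ξ‖ ^ 2)
    (fun n => (((measurable_ramp _).comp measurable_norm).aestronglyMeasurable).mul
      hg.aestronglyMeasurable) hg
    (fun n => Filter.Eventually.of_forall fun ξ => by
      rw [Real.norm_of_nonneg (mul_nonneg (ramp_nonneg (by positivity) _) (by positivity))]
      exact mul_le_of_le_one_left (by positivity) (ramp_le_one _ _))
    (Filter.Eventually.of_forall fun ξ => by
      rw [show (0 : ℝ) = 0 * ‖g ξ‖ ^ 2 by ring]
      refine Filter.Tendsto.mul_const _ ?_
      refine squeeze_zero (fun n => ramp_nonneg (by positivity) _) (fun n => min_le_right _ _) ?_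
      have : Filter.Tendsto (fun n : ℕ => (n : ℝ) + 1) Filter.atTop Filter.atTop :=
        Filter.tendsto_atTop_add_const_right _ _ tendsto_natCast_atTop_atTop
      exact this.const_div_atTop _)
  simpa using h

/-- Every `L²` function is still square integrable with respect to a slowly growing weight. -/
lemma exists_slow_weight (g : VL2) :
    ∃ m : ℝ → ℝ, Measurable m ∧ (∀ r, 1 ≤ m r) ∧ (∀ r l, 1 ≤ l → m r ≤ m (l * r)) ∧
      (∀ r l, 1 ≤ l → m (l * r) ≤ l * m r) ∧ (∀ K : ℕ, ∃ N : ℝ, ∀ r, N ≤ r → (K : ℝ) ≤ m r) ∧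
      Integrable (fun ξ => m ‖ξ‖ * ‖g ξ‖ ^ 2) := by
  have hg : Integrable fun ξ => ‖g ξ‖ ^ 2 := (Lp.memLp g).integrable_norm_pow (by norm_num)
  -- The smallness of the integrals makes the sum of ramps integrable against |g|²; the growth of R
  -- makes that sum finite at every point.
  have hex : ∀ k : ℕ, ∃ R : ℝ, 2 ^ k ≤ R ∧ ∫ ξ, ramp R ‖ξ‖ * ‖g ξ‖ ^ 2 ≤ (1 / 2) ^ k := fun k => by
    have h1 := (tendsto_integral_ramp g).eventually (eventually_le_nhds
      (show (0 : ℝ) < (1 / 2) ^ k by positivity))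
    obtain ⟨n, hn, hn'⟩ := (h1.and (Filter.eventually_ge_atTop (2 ^ k))).exists
    refine ⟨n + 1, ?_, hn⟩
    have : ((2 ^ k : ℕ) : ℝ) ≤ n := by exact_mod_cast hn'
    push_cast at this
    linarith
  choose R hR hRint using hex
  have hR0 : ∀ k, 0 < R k := fun k => lt_of_lt_of_le (by positivity) (hR k)
  have hsum : ∀ r, Summable fun k => ramp (R k) r := fun r => by
    refine Summable.of_nonneg_of_le (fun k => ramp_nonneg (hR0 k) r) (fun k => ?_)
      (summable_geometric_two.mul_left |r|)
    refine (min_le_right _ _).trans ?_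
    rw [one_div, inv_pow, ← div_eq_mul_inv]
    exact div_le_div_of_nonneg_left (abs_nonneg r) (by positivity) (hR k)
  refine ⟨fun r => 1 + ∑' k, ramp (R k) r, ?_, fun r => ?_, fun r l hl => ?_, fun r l hl => ?_,
    fun K => ?_, ?_⟩
  · exact (Measurable.tsum (fun k => measurable_ramp (R k))).const_add 1
  · have := tsum_nonneg (L := .unconditional ℕ) fun k => ramp_nonneg (hR0 k) r
    linarith
  · have := (hsum r).tsum_le_tsum (fun k => ramp_mono (hR0 k) (r := r) hl) (hsum (l * r))
    linarith
  · have := (hsum (l * r)).tsum_le_tsum (fun k => ramp_mul_le (R := R k) (r := r) hl)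
      ((hsum r).mul_left l)
    rw [tsum_mul_left] at this
    linarith
  -- Beyond the sum of the first K radii, each of the first K ramps equals 1, so the weight is at
  -- least K.
  · refine ⟨∑ k ∈ Finset.range K, R k, fun r hr => ?_⟩
    have h1 : ∑ k ∈ Finset.range K, ramp (R k) r = K := by
      rw [Finset.sum_congr rfl fun k hk => ramp_eq_one (hR0 k)
        ((Finset.single_le_sum (fun i _ => (hR0 i).le) hk).trans hr)]
      simp
    have h2 := (hsum r).sum_le_tsum (Finset.range K) fun k _ => ramp_nonneg (hR0 k) r
    linarith
  · have hi : ∀ k, Integrable fun ξ => ramp (R k) ‖ξ‖ * ‖g ξ‖ ^ 2 := fun k =>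
      hg.bdd_mul (c := 1) ((measurable_ramp _).comp measurable_norm).aestronglyMeasurable
        (Filter.Eventually.of_forall fun ξ => by
          rw [Real.norm_of_nonneg (ramp_nonneg (hR0 k) _)]
          exact ramp_le_one _ _)
    have hS : Integrable fun ξ => ∑' k, ramp (R k) ‖ξ‖ * ‖g ξ‖ ^ 2 := by
      refine ⟨?_, ?_⟩
      · simp_rw [tsum_mul_right]
        exact ((Measurable.tsum (fun k => measurable_ramp (R k))).comp
          measurable_norm).aestronglyMeasurable.mul hg.aestronglyMeasurable
      · have h0 : ∀ k ξ, 0 ≤ ramp (R k) ‖ξ‖ * ‖g ξ‖ ^ 2 := fun k ξ =>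
          mul_nonneg (ramp_nonneg (hR0 k) _) (by positivity)
        rw [hasFiniteIntegral_iff_ofReal (Filter.Eventually.of_forall fun ξ =>
          tsum_nonneg fun k => h0 k ξ)]
        simp_rw [fun ξ => ENNReal.ofReal_tsum_of_nonneg (fun k => h0 k ξ)
          ((hsum ‖ξ‖).mul_right (‖g ξ‖ ^ 2))]
        rw [lintegral_tsum fun k => (hi k).aestronglyMeasurable.aemeasurable.ennreal_ofReal]
        calc _ ≤ ∑' k : ℕ, ENNReal.ofReal ((1 / 2) ^ k) := by
              refine ENNReal.tsum_le_tsum fun k => ?_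
              rw [← ofReal_integral_eq_lintegral_ofReal (hi k)
                (Filter.Eventually.of_forall fun ξ => h0 k ξ)]
              exact ENNReal.ofReal_le_ofReal (hRint k)
          _ = ENNReal.ofReal (∑' k : ℕ, (1 / 2) ^ k) :=
              (ENNReal.ofReal_tsum_of_nonneg (fun k => by positivity) summable_geometric_two).symm
          _ < ⊤ := ENNReal.ofReal_lt_top
    refine (hg.add hS).congr (Filter.Eventually.of_forall fun ξ => ?_)
    simp only [Pi.add_apply, tsum_mul_right]
    ring

/-- For each datum in `H^s` there is an admissible weight, strictly stronger than that of `H^s`,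
for which the datum still has finite energy. -/
lemma exists_isWeight {s : ℝ} (hs : 1 ≤ s) (g : VL2) :
    ∃ ψ : ℝ → ℝ, IsWeight s ψ ∧
      (∀ ε : ℝ, 0 < ε → ∃ N : ℝ, ∀ ξ : R3, N < ‖ξ‖ → bw s ξ ≤ ε * Vw ψ ξ) ∧
      MemLp (fun ξ => (Vw ψ ξ / bw s ξ) • g ξ) 2 := by
  obtain ⟨m, hm, h1, hmono, hmul, hlim, hint⟩ := exists_slow_weight g
  have hm0 : ∀ r, 0 ≤ m r := fun r => zero_le_one.trans (h1 r)
  -- The square root appears because energies are quadratic: ψ² contains m itself, which is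
  -- integrable against |g|².
  have hw : IsWeight s fun r => |r| ^ s * √(m r) := by
    refine ⟨(measurable_norm.pow_const s).mul hm.sqrt, fun r => by positivity, fun r l hr hl => ?_,
      fun r l hr hl => ?_, fun r hr => ?_⟩
    · have hl0 : 0 < l := by linarith
      have : √(m (l * r)) ≤ l * √(m r) := by
        rw [Real.sqrt_le_left (by positivity), mul_pow, Real.sq_sqrt (hm0 r)]
        refine (hmul r l hl).trans ?_
        have := hm0 r
        gcongr
        nlinarith
      rw [abs_mul, abs_of_pos hl0, Real.mul_rpow hl0.le (abs_nonneg r), Real.rpow_add_one hl0.ne']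
      calc _ ≤ l ^ s * |r| ^ s * (l * √(m r)) := by gcongr
        _ = _ := by ring
    · have hl0 : 0 < l := by linarith
      have h2 : √(m r) ≤ √(m (l * r)) := Real.sqrt_le_sqrt (hmono r l hl)
      have h3 : l ≤ l ^ s := Real.self_le_rpow_of_one_le hl hs
      rw [abs_mul, abs_of_pos hl0, Real.mul_rpow hl0.le (abs_nonneg r), ← mul_assoc]
      gcongr
    · rw [abs_of_nonneg hr]
      exact le_mul_of_one_le_right (by positivity) (Real.one_le_sqrt.2 (h1 r))
  refine ⟨fun r => |r| ^ s * √(m r), hw, fun ε hε => ?_, ?_⟩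
  · obtain ⟨K, hK⟩ := exists_nat_ge ((2 ^ s / ε) ^ 2)
    obtain ⟨N, hN⟩ := hlim K
    refine ⟨max N 1, fun ξ hξ => ?_⟩
    have hξ1 : 1 ≤ ‖ξ‖ := ((le_max_right _ _).trans hξ.le)
    have h2 : 2 ^ s / ε ≤ √(m ‖ξ‖) := by
      refine Real.le_sqrt_of_sq_le (hK.trans (hN _ ((le_max_left _ _).trans hξ.le)))
    have h3 : bw s ξ ≤ 2 ^ s * ‖ξ‖ ^ s := by
      unfold bw
      calc (1 + ‖ξ‖ ^ 2) ^ (s / 2) ≤ ((2 * ‖ξ‖) ^ (2 : ℝ)) ^ (s / 2) := by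
            refine Real.rpow_le_rpow (by positivity) ?_ (by linarith)
            rw [Real.rpow_two]; nlinarith
        _ = (2 * ‖ξ‖) ^ s := by rw [← Real.rpow_mul (by positivity)]; ring_nf
        _ = _ := Real.mul_rpow (by norm_num) (norm_nonneg _)
    have h4 : ‖ξ‖ ^ s * √(m ‖ξ‖) ≤ Vw (fun r => |r| ^ s * √(m r)) ξ := by
      refine Real.le_sqrt_of_sq_le ?_
      simp only [abs_norm]
      linarith
    rw [div_le_iff₀ hε] at h2
    calc _ ≤ 2 ^ s * ‖ξ‖ ^ s := h3
      _ ≤ √(m ‖ξ‖) * ε * ‖ξ‖ ^ s := by gcongr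
      _ = ε * (‖ξ‖ ^ s * √(m ‖ξ‖)) := by ring
      _ ≤ _ := by gcongr
  · set ψ : ℝ → ℝ := fun r => |r| ^ s * √(m r) with hψ
    have hg : Integrable fun ξ => ‖g ξ‖ ^ 2 := (Lp.memLp g).integrable_norm_pow (by norm_num)
    have hsm : AEStronglyMeasurable (fun ξ => (Vw ψ ξ / bw s ξ) • g ξ) volume :=
      (hw.measurable_Vw.div (measurable_bw s)).aestronglyMeasurable.smul
        (Lp.aestronglyMeasurable g)
    rw [memLp_two_iff_integrable_sq_norm hsm]
    refine Integrable.mono' (hg.add hint) (hsm.norm.pow 2) (Filter.Eventually.of_forall fun ξ => ?_)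
    have hbw : ‖ξ‖ ^ s ≤ bw s ξ := norm_rpow_le_bw (by linarith) ξ
    have hb1 : 1 ≤ bw s ξ := one_le_bw (by linarith) ξ
    have hb0 := bw_pos s ξ
    rw [Real.norm_of_nonneg (by positivity), norm_smul, mul_pow,
      Real.norm_of_nonneg (div_nonneg (Vw_pos _ _).le hb0.le), div_pow, Vw_sq, Pi.add_apply,
      ← one_add_mul]
    gcongr
    rw [div_le_iff₀ (by positivity), hψ]
    simp only [abs_norm]
    rw [mul_pow, Real.sq_sqrt (hm0 _), add_mul]
    have e1 : (‖ξ‖ ^ s) ^ 2 ≤ bw s ξ ^ 2 := by gcongr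
    have e2 : 1 ≤ bw s ξ ^ 2 := one_le_pow₀ hb1
    have := mul_le_mul_of_nonneg_right e1 (hm0 ‖ξ‖)
    linarith

/-! ### Low-frequency equations and L² stability -/

/-- The evolution equation on the frequencies `‖ξ‖ ≤ n`; the unknown is weighted by `bw s`. -/
def TruncEq (b s κ : ℝ) (B : VL2 →L[ℝ] VL2 →L[ℝ] VL2) (n T : ℝ) (g : ℝ → VL2) : Prop :=
  ∀ t ∈ Set.Icc 0 T, HasDerivWithinAt (fun τ => bmul (fun ξ => cut n ξ * bw (-s) ξ) (g τ))
    (κ • bmul (cut n) (B (g t) (g t)) - bmul (fun ξ => cut n ξ * (lam b ξ * bw (-s) ξ)) (g t))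
    (Set.Icc 0 T) t

lemma bddBy_cut_bw {s : ℝ} (hs : 0 ≤ s) (n : ℝ) : BddBy (fun ξ => cut n ξ * bw (-s) ξ) 1 := by
  simpa using (bddBy_cut n).mul (bddBy_bw (s := -s) (by linarith))

lemma bddBy_cut_lam_bw {b s : ℝ} (hb : 0 ≤ b) (hs : 0 ≤ s) (n : ℝ) :
    BddBy (fun ξ => cut n ξ * (lam b ξ * bw (-s) ξ)) ((2 * Real.pi * |n|) ^ b) := by
  simpa [mul_assoc] using (bddBy_cut_lam hb n).mul (bddBy_bw (s := -s) (by linarith))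

/-- On frequencies up to m ≤ n the cut-off at n is invisible, apart from its action inside the
nonlinearity, which still sees the full unknown. Approximations of different levels thus satisfy one
common equation and can be compared. -/
lemma truncEq_of_galerkin {b s κ : ℝ} {ψ : ℝ → ℝ} (hs : 0 ≤ s) (hb : 0 ≤ b) (hψ : IsWeight s ψ)
    {B : VL2 →L[ℝ] VL2 →L[ℝ] VL2} {m n T : ℝ} (hmn : m ≤ n) {G : ℝ → VL2}
    (hG : ∀ t ∈ Set.Icc 0 T,
      HasDerivWithinAt G (galerkinField b s κ ψ B n (G t)) (Set.Icc 0 T) t) :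
    TruncEq b s κ B m T fun t => bmul (fun ξ => cut n ξ * (bw s ξ / Vw ψ ξ)) (G t) := by
  intro t ht
  have hQ := hψ.bddBy_ratio hs n
  have hm : BddBy (fun ξ => cut m ξ * (1 / Vw ψ ξ)) 1 := by
    refine bddBy_cut_mul (m := fun ξ => 1 / Vw ψ ξ) (hψ.measurable_Vw.const_div 1) zero_le_one
      fun ξ _ => ?_
    rw [abs_of_nonneg (by have := Vw_pos ψ ξ; positivity), div_le_one (Vw_pos ψ ξ)]
    exact one_le_Vw ψ ξ
  have e1 : ∀ X : VL2, bmul (fun ξ => cut m ξ * bw (-s) ξ)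
      (bmul (fun ξ => cut n ξ * (bw s ξ / Vw ψ ξ)) X) = bmul (fun ξ => cut m ξ * (1 / Vw ψ ξ)) X :=
    fun X => by
      rw [bmul_bmul (bddBy_cut_bw hs m) hQ]
      congr 2
      ext1 ξ
      calc _ = (cut m ξ * cut n ξ) * (bw (-s) ξ * bw s ξ) * (1 / Vw ψ ξ) := by ring
        _ = _ := by rw [cut_mul_cut hmn, bw_neg_mul]; ring
  simp only [e1]
  have h1 := ((bmul fun ξ => cut m ξ * (1 / Vw ψ ξ)).hasFDerivAt.comp_hasDerivWithinAt t (hG t ht))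
  refine h1.congr_deriv ?_
  rw [galerkinField, map_sub, map_smul, bmul_bmul hm (hψ.bddBy_cut_Vw n),
    bmul_bmul hm (bddBy_cut_lam hb n), bmul_bmul (bddBy_cut_lam_bw hb hs m) hQ]
  congr 3
  · congr 1
    ext1 ξ
    have := (Vw_pos ψ ξ).ne'
    calc _ = (cut m ξ * cut n ξ) * (1 / Vw ψ ξ * Vw ψ ξ) := by ring
      _ = _ := by rw [cut_mul_cut hmn, one_div_mul_cancel this, mul_one]
  · ext1 ξ
    calc _ = (cut m ξ * cut n ξ) * 1 * (lam b ξ / Vw ψ ξ) := by ring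
      _ = (cut m ξ * cut n ξ) * (bw (-s) ξ * bw s ξ) * (lam b ξ / Vw ψ ξ) := by rw [bw_neg_mul]
      _ = _ := by ring

lemma fld_bmul_bw {s s' : ℝ} (h : s' ≤ s) (g : VL2) :
    fld s' (bmul (bw (s' - s)) g) =ᵐ[volume] fld s g := by
  filter_upwards [bmul_ae (bddBy_bw (s := s' - s) (by linarith)) g] with ξ h1
  rw [fld, h1, smul_smul, ← bw_add, fld]
  congr 2
  ring

/-- The same nonlinearity read at a lower order: the unknowns acquire the decaying factor `bw (s' -
s)`, which is what makes tails small. -/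
lemma IsBilin.eq_lower {a s s' : ℝ} (h : s' ≤ s) {B B' : VL2 →L[ℝ] VL2 →L[ℝ] VL2}
    (hB : IsBilin a s B) (hB' : IsBilin a s' B') (g u : VL2) :
    B g u = B' (bmul (bw (s' - s)) g) (bmul (bw (s' - s)) u) := by
  refine Lp.ext ((hB g u).trans (Filter.EventuallyEq.trans ?_ (hB' _ _).symm))
  rw [Nl_congr (fld_bmul_bw h g) (fld_bmul_bw h u)]

lemma norm_bmul_bw_sub_cut_le {σ n : ℝ} (hσ : 0 ≤ σ) (hn : 1 ≤ n) (h : VL2) :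
    ‖bmul (bw (-σ)) (h - bmul (cut n) h)‖ ≤ n ^ (-σ) * ‖h‖ := by
  refine Lp.norm_le_mul_norm_of_ae_le_mul ?_
  filter_upwards [bmul_ae (bddBy_bw (s := -σ) (by linarith)) (h - bmul (cut n) h),
    Lp.coeFn_sub h (bmul (cut n) h), bmul_ae (bddBy_cut n) h] with ξ h1 h2 h3
  rw [h1, h2, Pi.sub_apply, h3, norm_smul, Real.norm_of_nonneg (bw_nonneg _ _)]
  unfold cut
  split_ifs with h4
  · simp only [one_smul, sub_self, norm_zero, mul_zero]
    positivity
  · rw [zero_smul, sub_zero]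
    gcongr
    push Not at h4
    unfold bw
    calc (1 + ‖ξ‖ ^ 2) ^ (-σ / 2) ≤ (n ^ (2 : ℝ)) ^ (-σ / 2) := by
          refine Real.rpow_le_rpow_of_nonpos (by positivity) ?_ (by linarith)
          rw [Real.rpow_two]; nlinarith
      _ = _ := by rw [← Real.rpow_mul (by positivity)]; ring_nf

lemma IsBilin.exists_tail_le {a s : ℝ} (ha : a < 1) (hs : 7 / 2 - a < s)
    {B : VL2 →L[ℝ] VL2 →L[ℝ] VL2} (hB : IsBilin a s B) :
    ∃ C σ : ℝ, 0 ≤ C ∧ 0 < σ ∧ ∀ n : ℝ, 1 ≤ n → ∀ g h : VL2,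
      ‖B (h - bmul (cut n) h) g‖ ≤ C * n ^ (-σ) * ‖h‖ * ‖g‖ ∧
      ‖B g (h - bmul (cut n) h)‖ ≤ C * n ^ (-σ) * ‖h‖ * ‖g‖ := by
  -- Half of the available gap: s - σ is still above 7/2 - a, and a factor supported above n costs
  -- n^(-σ).
  set σ : ℝ := (s - (7 / 2 - a)) / 2 with hσ
  have hσ0 : 0 < σ := by rw [hσ]; linarith
  obtain ⟨B', hB'⟩ := exists_isBilin (a := a) (s := s - σ) ha (by rw [hσ]; linarith)
  have e : s - σ - s = -σ := by ring
  have hg : ∀ g : VL2, ‖bmul (bw (-σ)) g‖ ≤ ‖g‖ := fun g => by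
    simpa using norm_bmul_le (bddBy_bw (s := -σ) (by linarith)) g
  refine ⟨‖B'‖, σ, norm_nonneg B', hσ0, fun n hn g h => ⟨?_, ?_⟩⟩
  · rw [hB.eq_lower (by linarith) hB', e]
    calc _ ≤ ‖B'‖ * _ * _ := B'.le_opNorm₂ _ _
      _ ≤ ‖B'‖ * (n ^ (-σ) * ‖h‖) * ‖g‖ := by
          gcongr
          · exact norm_bmul_bw_sub_cut_le hσ0.le hn h
          · exact hg g
      _ = _ := by ring
  · rw [hB.eq_lower (by linarith) hB', e]
    calc _ ≤ ‖B'‖ * _ * _ := B'.le_opNorm₂ _ _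
      _ ≤ ‖B'‖ * ‖g‖ * (n ^ (-σ) * ‖h‖) := by
          gcongr
          · exact hg g
          · exact norm_bmul_bw_sub_cut_le hσ0.le hn h
      _ = _ := by ring

lemma re_inner_le (x y : VL2) : (inner ℂ x y : ℂ).re ≤ ‖x‖ * ‖y‖ :=
  re_inner_le_norm (𝕜 := ℂ) x y

/-- The energy estimate for the difference of two solutions, localized to `‖ξ‖ ≤ n`. -/
lemma diff_energy_le {a b s κ K M₀ C σ n : ℝ} (ha₀ : 0 ≤ a) (ha : a < 1) (hb : 1 - a < b)
    (hs : 7 / 2 - a < s) (hκ : 0 ≤ κ) (hK : 0 ≤ K) {B : VL2 →L[ℝ] VL2 →L[ℝ] VL2}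
    (hB : IsBilin a s B) (hM₀ : 0 ≤ M₀)
    (hM : ∀ x : ℝ, 0 ≤ x →
      x ^ (1 - a) ≤ 1 / (κ * (sobConst 1 s * K) + 1) * x ^ b + M₀)
    (hC : 0 ≤ C) (hn : 0 < n) (htail : ∀ g h : VL2,
      ‖B (h - bmul (cut n) h) g‖ ≤ C * n ^ (-σ) * ‖h‖ * ‖g‖ ∧
      ‖B g (h - bmul (cut n) h)‖ ≤ C * n ^ (-σ) * ‖h‖ * ‖g‖)
    {g₁ g₂ : VL2} (h₁ : g₁ ∈ solenoidal) (h₂ : g₂ ∈ solenoidal) (hk₁ : ‖g₁‖ ≤ K)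
    (hk₂ : ‖g₂‖ ≤ K) :
    (inner ℂ (bmul (fun ξ => cut n ξ * bw (-s) ξ) (g₁ - g₂))
      ((κ • bmul (cut n) (B g₁ g₁) - bmul (fun ξ => cut n ξ * (lam b ξ * bw (-s) ξ)) g₁) -
        (κ • bmul (cut n) (B g₂ g₂) - bmul (fun ξ => cut n ξ * (lam b ξ * bw (-s) ξ)) g₂)) : ℂ).re
      ≤ (κ * (sobConst 1 s * K) * (M₀ + 1) + κ * (sobConst (2 - a) s * K)) *
          ‖bmul (fun ξ => cut n ξ * bw (-s) ξ) (g₁ - g₂)‖ ^ 2 +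
        κ * (8 * C * K ^ 3) * n ^ (-σ) := by
  have hs0 : 0 ≤ s := by linarith
  have hb0 : 0 ≤ b := by linarith
  have hW := bddBy_cut_bw hs0 n
  have hbw := bddBy_bw (s := -s) (by linarith)
  set h := g₁ - g₂ with hh
  have hhs : h ∈ solenoidal := solenoidal.sub_mem h₁ h₂
  have hhK : ‖h‖ ≤ 2 * K := (norm_sub_le _ _).trans (by linarith)
  set w := bmul (fun ξ => cut n ξ * bw (-s) ξ) h with hw
  set hN := bmul (cut n) h with hhN
  have hNs : hN ∈ solenoidal := bmul_mem_solenoidal (bddBy_cut n) (cut_neg_arg n) hhs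
  have hwK : ‖w‖ ≤ 2 * K := (norm_bmul_le hW h).trans (by linarith)
  have ew : bmul (bw (-s)) hN = w := by
    rw [hhN, bmul_bmul hbw (bddBy_cut n), hw]
    congr 2; ext1 ξ; ring
  have ecw : bmul (cut n) w = w := by
    rw [hw, bmul_bmul (bddBy_cut n) hW]
    congr 2; ext1 ξ; rw [← mul_assoc, cut_mul_self]
  have elam : bmul (fun ξ => cut n ξ * (lam b ξ * bw (-s) ξ)) h =
      bmul (fun ξ => cut n ξ * lam b ξ) w := by
    rw [hw, bmul_bmul (bddBy_cut_lam hb0 n) hW]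
    congr 2; ext1 ξ
    calc _ = cut n ξ * lam b ξ * bw (-s) ξ := by ring
      _ = (cut n ξ * cut n ξ) * lam b ξ * bw (-s) ξ := by rw [cut_mul_self]
      _ = _ := by ring
  -- Polarization of the quadratic difference followed by a split of h at frequency n. In the
  -- pairing with w, `B hN g₁` is skew up to order 1-a, `B g₂ hN` is a transport term, and the other
  -- two are tails.
  set X := B hN g₁ + B g₂ hN + (B (h - hN) g₁ + B g₂ (h - hN)) with hX
  have eX : B g₁ g₁ - B g₂ g₂ = X := by
    simp only [hX, hh, map_sub, sub_apply]
    abel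
  have eD : (κ • bmul (cut n) (B g₁ g₁) - bmul (fun ξ => cut n ξ * (lam b ξ * bw (-s) ξ)) g₁) -
        (κ • bmul (cut n) (B g₂ g₂) - bmul (fun ξ => cut n ξ * (lam b ξ * bw (-s) ξ)) g₂) =
      κ • bmul (cut n) X - bmul (fun ξ => cut n ξ * lam b ξ) w := by
    rw [← eX, ← elam, hh, map_sub, map_sub, smul_sub]
    abel
  rw [eD, inner_sub_right, Complex.sub_re, re_inner_rsmul_right, ← inner_bmul_left (bddBy_cut n),
    ecw, re_inner_bmul_self (bddBy_cut_lam hb0 n), hX, inner_add_right, inner_add_right,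
    Complex.add_re, Complex.add_re]
  have hwfld : ∀ᵐ ξ, fld s hN ξ = w ξ := by
    rw [← ew]
    exact (bmul_ae hbw hN).symm
  have hwcut : ∀ᵐ ξ, w ξ = cut n ξ • w ξ := by
    have := bmul_ae (bddBy_cut n) w
    rwa [ecw] at this
  set I := ∫ ξ, (cut n ξ * (‖ξ‖ ^ (1 - a) + 1)) * ‖w ξ‖ ^ 2 with hI
  have k1 : (inner ℂ w (B hN g₁) : ℂ).re ≤ I * (sobConst 1 s * K) := by
    have h3 := inner_bilin_skew_le ha₀ ha hs hB (h := hN) h₁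
    rw [ew] at h3
    refine h3.trans ?_
    have h4 : ∫ ξ, (‖ξ‖ ^ ((1 - a) / 2) * ‖fld s hN ξ‖) ^ 2 ≤ I := by
      refine integral_mono_of_nonneg (Filter.Eventually.of_forall fun ξ => by positivity)
        ((bddBy_cut_rpow_add_one (α := 1 - a) (by linarith) n).integrable_mul_sq w) ?_
      filter_upwards [hwfld, hwcut] with ξ h5 h6
      rw [h5, mul_pow, ← Real.rpow_natCast, ← Real.rpow_mul (norm_nonneg _)]
      have h7 : ‖w ξ‖ ^ 2 = cut n ξ * ‖w ξ‖ ^ 2 := by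
        nth_rewrite 1 [h6]
        rw [norm_smul, mul_pow, Real.norm_of_nonneg (cut_nonneg _ _), sq, cut_mul_self]
      have h8 : (1 - a) / 2 * ((2 : ℕ) : ℝ) = 1 - a := by push_cast; ring
      rw [h8]
      calc _ = ‖ξ‖ ^ (1 - a) * (cut n ξ * ‖w ξ‖ ^ 2) := by rw [← h7]
        _ ≤ (‖ξ‖ ^ (1 - a) + 1) * (cut n ξ * ‖w ξ‖ ^ 2) := by
            rw [← h7]
            gcongr
            linarith
        _ = _ := by ring
    have h5 : 0 ≤ ∫ ξ, (‖ξ‖ ^ ((1 - a) / 2) * ‖fld s hN ξ‖) ^ 2 :=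
      integral_nonneg fun ξ => by positivity
    have h6 := sobConst_nonneg 1 s
    have h7 : 0 ≤ I := h5.trans h4
    gcongr
  have k2 : (inner ℂ w (B g₂ hN) : ℂ).re ≤ ‖w‖ ^ 2 * (sobConst (2 - a) s * K) := by
    have h3 := inner_bilin_transport_le ha hs hB (h := hN) h₂ hNs
    rw [ew] at h3
    have h4 : ∫ ξ, ‖fld s hN ξ‖ ^ 2 = ‖w‖ ^ 2 := by
      rw [norm_sq_VL2]
      refine integral_congr_ae ?_
      filter_upwards [hwfld] with ξ h5
      rw [h5]
    rw [h4] at h3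
    have h6 := sobConst_nonneg (2 - a) s
    exact h3.trans (by gcongr)
  have k3 : ∀ Y : VL2, ‖Y‖ ≤ C * n ^ (-σ) * (2 * K) * K →
      (inner ℂ w Y : ℂ).re ≤ 4 * C * K ^ 3 * n ^ (-σ) := fun Y hY => by
    refine (re_inner_le w Y).trans ?_
    calc _ ≤ (2 * K) * (C * n ^ (-σ) * (2 * K) * K) := by gcongr
      _ = _ := by ring
  have k4 := k3 (B (h - hN) g₁) ((htail g₁ h).1.trans (by gcongr))
  have k5 := k3 (B g₂ (h - hN)) ((htail g₂ h).2.trans (by gcongr))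
  have k6 := absorb_le (a := a) ha hb (Q := κ * (sobConst 1 s * K))
    (by have := sobConst_nonneg 1 s; positivity) hM₀ hM n w
  rw [← hI] at k6
  rw [inner_add_right, Complex.add_re]
  have k7 : κ * ((inner ℂ w (B hN g₁) : ℂ).re + (inner ℂ w (B g₂ hN) : ℂ).re +
      ((inner ℂ w (B (h - hN) g₁) : ℂ).re + (inner ℂ w (B g₂ (h - hN)) : ℂ).re)) ≤
      κ * (I * (sobConst 1 s * K) + ‖w‖ ^ 2 * (sobConst (2 - a) s * K) +
        (4 * C * K ^ 3 * n ^ (-σ) + 4 * C * K ^ 3 * n ^ (-σ))) := by gcongr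
  linarith

/-- Gronwall's inequality for the L² norm of the low-frequency difference. The equation is required
only up to frequency n; the error δ comes from the tails and depends on the curves through K alone,
so the estimate serves both convergence and uniqueness. -/
theorem exists_truncEq_stability {a b s κ K : ℝ} (ha₀ : 0 ≤ a) (ha : a < 1) (hb : 1 - a < b)
    (hs : 7 / 2 - a < s) (hκ : 0 ≤ κ) (hK : 0 ≤ K) {B : VL2 →L[ℝ] VL2 →L[ℝ] VL2}
    (hB : IsBilin a s B) :
    ∃ C : ℝ, ∃ δ : ℝ → ℝ, 0 ≤ C ∧ Filter.Tendsto δ Filter.atTop (nhds 0) ∧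
      ∀ (n T : ℝ) (g₁ g₂ : ℝ → VL2), 1 ≤ n → TruncEq b s κ B n T g₁ → TruncEq b s κ B n T g₂ →
        (∀ t ∈ Set.Icc 0 T, g₁ t ∈ solenoidal ∧ g₂ t ∈ solenoidal ∧ ‖g₁ t‖ ≤ K ∧ ‖g₂ t‖ ≤ K) →
        ∀ t ∈ Set.Icc 0 T, ‖bmul (fun ξ => cut n ξ * bw (-s) ξ) (g₁ t - g₂ t)‖ ^ 2 ≤
          (‖bmul (fun ξ => cut n ξ * bw (-s) ξ) (g₁ 0 - g₂ 0)‖ ^ 2 + δ n) * Real.exp (C * t) := by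
  have hS1 := sobConst_nonneg 1 s
  have hS2 := sobConst_nonneg (2 - a) s
  obtain ⟨C₀, σ, hC₀, hσ, htail⟩ := hB.exists_tail_le ha hs
  obtain ⟨M₀, hM₀, hM⟩ := rpow_le_eps_mul_rpow_add (α := 1 - a) (b := b)
    (ε := 1 / (κ * (sobConst 1 s * K) + 1)) (by linarith) hb (by positivity)
  -- The extra 1 ensures C ≥ 1, so that the quotient ε / C in Gronwall's bound is at most ε.
  set C : ℝ := 2 * (κ * (sobConst 1 s * K) * (M₀ + 1) + κ * (sobConst (2 - a) s * K)) + 1 with hC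
  have hC1 : 1 ≤ C := by rw [hC]; linarith [show 0 ≤ 2 * (κ * (sobConst 1 s * K) * (M₀ + 1) +
    κ * (sobConst (2 - a) s * K)) by positivity]
  refine ⟨C, fun n => 2 * (κ * (8 * C₀ * K ^ 3)) * n ^ (-σ), by linarith, ?_, ?_⟩
  · simpa using (tendsto_rpow_neg_atTop hσ).const_mul (2 * (κ * (8 * C₀ * K ^ 3)))
  intro n T g₁ g₂ hn hg₁ hg₂ hbd t ht
  have hn0 : 0 < n := by linarith
  set W := bmul (fun ξ => cut n ξ * bw (-s) ξ) with hW
  have hder : ∀ t ∈ Set.Icc 0 T, HasDerivWithinAt (fun τ => W (g₁ τ - g₂ τ))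
      ((κ • bmul (cut n) (B (g₁ t) (g₁ t)) -
        bmul (fun ξ => cut n ξ * (lam b ξ * bw (-s) ξ)) (g₁ t)) -
      (κ • bmul (cut n) (B (g₂ t) (g₂ t)) -
        bmul (fun ξ => cut n ξ * (lam b ξ * bw (-s) ξ)) (g₂ t))) (Set.Icc 0 T) t := fun t ht => by
    simp only [map_sub]
    exact (hg₁ t ht).sub (hg₂ t ht)
  have h1 := gronwall_Icc (C := C) (ε := 2 * (κ * (8 * C₀ * K ^ 3)) * n ^ (-σ))
    (fun t ht => hasDerivWithinAt_norm_sq (hder t ht)) (fun t ht => ?_) t ht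
  · refine h1.trans ?_
    rw [gronwallBound_of_K_ne_0 (by linarith)]
    set y := ‖W (g₁ 0 - g₂ 0)‖ ^ 2
    set ε := 2 * (κ * (8 * C₀ * K ^ 3)) * n ^ (-σ)
    have hε : 0 ≤ ε := by positivity
    have e1 : 1 ≤ Real.exp (C * t) := Real.one_le_exp (mul_nonneg (by linarith) ht.1)
    have e2 : ε / C * (Real.exp (C * t) - 1) ≤ ε * (Real.exp (C * t) - 1) :=
      mul_le_mul_of_nonneg_right (div_le_self hε hC1) (by linarith)
    rw [add_mul]
    linarith
  · obtain ⟨m1, m2, m3, m4⟩ := hbd t ht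
    have h2 := diff_energy_le ha₀ ha hb hs hκ hK hB hM₀ hM hC₀ hn0 (htail n hn) m1 m2 m3 m4
    rw [← hW] at h2
    have h3 := sq_nonneg ‖W (g₁ t - g₂ t)‖
    rw [hC]
    linarith

/-! ### Uniqueness, passage to the limit and existence on the frequency side -/

/-- A criterion for differentiability on an interval through approximations. -/
lemma hasDerivWithinAt_of_forall_approx {E : Type*} [NormedAddCommGroup E] [NormedSpace ℝ E]
    {f : ℝ → E} {v : E} {S : Set ℝ} {t : ℝ}
    (h : ∀ ε : ℝ, 0 < ε → ∃ ρ : ℝ, 0 < ρ ∧ ∀ τ ∈ S, |τ - t| < ρ →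
      ‖f τ - f t - (τ - t) • v‖ ≤ ε * |τ - t|) :
    HasDerivWithinAt f v S t := by
  rw [hasDerivWithinAt_iff_isLittleO, Asymptotics.isLittleO_iff]
  intro c hc
  obtain ⟨ρ, hρ, h1⟩ := h c hc
  filter_upwards [self_mem_nhdsWithin, mem_nhdsWithin_of_mem_nhds (Metric.ball_mem_nhds t hρ)]
    with τ h2 h3
  exact h1 τ h2 h3

/-- The mean value inequality in the form used to differentiate limits. -/
lemma norm_sub_sub_smul_le {E : Type*} [NormedAddCommGroup E] [NormedSpace ℝ E]
    {f F : ℝ → E} {v : E} {T t τ ρ ε : ℝ} (ht : t ∈ Set.Icc 0 T) (hτ : τ ∈ Set.Icc 0 T)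
    (hf : ∀ x ∈ Set.Icc 0 T, HasDerivWithinAt f (F x) (Set.Icc 0 T) x)
    (hF : ∀ x ∈ Set.Icc 0 T, |x - t| < ρ → ‖F x - v‖ ≤ ε) (hρ : |τ - t| < ρ) :
    ‖f τ - f t - (τ - t) • v‖ ≤ ε * |τ - t| := by
  have hρ0 : 0 < ρ := (abs_nonneg _).trans_lt hρ
  have h := (((convex_Icc 0 T).inter (convex_ball t ρ))).norm_image_sub_le_of_norm_hasDerivWithin_le
    (f := fun x => f x - (x - t) • v) (f' := fun x => F x - v) (C := ε) (x := t) (y := τ)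
    (fun x hx => by
      have h1 := (hf x hx.1).mono (Set.inter_subset_left (t := Metric.ball t ρ))
      have h2 : HasDerivWithinAt (fun x : ℝ => (x - t) • v) ((1 : ℝ) • v)
          (Set.Icc 0 T ∩ Metric.ball t ρ) x := ((hasDerivWithinAt_id x _).sub_const t).smul_const v
      rw [one_smul] at h2
      exact h1.sub h2)
    (fun x hx => hF x hx.1 hx.2) ⟨ht, Metric.mem_ball_self hρ0⟩ ⟨hτ, hρ⟩
  simp only [sub_self, zero_smul, sub_zero] at h
  rw [sub_right_comm]
  exact h

/-- The mean value inequality bounds the difference quotients uniformly in n, end points of the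
interval included; continuity of the limiting derivative then does the rest. -/
lemma hasDerivWithinAt_of_tendstoUniformlyOn {E : Type*} [NormedAddCommGroup E] [NormedSpace ℝ E]
    {f F : ℕ → ℝ → E} {g G : ℝ → E} {T : ℝ}
    (hf : ∀ n, ∀ t ∈ Set.Icc 0 T, HasDerivWithinAt (f n) (F n t) (Set.Icc 0 T) t)
    (hg : ∀ t ∈ Set.Icc 0 T, Filter.Tendsto (fun n => f n t) Filter.atTop (nhds (g t)))
    (hG : TendstoUniformlyOn F G Filter.atTop (Set.Icc 0 T)) (hGc : ContinuousOn G (Set.Icc 0 T)) :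
    ∀ t ∈ Set.Icc 0 T, HasDerivWithinAt g (G t) (Set.Icc 0 T) t := by
  intro t ht
  refine hasDerivWithinAt_of_forall_approx fun ε hε => ?_
  obtain ⟨ρ, hρ, h1⟩ := Metric.continuousWithinAt_iff.1 (hGc t ht) (ε / 2) (by positivity)
  refine ⟨ρ, hρ, fun τ hτ hτρ => ?_⟩
  have h2 := Metric.tendstoUniformlyOn_iff.1 hG (ε / 2) (by positivity)
  refine le_of_tendsto (((hg τ hτ).sub (hg t ht)).sub_const ((τ - t) • G t)).norm ?_
  filter_upwards [h2] with n hn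
  refine norm_sub_sub_smul_le ht hτ (hf n) (fun x hx hxρ => ?_) hτρ
  have h3 := hn x hx
  have h4 := h1 hx hxρ
  rw [dist_comm, dist_eq_norm] at h3
  rw [dist_eq_norm] at h4
  calc _ = ‖(F n x - G x) + (G x - G t)‖ := by rw [sub_add_sub_cancel]
    _ ≤ _ := norm_add_le _ _
    _ ≤ ε := by linarith

/-- The evolution equation in a negative order space. -/
def StrongEq (b s κ : ℝ) (B : VL2 →L[ℝ] VL2 →L[ℝ] VL2) (T : ℝ) (g : ℝ → VL2) : Prop :=
  ∀ t ∈ Set.Icc 0 T, HasDerivWithinAt (fun τ => bmul (bw (-(b + 1 + s))) (g τ))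
    (κ • bmul (bw (-(b + 1))) (B (g t) (g t)) -
      bmul (fun ξ => bw (-(b + 1)) ξ * (lam b ξ * bw (-s) ξ)) (g t)) (Set.Icc 0 T) t

lemma lam_le_bw {b : ℝ} (hb : 0 ≤ b) (ξ : R3) : lam b ξ ≤ (2 * Real.pi) ^ b * bw b ξ := by
  rw [lam, Real.mul_rpow (by positivity) (norm_nonneg _)]
  gcongr
  exact norm_rpow_le_bw hb ξ

lemma bddBy_dissipation {b s : ℝ} (hb : 0 ≤ b) (hs : 0 ≤ s) :
    BddBy (fun ξ => bw (-(b + 1)) ξ * (lam b ξ * bw (-s) ξ)) ((2 * Real.pi) ^ b) := by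
  refine ⟨(measurable_bw _).mul ((measurable_lam b).mul (measurable_bw _)), fun ξ => ?_⟩
  have h1 := lam_nonneg b ξ
  have h2 := bw_pos (-(b + 1)) ξ
  have h3 := bw_pos (-s) ξ
  rw [abs_of_nonneg (by positivity)]
  have h4 : bw (-s) ξ ≤ 1 := bw_le_one (by linarith) ξ
  have h5 := lam_le_bw hb ξ
  have h6 := bw_pos b ξ
  calc bw (-(b + 1)) ξ * (lam b ξ * bw (-s) ξ)
      ≤ bw (-(b + 1)) ξ * (((2 * Real.pi) ^ b * bw b ξ) * 1) := by gcongr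
    _ = (2 * Real.pi) ^ b * (bw (-(b + 1)) ξ * bw b ξ) := by ring
    _ ≤ (2 * Real.pi) ^ b * 1 := by
        rw [← bw_add]
        gcongr
        exact bw_le_one (by linarith) ξ
    _ = _ := mul_one _

/-- Below frequency n the negative weight can be undone by a bounded multiplier. -/
lemma StrongEq.truncEq {b s κ T : ℝ} (hb : 0 ≤ b) (hs : 0 ≤ s) {B : VL2 →L[ℝ] VL2 →L[ℝ] VL2}
    {g : ℝ → VL2} (h : StrongEq b s κ B T g) (n : ℝ) : TruncEq b s κ B n T g := by
  intro t ht
  have hm : BddBy (fun ξ => cut n ξ * bw (b + 1) ξ) ((1 + n ^ 2) ^ ((b + 1) / 2)) := by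
    refine bddBy_cut_mul (measurable_bw _) (by positivity) fun ξ hξ => ?_
    rw [abs_of_pos (bw_pos _ _), bw]
    gcongr
  have e : ∀ c ξ, cut n ξ * bw (b + 1) ξ * (bw (-(b + 1)) ξ * c) = cut n ξ * c := fun c ξ => by
    calc _ = cut n ξ * (bw (b + 1) ξ * bw (-(b + 1)) ξ) * c := by ring
      _ = _ := by rw [bw_mul_neg, mul_one]
  have h1 := ((bmul fun ξ => cut n ξ * bw (b + 1) ξ).hasFDerivAt.comp_hasDerivWithinAt t (h t ht))
  have e1 : ∀ X : VL2, bmul (fun ξ => cut n ξ * bw (b + 1) ξ) (bmul (bw (-(b + 1 + s))) X) =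
      bmul (fun ξ => cut n ξ * bw (-s) ξ) X := fun X => by
    rw [bmul_bmul hm (bddBy_bw (by linarith))]
    congr 2
    ext1 ξ
    rw [show -(b + 1 + s) = -(b + 1) + -s by ring, bw_add (-(b + 1)), e]
  simp only [map_sub, map_smul] at h1
  rw [bmul_bmul hm (bddBy_bw (by linarith)), bmul_bmul hm (bddBy_dissipation hb hs)] at h1
  have e2 : (fun ξ => cut n ξ * bw (b + 1) ξ * bw (-(b + 1)) ξ) = cut n := funext fun ξ => by
    simpa using e 1 ξ
  simp only [e, e2] at h1
  refine h1.congr_of_eventuallyEq_of_mem (Filter.Eventually.of_forall fun τ => ?_) ht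
  exact (e1 _).symm

lemma norm_bmul_cut_le {s n₀ n : ℝ} (hs : 0 ≤ s) (hn : n₀ ≤ n) (h : VL2) :
    ‖bmul (cut n₀) h‖ ≤
      (1 + n₀ ^ 2) ^ (s / 2) * ‖bmul (fun ξ => cut n ξ * bw (-s) ξ) h‖ := by
  refine Lp.norm_le_mul_norm_of_ae_le_mul ?_
  filter_upwards [bmul_ae (bddBy_cut n₀) h, bmul_ae (bddBy_cut_bw hs n) h] with ξ h1 h2
  have h3 := bw_pos (-s) ξ
  rw [h1, h2, norm_smul, norm_smul, Real.norm_of_nonneg (cut_nonneg _ _),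
    Real.norm_of_nonneg (mul_nonneg (cut_nonneg _ _) h3.le), ← mul_assoc]
  gcongr
  unfold cut
  split_ifs with h4 h5 h5
  · have h6 : bw s ξ ≤ (1 + n₀ ^ 2) ^ (s / 2) := by
      unfold bw
      gcongr
    calc (1 : ℝ) = bw s ξ * bw (-s) ξ := (bw_mul_neg s ξ).symm
      _ ≤ (1 + n₀ ^ 2) ^ (s / 2) * bw (-s) ξ := by gcongr
      _ = _ := by rw [one_mul]
  · exact absurd (h4.trans hn) h5
  · positivity
  · simp

lemma eq_zero_of_forall_cut {h : VL2} (h0 : ∀ n : ℕ, bmul (cut n) h = 0) : h = 0 := by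
  refine Lp.ext ?_
  have h1 : ∀ᵐ ξ, ∀ n : ℕ, cut n ξ • h ξ = 0 := by
    rw [ae_all_iff]
    intro n
    filter_upwards [bmul_ae (bddBy_cut n) h, Lp.coeFn_zero C3 2 (volume : Measure R3)] with ξ h2 h3
    rw [← h2, h0 n, h3, Pi.zero_apply]
  filter_upwards [h1, Lp.coeFn_zero C3 2 (volume : Measure R3)] with ξ h2 h3
  obtain ⟨n, hn⟩ := exists_nat_ge ‖ξ‖
  have := h2 n
  rw [h3, Pi.zero_apply]
  simpa [cut, hn] using this

/-- The stability estimate with equal data leaves only the error δ(n). Fixing a low-frequency window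
n₀ and letting n tend to infinity shows that the difference vanishes there. -/
theorem StrongEq.unique {a b s κ T : ℝ} (ha₀ : 0 ≤ a) (ha : a < 1) (hb : 1 - a < b)
    (hs : 7 / 2 - a < s) (hκ : 0 ≤ κ) {B : VL2 →L[ℝ] VL2 →L[ℝ] VL2} (hB : IsBilin a s B)
    {g₁ g₂ : ℝ → VL2} (hc₁ : ContinuousOn g₁ (Set.Icc 0 T)) (hc₂ : ContinuousOn g₂ (Set.Icc 0 T))
    (hs₁ : ∀ t ∈ Set.Icc 0 T, g₁ t ∈ solenoidal) (hs₂ : ∀ t ∈ Set.Icc 0 T, g₂ t ∈ solenoidal)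
    (h₁ : StrongEq b s κ B T g₁) (h₂ : StrongEq b s κ B T g₂) (h0 : g₁ 0 = g₂ 0) :
    ∀ t ∈ Set.Icc 0 T, g₁ t = g₂ t := by
  intro t ht
  obtain ⟨K₁, hK₁⟩ := isCompact_Icc.exists_bound_of_continuousOn hc₁
  obtain ⟨K₂, hK₂⟩ := isCompact_Icc.exists_bound_of_continuousOn hc₂
  have hK0 : 0 ≤ max K₁ K₂ := ((norm_nonneg _).trans (hK₁ t ht)).trans (le_max_left _ _)
  have hs0 : 0 ≤ s := by linarith
  obtain ⟨C, δ, hC, hδ, hst⟩ := exists_truncEq_stability ha₀ ha hb hs hκ hK0 hB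
  have hst' : ∀ n : ℝ, 1 ≤ n →
      ‖bmul (fun ξ => cut n ξ * bw (-s) ξ) (g₁ t - g₂ t)‖ ^ 2 ≤ δ n * Real.exp (C * t) :=
    fun n hn => by
      have := hst n T g₁ g₂ hn (h₁.truncEq (by linarith) hs0 n) (h₂.truncEq (by linarith) hs0 n)
        (fun t ht => ⟨hs₁ t ht, hs₂ t ht, (hK₁ t ht).trans (le_max_left _ _),
          (hK₂ t ht).trans (le_max_right _ _)⟩) t ht
      rwa [h0, sub_self, map_zero, norm_zero, zero_pow two_ne_zero, zero_add] at this
  refine sub_eq_zero.1 (eq_zero_of_forall_cut fun n₀ => ?_)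
  have h3 : ∀ᶠ n : ℝ in Filter.atTop, ‖bmul (cut n₀) (g₁ t - g₂ t)‖ ^ 2 ≤
      ((1 + (n₀ : ℝ) ^ 2) ^ (s / 2)) ^ 2 * (δ n * Real.exp (C * t)) := by
    filter_upwards [Filter.eventually_ge_atTop (n₀ : ℝ), Filter.eventually_ge_atTop 1] with n h4 h5
    calc _ ≤ ((1 + (n₀ : ℝ) ^ 2) ^ (s / 2) *
            ‖bmul (fun ξ => cut n ξ * bw (-s) ξ) (g₁ t - g₂ t)‖) ^ 2 := by
          gcongr
          exact norm_bmul_cut_le hs0 h4 _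
      _ ≤ _ := by
          rw [mul_pow]
          gcongr
          exact hst' n h5
  have h4 := ge_of_tendsto ((hδ.mul_const (Real.exp (C * t))).const_mul
    (((1 + (n₀ : ℝ) ^ 2) ^ (s / 2)) ^ 2)) h3
  rw [zero_mul, mul_zero] at h4
  have h5 := pow_eq_zero_iff (n := 2) two_ne_zero |>.1 (le_antisymm h4 (sq_nonneg _))
  exact norm_eq_zero.1 h5

/-- The frequencies above `n` are controlled by the energy weight. -/
lemma norm_sub_cut_le {s ε n₀ n : ℝ} {ψ : ℝ → ℝ} (hs : 0 ≤ s) (hψ : IsWeight s ψ) (hε : 0 ≤ ε)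
    (hn₀ : ∀ ξ : R3, n₀ < ‖ξ‖ → bw s ξ ≤ ε * Vw ψ ξ) (G : VL2) :
    ‖bmul (fun ξ => cut n ξ * (bw s ξ / Vw ψ ξ)) G -
      bmul (cut n₀) (bmul (fun ξ => cut n ξ * (bw s ξ / Vw ψ ξ)) G)‖ ≤ ε * ‖G‖ := by
  refine Lp.norm_le_mul_norm_of_ae_le_mul ?_
  have hQ := hψ.bddBy_ratio hs n
  set g := bmul (fun ξ => cut n ξ * (bw s ξ / Vw ψ ξ)) G with hg
  filter_upwards [Lp.coeFn_sub g (bmul (cut n₀) g), bmul_ae (bddBy_cut n₀) g, bmul_ae hQ G]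
    with ξ h1 h2 h3
  rw [h1, Pi.sub_apply, h2, h3]
  by_cases h4 : ‖ξ‖ ≤ n₀
  · simp only [cut, h4, if_true, one_smul, sub_self, norm_zero]
    positivity
  · rw [show cut n₀ ξ = 0 from if_neg h4, zero_smul, sub_zero, norm_smul]
    gcongr
    have h5 := bw_pos s ξ
    have h6 := Vw_pos ψ ξ
    rw [Real.norm_of_nonneg (mul_nonneg (cut_nonneg _ _) (by positivity))]
    refine (mul_le_of_le_one_left (by positivity) (cut_le_one _ _)).trans ?_
    rw [div_le_iff₀ h6]
    exact hn₀ ξ (not_le.1 h4)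

/-- Uniform convergence of the frequency-localized approximations. -/
lemma exists_tendstoUniformlyOn {a b s κ T R : ℝ} {ψ : ℝ → ℝ} (ha₀ : 0 ≤ a) (ha : a < 1)
    (hb : 1 - a < b) (hs : 7 / 2 - a < s) (hκ : 0 ≤ κ) (hR : 0 ≤ R) (hψ : IsWeight s ψ)
    (hlim : ∀ ε : ℝ, 0 < ε → ∃ N : ℝ, ∀ ξ : R3, N < ‖ξ‖ → bw s ξ ≤ ε * Vw ψ ξ)
    {B : VL2 →L[ℝ] VL2 →L[ℝ] VL2} (hB : IsBilin a s B) {G : ℕ → ℝ → VL2} {G₀ : VL2}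
    (hG₀ : ∀ n, G n 0 = G₀)
    (hG : ∀ n : ℕ, ∀ t ∈ Set.Icc 0 T, G n t ∈ solenoidal ∧ ‖G n t‖ ≤ R ∧
      HasDerivWithinAt (G n) (galerkinField b s κ ψ B n (G n t)) (Set.Icc 0 T) t) :
    ∃ g : ℝ → VL2, TendstoUniformlyOn
      (fun (n : ℕ) t => bmul (fun ξ => cut n ξ * (bw s ξ / Vw ψ ξ)) (G n t)) g Filter.atTop
      (Set.Icc 0 T) := by
  have hs0 : 0 ≤ s := by linarith
  have hb0 : 0 ≤ b := by linarith
  set γ : ℕ → ℝ → VL2 := fun n t => bmul (fun ξ => cut n ξ * (bw s ξ / Vw ψ ξ)) (G n t) with hγ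
  have hγK : ∀ n, ∀ t ∈ Set.Icc 0 T, ‖γ n t‖ ≤ 2 ^ s * R := fun n t ht =>
    (norm_bmul_le (hψ.bddBy_ratio hs0 n) _).trans (by have := (hG n t ht).2.1; gcongr)
  have hγs : ∀ n, ∀ t ∈ Set.Icc 0 T, γ n t ∈ solenoidal := fun n t ht =>
    bmul_mem_solenoidal (hψ.bddBy_ratio hs0 n)
      (fun ξ => by simp [cut_neg_arg, bw_neg_arg, Vw_neg_arg]) (hG n t ht).1
  obtain ⟨C, δ, hC, hδ, hst⟩ := exists_truncEq_stability ha₀ ha hb hs hκ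
    (show 0 ≤ 2 ^ s * R by positivity) hB
  -- All levels start from the same G₀, so below frequency m the initial difference is exactly zero.
  have h0 : ∀ m n n' : ℕ, m ≤ n → m ≤ n' →
      bmul (fun ξ => cut m ξ * bw (-s) ξ) (γ n 0 - γ n' 0) = 0 := fun m n n' h h' => by
    have e : ∀ k : ℕ, m ≤ k → bmul (fun ξ => cut m ξ * bw (-s) ξ) (γ k 0) =
        bmul (fun ξ => (cut m ξ * bw (-s) ξ) * (bw s ξ / Vw ψ ξ)) G₀ := fun k hk => by
      simp only [hγ]
      rw [hG₀, bmul_bmul (bddBy_cut_bw hs0 m) (hψ.bddBy_ratio hs0 k)]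
      congr 2
      ext1 ξ
      have := cut_mul_cut (m := (m : ℝ)) (n := k) (by exact_mod_cast hk) ξ
      calc _ = (cut m ξ * cut k ξ) * bw (-s) ξ * (bw s ξ / Vw ψ ξ) := by ring
        _ = _ := by rw [this]
    rw [map_sub, e n h, e n' h', sub_self]
  have hlow : ∀ m n n' : ℕ, 1 ≤ m → m ≤ n → m ≤ n' → ∀ t ∈ Set.Icc 0 T,
      ‖bmul (fun ξ => cut m ξ * bw (-s) ξ) (γ n t - γ n' t)‖ ^ 2 ≤ |δ m| * Real.exp (C * T) :=
    fun m n n' hm hn hn' t ht => by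
      have h1 := hst m T (γ n) (γ n') (by exact_mod_cast hm)
        (truncEq_of_galerkin hs0 hb0 hψ (by exact_mod_cast hn) fun t ht => (hG n t ht).2.2)
        (truncEq_of_galerkin hs0 hb0 hψ (by exact_mod_cast hn') fun t ht => (hG n' t ht).2.2)
        (fun t ht => ⟨hγs n t ht, hγs n' t ht, hγK n t ht, hγK n' t ht⟩) t ht
      rw [h0 m n n' hn hn', norm_zero, zero_pow two_ne_zero, zero_add] at h1
      refine h1.trans ?_
      have := ht.2
      gcongr
      exact le_abs_self _
  have hcau : UniformCauchySeqOn γ Filter.atTop (Set.Icc 0 T) := by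
    rw [Metric.uniformCauchySeqOn_iff]
    intro ε hε
    -- Frequencies above N contribute at most ε/4 for each approximation, by the stronger energy.
    -- Those below N are then compared through the L² stability estimate, at the cost of the fixed
    -- factor D.
    obtain ⟨N, hN⟩ := hlim (ε / (4 * (R + 1))) (by positivity)
    set D : ℝ := (1 + N ^ 2) ^ (s / 2) with hD
    have hD0 : 0 < D := by positivity
    have hδ' : Filter.Tendsto (fun m : ℕ => |δ m| * Real.exp (C * T)) Filter.atTop (nhds 0) := by
      simpa using ((hδ.comp tendsto_natCast_atTop_atTop).abs).mul_const (Real.exp (C * T))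
    obtain ⟨m, h1, h2, h3⟩ := ((hδ'.eventually (eventually_lt_nhds
      (show (0 : ℝ) < (ε / (4 * D)) ^ 2 by positivity))).and
      ((Filter.eventually_ge_atTop 1).and (tendsto_natCast_atTop_atTop.eventually
        (Filter.eventually_ge_atTop N)))).exists
    refine ⟨m, fun n hn n' hn' t ht => ?_⟩
    have hhigh : ∀ k : ℕ, ‖γ k t - bmul (cut N) (γ k t)‖ ≤ ε / 4 := fun k => by
      refine (norm_sub_cut_le hs0 hψ (by positivity) hN (G k t)).trans ?_
      calc _ ≤ ε / (4 * (R + 1)) * (R + 1) := by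
            gcongr
            linarith [(hG k t ht).2.1]
        _ = _ := by field_simp
    have h4 : ‖bmul (fun ξ => cut m ξ * bw (-s) ξ) (γ n t - γ n' t)‖ < ε / (4 * D) :=
      lt_of_pow_lt_pow_left₀ 2 (by positivity) ((hlow m n n' h2 hn hn' t ht).trans_lt h1)
    have h5 : ‖bmul (cut N) (γ n t - γ n' t)‖ < ε / 4 := by
      refine (norm_bmul_cut_le hs0 h3 _).trans_lt ?_
      calc _ < D * (ε / (4 * D)) := by gcongr
        _ = _ := by field_simp
    rw [dist_eq_norm]
    calc ‖γ n t - γ n' t‖ = ‖(γ n t - bmul (cut N) (γ n t)) + bmul (cut N) (γ n t - γ n' t) -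
          (γ n' t - bmul (cut N) (γ n' t))‖ := by rw [map_sub]; congr 1; abel
      _ ≤ ‖γ n t - bmul (cut N) (γ n t)‖ + ‖bmul (cut N) (γ n t - γ n' t)‖ +
          ‖γ n' t - bmul (cut N) (γ n' t)‖ :=
        (norm_sub_le _ _).trans (by gcongr; exact norm_add_le _ _)
      _ < ε := by linarith [hhigh n, hhigh n']
  have hex : ∀ t, ∃ x : VL2, t ∈ Set.Icc 0 T →
      Filter.Tendsto (fun n => γ n t) Filter.atTop (nhds x) := fun t => by
    by_cases ht : t ∈ Set.Icc 0 T
    · obtain ⟨x, hx⟩ := cauchySeq_tendsto_of_complete (hcau.cauchySeq ht)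
      exact ⟨x, fun _ => hx⟩
    · exact ⟨0, fun h => absurd h ht⟩
  choose g hg using hex
  exact ⟨g, hcau.tendstoUniformlyOn_of_tendsto fun t ht => hg t ht⟩

/-- Existence of a solution on the frequency side. -/
theorem exists_strongEq {a b s κ : ℝ} (ha₀ : 0 ≤ a) (ha : a < 1) (hb : 1 - a < b)
    (hs : 7 / 2 - a < s) (hκ : 0 ≤ κ) {B : VL2 →L[ℝ] VL2 →L[ℝ] VL2} (hB : IsBilin a s B)
    {g₀ : VL2} (hg₀ : g₀ ∈ solenoidal) :
    ∃ T : ℝ, 0 < T ∧ ∃ g : ℝ → VL2, g 0 = g₀ ∧ ContinuousOn g (Set.Icc 0 T) ∧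
      (∀ t ∈ Set.Icc 0 T, g t ∈ solenoidal) ∧ StrongEq b s κ B T g := by
  have hs0 : 0 ≤ s := by linarith
  have hb0 : 0 ≤ b := by linarith
  obtain ⟨ψ, hψ, hlim, hG₀⟩ := exists_isWeight (s := s) (by linarith) g₀
  -- The approximations evolve the unknown weighted by `Vw ψ` instead of `bw s`; the datum is
  -- rescaled accordingly and lies in L² by the choice of ψ.
  have hG₀s : hG₀.toLp _ ∈ solenoidal :=
    ⟨(hg₀.1.rsmul fun ξ => by simp [bw_neg_arg, Vw_neg_arg]).congr hG₀.coeFn_toLp.symm,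
      (hg₀.2.rsmul _).congr hG₀.coeFn_toLp.symm⟩
  obtain ⟨T, R, hT, hR, hG⟩ := exists_galerkin ha₀ ha hb hs hκ hψ hB hG₀s
  choose G hG0 hG using fun n : ℕ => hG n
  obtain ⟨g, hg⟩ := exists_tendstoUniformlyOn ha₀ ha hb hs hκ hR.le hψ hlim hB hG0 hG
  set γ : ℕ → ℝ → VL2 := fun n t => bmul (fun ξ => cut n ξ * (bw s ξ / Vw ψ ξ)) (G n t) with hγ
  have hγK : ∀ n, ∀ t ∈ Set.Icc 0 T, ‖γ n t‖ ≤ 2 ^ s * R := fun n t ht =>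
    (norm_bmul_le (hψ.bddBy_ratio hs0 n) _).trans (by have := (hG n t ht).2.1; gcongr)
  have hγc : ∀ n, ContinuousOn (γ n) (Set.Icc 0 T) := fun n =>
    (bmul _).continuous.comp_continuousOn fun t ht => (hG n t ht).2.2.continuousWithinAt
  have hgc : ContinuousOn g (Set.Icc 0 T) := hg.continuousOn (Filter.Frequently.of_forall hγc)
  have hgK : ∀ t ∈ Set.Icc 0 T, ‖g t‖ ≤ 2 ^ s * R := fun t ht =>
    le_of_tendsto (hg.tendsto_at ht).norm (Filter.Eventually.of_forall fun n => hγK n t ht)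
  refine ⟨T, hT, g, ?_, hgc, fun t ht => ?_, ?_⟩
  · have ht : (0 : ℝ) ∈ Set.Icc 0 T := ⟨le_rfl, hT.le⟩
    refine sub_eq_zero.1 (eq_zero_of_forall_cut fun m => ?_)
    have h1 : Filter.Tendsto (fun n => bmul (cut m) (γ n 0)) Filter.atTop
        (nhds (bmul (cut m) (g 0))) := ((bmul _).continuous.tendsto _).comp (hg.tendsto_at ht)
    have h2 : ∀ᶠ n : ℕ in Filter.atTop, bmul (cut m) (γ n 0) = bmul (cut m) g₀ := by
      filter_upwards [Filter.eventually_ge_atTop m] with n hn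
      simp only [hγ]
      rw [hG0, bmul_bmul (bddBy_cut m) (hψ.bddBy_ratio hs0 n)]
      refine Lp.ext ?_
      filter_upwards [bmul_ae ((bddBy_cut m).mul (hψ.bddBy_ratio hs0 n)) (hG₀.toLp _),
        hG₀.coeFn_toLp, bmul_ae (bddBy_cut m) g₀] with ξ h3 h4 h5
      rw [h3, h4, h5, smul_smul]
      congr 1
      have h6 := (bw_pos s ξ).ne'
      have h7 := (Vw_pos ψ ξ).ne'
      have := cut_mul_cut (m := (m : ℝ)) (n := n) (by exact_mod_cast hn) ξ
      calc _ = (cut m ξ * cut n ξ) * ((bw s ξ / Vw ψ ξ) * (Vw ψ ξ / bw s ξ)) := by ring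
        _ = _ := by rw [this, div_mul_div_cancel₀ h7, div_self h6, mul_one]
    rw [map_sub, sub_eq_zero]
    exact tendsto_nhds_unique h1 (tendsto_const_nhds.congr' (h2.mono fun n hn => hn.symm))
  · refine isClosed_solenoidal.mem_of_tendsto (hg.tendsto_at ht)
      (Filter.Eventually.of_forall fun n => ?_)
    exact bmul_mem_solenoidal (hψ.bddBy_ratio hs0 n)
      (fun ξ => by simp [cut_neg_arg, bw_neg_arg, Vw_neg_arg]) (hG n t ht).1
  · set D := bmul fun ξ => bw (-(b + 1)) ξ * (lam b ξ * bw (-s) ξ) with hD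
    have hbβ := bddBy_bw (s := -(b + 1)) (by linarith)
    have hdis := bddBy_dissipation hb0 hs0
    -- After the negative weight the dissipation is a bounded operator, so uniform convergence of
    -- the unknowns carries the right-hand sides along.
    refine hasDerivWithinAt_of_tendstoUniformlyOn (f := fun n τ => bmul (bw (-(b + 1 + s))) (γ n τ))
      (F := fun n t => κ • bmul (bw (-(b + 1))) (bmul (cut n) (B (γ n t) (γ n t))) - D (γ n t))
      (g := fun τ => bmul (bw (-(b + 1 + s))) (g τ))
      (G := fun t => κ • bmul (bw (-(b + 1))) (B (g t) (g t)) - D (g t)) ?_ ?_ ?_ ?_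
    · intro n t ht
      have h1 := ((bmul (bw (-(b + 1)))).hasFDerivAt.comp_hasDerivWithinAt t
        (truncEq_of_galerkin hs0 hb0 hψ (le_refl (n : ℝ)) (fun t ht => (hG n t ht).2.2) t ht))
      have hcut : ∀ t, bmul (cut n) (γ n t) = γ n t := fun t => by
        simp only [hγ]
        rw [bmul_bmul (bddBy_cut n) (hψ.bddBy_ratio hs0 n)]
        congr 2; ext1 ξ; rw [← mul_assoc, cut_mul_self]
      have e1 : ∀ t, bmul (bw (-(b + 1))) (bmul (fun ξ => cut n ξ * bw (-s) ξ) (γ n t)) =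
          bmul (bw (-(b + 1 + s))) (γ n t) := fun t => by
        rw [bmul_bmul hbβ (bddBy_cut_bw hs0 n)]
        nth_rewrite 2 [← hcut t]
        rw [bmul_bmul (bddBy_bw (by linarith)) (bddBy_cut n)]
        congr 2; ext1 ξ
        rw [show -(b + 1 + s) = -(b + 1) + -s by ring, bw_add (-(b + 1))]; ring
      have e2 : bmul (bw (-(b + 1))) (bmul (fun ξ => cut n ξ * (lam b ξ * bw (-s) ξ)) (γ n t)) =
          D (γ n t) := by
        rw [bmul_bmul hbβ (bddBy_cut_lam_bw hb0 hs0 n)]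
        nth_rewrite 2 [← hcut t]
        rw [hD, bmul_bmul hdis (bddBy_cut n)]
        congr 2; ext1 ξ; ring
      simp only [map_sub, map_smul] at h1
      rw [e2] at h1
      exact h1.congr_of_eventuallyEq_of_mem (Filter.Eventually.of_forall fun τ => (e1 τ).symm) ht
    · intro t ht
      exact ((bmul _).continuous.tendsto _).comp (hg.tendsto_at ht)
    · rw [Metric.tendstoUniformlyOn_iff]
      intro ε hε
      set K : ℝ := 2 ^ s * R with hK
      have hK0 : 0 ≤ K := by positivity
      have hB0 : 0 ≤ ‖B‖ := norm_nonneg B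
      have hD0 : 0 ≤ ‖D‖ := norm_nonneg D
      set M : ℝ := κ * (2 * (‖B‖ * K)) + ‖D‖ + 1 with hM
      have hM0 : 0 < M := by positivity
      have hlim0 : Filter.Tendsto (fun n : ℕ => κ * ((n : ℝ) ^ (-(b + 1)) * (‖B‖ * K * K)))
          Filter.atTop (nhds 0) := by
        simpa using ((((tendsto_rpow_neg_atTop (y := b + 1) (by linarith)).comp
          tendsto_natCast_atTop_atTop).mul_const (‖B‖ * K * K)).const_mul κ)
      filter_upwards [Metric.tendstoUniformlyOn_iff.1 hg (ε / (2 * M)) (by positivity),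
        hlim0.eventually (eventually_lt_nhds (show (0 : ℝ) < ε / 2 by positivity)),
        Filter.eventually_ge_atTop 1] with n h1 h2 h3 t ht
      have h4 := h1 t ht
      have hn1 : (1 : ℝ) ≤ n := by exact_mod_cast h3
      have k1 := hγK n t ht
      have k2 := hgK t ht
      rw [dist_comm, dist_eq_norm] at h4 ⊢
      set x := γ n t
      set y := g t
      have k3 : ‖B x x‖ ≤ ‖B‖ * K * K := (B.le_opNorm₂ x x).trans (by gcongr)
      have k4 : ‖B x x - B y y‖ ≤ 2 * (‖B‖ * K) * ‖x - y‖ := by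
        have e : B x x - B y y = B x (x - y) + B (x - y) y := by
          simp only [map_sub, sub_apply]; abel
        rw [e]
        calc _ ≤ ‖B‖ * ‖x‖ * ‖x - y‖ + ‖B‖ * ‖x - y‖ * ‖y‖ :=
              (norm_add_le _ _).trans (add_le_add (B.le_opNorm₂ _ _) (B.le_opNorm₂ _ _))
          _ ≤ ‖B‖ * K * ‖x - y‖ + ‖B‖ * ‖x - y‖ * K := by gcongr
          _ = _ := by ring
      have k5 : ‖bmul (bw (-(b + 1))) (B x x - B y y)‖ ≤ 2 * (‖B‖ * K) * ‖x - y‖ := by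
        refine (norm_bmul_le hbβ _).trans ?_
        rwa [one_mul]
      -- The nonlinearity is merely bounded in L²; the negative weight is what makes its frequency
      -- truncation converge uniformly.
      have k6 : ‖bmul (bw (-(b + 1))) (B x x - bmul (cut n) (B x x))‖ ≤
          (n : ℝ) ^ (-(b + 1)) * (‖B‖ * K * K) :=
        (norm_bmul_bw_sub_cut_le (by linarith) hn1 _).trans (by gcongr)
      have k7 := D.le_opNorm (x - y)
      have e : κ • bmul (bw (-(b + 1))) (bmul (cut n) (B x x)) - D x -
          (κ • bmul (bw (-(b + 1))) (B y y) - D y) =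
          κ • bmul (bw (-(b + 1))) (B x x - B y y) -
            κ • bmul (bw (-(b + 1))) (B x x - bmul (cut n) (B x x)) - D (x - y) := by
        simp only [map_sub, smul_sub]; abel
      rw [e]
      calc _ ≤ ‖κ • bmul (bw (-(b + 1))) (B x x - B y y)‖ +
            ‖κ • bmul (bw (-(b + 1))) (B x x - bmul (cut n) (B x x))‖ + ‖D (x - y)‖ :=
            (norm_sub_le _ _).trans (by gcongr; exact norm_sub_le _ _)
        _ ≤ κ * (2 * (‖B‖ * K) * ‖x - y‖) + κ * ((n : ℝ) ^ (-(b + 1)) * (‖B‖ * K * K)) +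
            ‖D‖ * ‖x - y‖ := by
            rw [norm_smul, norm_smul, Real.norm_of_nonneg hκ]
            gcongr
        _ ≤ M * ‖x - y‖ + κ * ((n : ℝ) ^ (-(b + 1)) * (‖B‖ * K * K)) := by
            rw [hM]
            linarith [norm_nonneg (x - y)]
        _ < M * (ε / (2 * M)) + ε / 2 := by gcongr
        _ = ε := by field_simp; ring
    · exact (((bmul _).continuous.comp_continuousOn
        ((B.continuous.comp_continuousOn hgc).clm_apply hgc)).const_smul κ).sub
        (D.continuous.comp_continuousOn hgc)

/-! ### Tempered distributions given by functions -/

/-- Complex valued square integrable functions. -/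
abbrev CL2 : Type := Lp ℂ 2 (volume : Measure R3)

lemma isGivenBy_toTemperedDistribution {p : ℝ≥0∞} [hp : Fact (1 ≤ p)]
    (f : Lp ℂ p (volume : Measure R3)) : IsGivenBy (Lp.toTemperedDistribution f) f := by
  intro φ
  have := ENNReal.HolderConjugate.inv_one_sub_inv' hp.out
  refine ⟨?_, ?_⟩
  · have h := (Lp.memLp f).integrable_mul (φ.memLp (1 - p⁻¹)⁻¹)
    refine h.congr (Filter.Eventually.of_forall fun ξ => ?_)
    simp [mul_comm]
  · rw [Lp.toTemperedDistribution_apply]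
    rfl

lemma IsGivenBy.congr {v : 𝓢'(R3, ℂ)} {h h' : R3 → ℂ} (hv : IsGivenBy v h)
    (he : h =ᵐ[volume] h') : IsGivenBy v h' := by
  intro φ
  have e : (fun ξ => φ ξ * h ξ) =ᵐ[volume] fun ξ => φ ξ * h' ξ := by
    filter_upwards [he] with ξ h1
    rw [h1]
  exact ⟨(hv φ).1.congr e, (hv φ).2.trans (integral_congr_ae e)⟩

lemma IsGivenBy.ext {v v' : 𝓢'(R3, ℂ)} {h : R3 → ℂ} (hv : IsGivenBy v h) (hv' : IsGivenBy v' h) :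
    v = v' := by
  ext φ
  rw [(hv φ).2, (hv' φ).2]

lemma IsGivenBy.add {v v' : 𝓢'(R3, ℂ)} {h h' : R3 → ℂ} (hv : IsGivenBy v h)
    (hv' : IsGivenBy v' h') : IsGivenBy (v + v') fun ξ => h ξ + h' ξ := by
  intro φ
  simp only [mul_add]
  refine ⟨(hv φ).1.add (hv' φ).1, ?_⟩
  rw [integral_add (hv φ).1 (hv' φ).1, ← (hv φ).2, ← (hv' φ).2]
  rfl

lemma IsGivenBy.neg {v : 𝓢'(R3, ℂ)} {h : R3 → ℂ} (hv : IsGivenBy v h) :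
    IsGivenBy (-v) fun ξ => -h ξ := by
  intro φ
  simp only [mul_neg]
  refine ⟨(hv φ).1.neg, ?_⟩
  rw [integral_neg, ← (hv φ).2]
  rfl

lemma IsGivenBy.sub {v v' : 𝓢'(R3, ℂ)} {h h' : R3 → ℂ} (hv : IsGivenBy v h)
    (hv' : IsGivenBy v' h') : IsGivenBy (v - v') fun ξ => h ξ - h' ξ := by
  simpa only [sub_eq_add_neg] using hv.add hv'.neg

lemma IsGivenBy.const_smul {v : 𝓢'(R3, ℂ)} {h : R3 → ℂ} (hv : IsGivenBy v h) (c : ℂ) :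
    IsGivenBy (c • v) fun ξ => c * h ξ := by
  intro φ
  simp only [mul_left_comm _ c]
  refine ⟨(hv φ).1.const_mul c, ?_⟩
  rw [integral_const_mul, ← (hv φ).2]
  rfl

lemma isGivenBy_zero : IsGivenBy 0 fun _ => 0 := fun φ => by simp

lemma IsGivenBy.smulLeft {v : 𝓢'(R3, ℂ)} {h : R3 → ℂ} (hv : IsGivenBy v h) {m : R3 → ℂ}
    (hm : m.HasTemperateGrowth) :
    IsGivenBy (TemperedDistribution.smulLeftCLM ℂ m v) fun ξ => m ξ * h ξ := by
  intro φ
  have h1 := hv (SchwartzMap.smulLeftCLM ℂ m φ)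
  have e : ∀ ξ, SchwartzMap.smulLeftCLM ℂ m φ ξ * h ξ = φ ξ * (m ξ * h ξ) := fun ξ => by
    rw [SchwartzMap.smulLeftCLM_apply_apply hm, smul_eq_mul]; ring
  simp only [e] at h1
  exact h1

/-- Test against a bump function equal to 1 on a ball. This is the hypothesis of the fundamental
lemma of the calculus of variations used in `IsGivenBy.ae_unique`. -/
lemma IsGivenBy.locallyIntegrable {v : 𝓢'(R3, ℂ)} {h : R3 → ℂ} (hv : IsGivenBy v h) :
    LocallyIntegrable h volume := by
  intro x
  let f : ContDiffBump x := ⟨1, 2, one_pos, one_lt_two⟩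
  have hg₁ : HasCompactSupport (Complex.ofRealCLM ∘ f) := f.hasCompactSupport.comp_left rfl
  have hg₂ : ContDiff ℝ (⊤ : ℕ∞) (Complex.ofRealCLM ∘ f) :=
    Complex.ofRealCLM.contDiff.comp f.contDiff
  have h1 := (hv (hg₁.toSchwartzMap hg₂)).1
  refine ⟨Metric.closedBall x 1, Metric.closedBall_mem_nhds x one_pos, ?_⟩
  refine (h1.integrableOn (s := Metric.closedBall x 1)).congr_fun (fun y hy => ?_)
    measurableSet_closedBall
  have h2 : f y = 1 := f.one_of_mem_closedBall hy
  simp [h2]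

lemma IsGivenBy.ae_unique {v : 𝓢'(R3, ℂ)} {h h' : R3 → ℂ} (hv : IsGivenBy v h)
    (hv' : IsGivenBy v h') : h =ᵐ[volume] h' := by
  refine ae_eq_of_integral_contDiff_smul_eq hv.locallyIntegrable hv'.locallyIntegrable
    fun g hg hgc => ?_
  have hg₁ : HasCompactSupport (Complex.ofRealCLM ∘ g) := hgc.comp_left rfl
  have hg₂ : ContDiff ℝ (⊤ : ℕ∞) (Complex.ofRealCLM ∘ g) := Complex.ofRealCLM.contDiff.comp hg
  have h1 := (hv (hg₁.toSchwartzMap hg₂)).2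
  rw [(hv' (hg₁.toSchwartzMap hg₂)).2] at h1
  simpa using h1.symm

/-- The symbol of the partial derivative `∂_i`. -/
def dsym (i : Fin 3) (ξ : R3) : ℂ := 2 * Real.pi * Complex.I * (ξ i : ℂ)

lemma IsGivenBy.fourier_lineDeriv {v : 𝓢'(R3, ℂ)} {h : R3 → ℂ} (hv : IsGivenBy (𝓕 v) h)
    (i : Fin 3) : IsGivenBy (𝓕 (∂_{e i} v)) fun ξ => dsym i ξ * h ξ := by
  rw [TemperedDistribution.fourier_lineDerivOp_eq]
  have hm : (fun ξ : R3 => ((inner ℝ ξ (e i) : ℝ) : ℂ)).HasTemperateGrowth := by fun_prop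
  refine ((hv.smulLeft hm).const_smul (2 * Real.pi * Complex.I)).congr
    (Filter.Eventually.of_forall fun ξ => ?_)
  simp only [dsym, e, EuclideanSpace.inner_single_right]
  simp
  ring

lemma fourier_add_dist (v w : 𝓢'(R3, ℂ)) : 𝓕 (v + w) = 𝓕 v + 𝓕 w := FourierTransform.fourier_add v w

lemma fourier_sub_dist (v w : 𝓢'(R3, ℂ)) : 𝓕 (v - w) = 𝓕 v - 𝓕 w := by
  ext φ; rfl

lemma fourier_neg_dist (v : 𝓢'(R3, ℂ)) : 𝓕 (-v) = -𝓕 v := by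
  ext φ; rfl

lemma fourier_injective_dist {v w : 𝓢'(R3, ℂ)} (h : 𝓕 v = 𝓕 w) : v = w := by
  have h1 : 𝓕⁻ (𝓕 v) = v := FourierTransform.fourierInv_fourier_eq v
  have h2 : 𝓕⁻ (𝓕 w) = w := FourierTransform.fourierInv_fourier_eq w
  rw [← h1, h, h2]

lemma isGivenBy_fourier_toDist (u : Lp ℝ 2 (volume : Measure R3)) :
    IsGivenBy (𝓕 (toDist u)) (𝓕 (toC u) : CL2) := by
  rw [toDist, Lp.fourier_toTemperedDistribution_eq]
  exact isGivenBy_toTemperedDistribution _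

/-! ### Products and convolutions of L² functions -/

lemma norm_integral_mul_le {f g : R3 → ℂ} (hf : MemLp f 2 volume) (hg : MemLp g 2 volume) :
    ‖∫ x, f x * g x‖ ≤ (eLpNorm f 2 volume).toReal * (eLpNorm g 2 volume).toReal := by
  have h1 := abs_real_inner_le_norm (hf.norm.toLp _) (hg.norm.toLp _)
  rw [Lp.norm_toLp, Lp.norm_toLp, eLpNorm_norm, eLpNorm_norm, L2.inner_def] at h1
  have e : ∫ x, inner ℝ ((hf.norm.toLp _ : Lp ℝ 2 volume) x) ((hg.norm.toLp _ : Lp ℝ 2 volume) x) =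
      ∫ x, ‖f x * g x‖ := by
    refine integral_congr_ae ?_
    filter_upwards [hf.norm.coeFn_toLp, hg.norm.coeFn_toLp] with x h2 h3
    rw [h2, h3, norm_mul]
    simp [mul_comm]
  rw [e] at h1
  exact (norm_integral_le_integral_norm _).trans ((le_abs_self _).trans h1)

lemma integrable_mul_of_memLp {f g : R3 → ℂ} (hf : MemLp f 2 volume) (hg : MemLp g 2 volume) :
    Integrable fun x => f x * g x := hf.integrable_mul hg

/-- Convolution of two square integrable functions. -/
def conv (F G : R3 → ℂ) (ξ : R3) : ℂ := ∫ η, F η * G (ξ - η)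

lemma MemLp.comp_sub_left {G : R3 → ℂ} (hG : MemLp G 2 volume) (ξ : R3) :
    MemLp (fun η => G (ξ - η)) 2 volume :=
  hG.comp_measurePreserving (Measure.measurePreserving_sub_left volume ξ)

lemma norm_conv_le {F G : R3 → ℂ} (hF : MemLp F 2 volume) (hG : MemLp G 2 volume) (ξ : R3) :
    ‖conv F G ξ‖ ≤ (eLpNorm F 2 volume).toReal * (eLpNorm G 2 volume).toReal := by
  refine (norm_integral_mul_le hF (MemLp.comp_sub_left hG ξ)).trans_eq ?_
  congr 2
  exact eLpNorm_comp_measurePreserving hG.1 (Measure.measurePreserving_sub_left volume ξ)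

lemma aesm_conv {F G : R3 → ℂ} (hF : AEStronglyMeasurable F volume)
    (hG : AEStronglyMeasurable G volume) : AEStronglyMeasurable (conv F G) volume :=
  ((hF.comp_quasiMeasurePreserving Measure.quasiMeasurePreserving_snd).mul
    (hG.comp_quasiMeasurePreserving
      (quasiMeasurePreserving_sub_of_right_invariant _ _))).integral_prod_right'

lemma integrable_mul_conv {F G : R3 → ℂ} (hF : MemLp F 2 volume) (hG : MemLp G 2 volume)
    (φ : 𝓢(R3, ℂ)) : Integrable fun ξ => φ ξ * conv F G ξ :=
  φ.integrable.mul_bdd (c := (eLpNorm F 2 volume).toReal * (eLpNorm G 2 volume).toReal)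
    (aesm_conv hF.1 hG.1) (Filter.Eventually.of_forall (norm_conv_le hF hG))

lemma conv_congr {F F' G G' : R3 → ℂ} (hF : F =ᵐ[volume] F') (hG : G =ᵐ[volume] G') :
    conv F G = conv F' G' := by
  ext1 ξ
  refine integral_congr_ae ?_
  filter_upwards [hF, (quasiMeasurePreserving_sub_left_of_right_invariant volume ξ).ae hG]
    with η h1 h2
  rw [h1, h2]

lemma conv_sub_right {F G G' : R3 → ℂ} (hF : MemLp F 2 volume) (hG : MemLp G 2 volume)
    (hG' : MemLp G' 2 volume) (ξ : R3) : conv F (G - G') ξ = conv F G ξ - conv F G' ξ := by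
  unfold conv
  rw [← integral_sub (integrable_mul_of_memLp hF (MemLp.comp_sub_left hG ξ))
    (integrable_mul_of_memLp hF (MemLp.comp_sub_left hG' ξ))]
  simp only [Pi.sub_apply, mul_sub]

/-- The Fourier transform turns products into convolutions: one factor smooth. -/
lemma integral_fourier_mul_schwartz (φ g : 𝓢(R3, ℂ)) (f : CL2) :
    ∫ x, (𝓕 φ) x * (f x * g x) = ∫ ξ, φ ξ * conv (𝓕 f : CL2) (𝓕 g : 𝓢(R3, ℂ)) ξ := by
  let N := SchwartzMap.compCLMOfContinuousLinearEquiv ℂ (F := ℂ)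
    (LinearIsometryEquiv.neg ℝ (E := R3)).toContinuousLinearEquiv
  let M := ContinuousLinearMap.mul ℂ ℂ
  -- Convolving φ with the reflected transform of g gives a Schwartz function whose transform is
  -- that of φ times g; the claim becomes the duality formula for f.
  set ψ : 𝓢(R3, ℂ) := SchwartzMap.convolution M φ (N (𝓕 g)) with hψ
  have hN : 𝓕 (N (𝓕 g)) = g := by
    have h1 : 𝓕⁻ g = N (𝓕 g) := rfl
    rw [← h1]
    exact FourierTransform.fourier_fourierInv_eq g
  have h𝓕ψ : ∀ x, (𝓕 ψ) x = (𝓕 φ) x * g x := fun x => by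
    rw [hψ, SchwartzMap.fourier_convolution, hN]
    rfl
  have h1 : Lp.toTemperedDistribution f (𝓕 ψ) = Lp.toTemperedDistribution (𝓕 f : CL2) ψ := by
    rw [← Lp.fourier_toTemperedDistribution_eq]; rfl
  rw [Lp.toTemperedDistribution_apply, Lp.toTemperedDistribution_apply] at h1
  calc ∫ x, (𝓕 φ) x * (f x * g x) = ∫ x, (𝓕 ψ) x • f x := by
        refine integral_congr_ae (Filter.Eventually.of_forall fun x => ?_)
        simp only [h𝓕ψ, smul_eq_mul]; ring
    _ = ∫ η, ψ η • (𝓕 f : CL2) η := h1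
    _ = ∫ η, ∫ ξ, φ ξ * ((𝓕 f : CL2) η * (𝓕 g) (ξ - η)) := by
        refine integral_congr_ae (Filter.Eventually.of_forall fun η => ?_)
        simp only [hψ, SchwartzMap.convolution_apply, convolution, smul_eq_mul]
        rw [← integral_mul_const]
        refine integral_congr_ae (Filter.Eventually.of_forall fun ξ => ?_)
        change φ ξ * (𝓕 g) (-(η - ξ)) * _ = _
        rw [neg_sub]; ring
    _ = ∫ ξ, ∫ η, φ ξ * ((𝓕 f : CL2) η * (𝓕 g) (ξ - η)) := by
        refine (integral_integral_swap (μ := volume) (ν := volume)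
          (f := fun ξ η => φ ξ * ((𝓕 f : CL2) η * (𝓕 g) (ξ - η)))
          ?_).symm
        refine integrable_young (p := fun ξ => ‖φ ξ‖) (q := fun η => ‖(𝓕 f : CL2) η‖)
          (r := fun ζ => ‖(𝓕 g) ζ‖) ((φ.memLp 2).integrable_norm_pow (by norm_num))
          ((Lp.memLp (𝓕 f : CL2)).integrable_norm_pow (by norm_num)) (𝓕 g).integrable.norm
          (fun _ => norm_nonneg _) ?_ (Filter.Eventually.of_forall fun z => ?_)
        · exact (φ.continuous.comp continuous_fst).aestronglyMeasurable.mul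
            (((Lp.aestronglyMeasurable (𝓕 f : CL2)).comp_quasiMeasurePreserving
              Measure.quasiMeasurePreserving_snd).mul
              ((𝓕 g).continuous.comp (continuous_fst.sub continuous_snd)).aestronglyMeasurable)
        · simp only [Function.uncurry, norm_mul, mul_assoc, le_refl]
    _ = _ := by simp only [integral_const_mul, conv]

/-- Density of Schwartz functions in L²: both sides are Lipschitz in g, the right-hand side by
Plancherel and the sup bound for convolutions. -/
lemma integral_fourier_mul (φ : 𝓢(R3, ℂ)) (f g : CL2) :
    ∫ x, (𝓕 φ) x * (f x * g x) = ∫ ξ, φ ξ * conv (𝓕 f : CL2) (𝓕 g : CL2) ξ := by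
  have hφf : MemLp (fun x => (𝓕 φ) x * f x) 2 volume :=
    (Lp.memLp f).mul ((𝓕 φ).memLp ⊤)
  refine DenseRange.induction_on (p := fun g : CL2 => ∫ x, (𝓕 φ) x * (f x * g x) =
    ∫ ξ, φ ξ * conv (𝓕 f : CL2) (𝓕 g : CL2) ξ)
    (SchwartzMap.denseRange_toLpCLM (p := 2) ENNReal.ofNat_ne_top) g (isClosed_eq ?_ ?_) fun g => ?_
  · refine (LipschitzWith.of_dist_le_mul (K := (eLpNorm (fun x => (𝓕 φ) x * f x) 2 volume).toNNReal)
      fun g g' => ?_).continuous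
    rw [dist_eq_norm, dist_eq_norm, Lp.norm_def]
    have e : (∫ x, (𝓕 φ) x * (f x * g x)) - (∫ x, (𝓕 φ) x * (f x * g' x)) =
        ∫ x, ((𝓕 φ) x * f x) * (g - g' : CL2) x := by
      simp only [← mul_assoc]
      rw [← integral_sub (integrable_mul_of_memLp hφf (Lp.memLp g))
        (integrable_mul_of_memLp hφf (Lp.memLp g'))]
      refine integral_congr_ae ?_
      filter_upwards [Lp.coeFn_sub g g'] with x h1
      rw [h1, Pi.sub_apply, mul_sub]
    rw [e]
    exact norm_integral_mul_le hφf (Lp.memLp _)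
  · set K : ℝ := (∫ ξ, ‖φ ξ‖) * (eLpNorm (𝓕 f : CL2) 2 volume).toReal with hK
    have hK0 : 0 ≤ K := mul_nonneg (integral_nonneg fun _ => norm_nonneg _) ENNReal.toReal_nonneg
    refine (LipschitzWith.of_dist_le_mul (K := K.toNNReal) fun g g' => ?_).continuous
    rw [dist_eq_norm, dist_eq_norm, Real.coe_toNNReal _ hK0]
    have hi : ∀ g : CL2, Integrable fun ξ => φ ξ * conv (𝓕 f : CL2) (𝓕 g : CL2) ξ := fun g =>
      integrable_mul_conv (Lp.memLp _) (Lp.memLp _) φ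
    have hn : ‖(𝓕 (g - g') : CL2)‖ = ‖g - g'‖ := Lp.norm_fourier_eq _
    rw [← integral_sub (hi g) (hi g')]
    have e : ∀ ξ, φ ξ * conv (𝓕 f : CL2) (𝓕 g : CL2) ξ - φ ξ * conv (𝓕 f : CL2) (𝓕 g' : CL2) ξ =
        φ ξ * conv (𝓕 f : CL2) (𝓕 (g - g') : CL2) ξ := fun ξ => by
      have h1 : (𝓕 (g - g') : CL2) = 𝓕 g - 𝓕 g' :=
        (Lp.fourierTransformₗᵢ R3 ℂ).map_sub g g'
      rw [h1, conv_congr Filter.EventuallyEq.rfl (Lp.coeFn_sub _ _),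
        conv_sub_right (Lp.memLp _) (Lp.memLp _) (Lp.memLp _), mul_sub]
    simp only [e]
    refine (norm_integral_le_integral_norm _).trans ?_
    rw [← hn, hK, mul_assoc, Lp.norm_def (𝓕 (g - g') : CL2), ← integral_mul_const]
    refine integral_mono (hi (g - g')).norm (φ.integrable.norm.mul_const _) fun ξ => ?_
    rw [norm_mul]
    gcongr
    exact norm_conv_le (Lp.memLp _) (Lp.memLp _) ξ
  · simp only [SchwartzMap.toLpCLM_apply]
    rw [conv_congr Filter.EventuallyEq.rfl (G' := (𝓕 g : 𝓢(R3, ℂ))) ?_]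
    · rw [← integral_fourier_mul_schwartz]
      refine integral_congr_ae ?_
      filter_upwards [g.coeFn_toLp 2 volume] with x h1
      rw [h1]
    · rw [SchwartzMap.toLp_fourier_eq]
      exact SchwartzMap.coeFn_toLp _ _ _

lemma isGivenBy_fourier_mulDist (u v : Lp ℝ 2 (volume : Measure R3)) :
    IsGivenBy (𝓕 (mulDist u v)) (conv (𝓕 (toC u) : CL2) (𝓕 (toC v) : CL2)) := by
  intro φ
  refine ⟨integrable_mul_conv (Lp.memLp _) (Lp.memLp _) φ, ?_⟩
  rw [← integral_fourier_mul, TemperedDistribution.fourier_apply, mulDist,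
    Lp.toTemperedDistribution_apply]
  refine integral_congr_ae ?_
  filter_upwards [Complex.ofRealCLM.coeFn_compLp (u • v : Lp ℝ 1 (volume : Measure R3)),
    Lp.coeFn_lpSMul (r := 1) u v, Complex.ofRealCLM.coeFn_compLp u,
    Complex.ofRealCLM.coeFn_compLp v] with x h1 h2 h3 h4
  rw [h1, h2, toC, toC, h3, h4]
  simp

/-! ### Real functions and Hermitian transforms -/

/-- Complex conjugation on `L²`. -/
def conjL2 : CL2 →L[ℝ] CL2 := (Complex.conjCLE : ℂ →L[ℝ] ℂ).compLpL 2 volume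

lemma conjL2_ae (f : CL2) : conjL2 f =ᵐ[volume] fun x => starRingEnd ℂ (f x) :=
  (Complex.conjCLE : ℂ →L[ℝ] ℂ).coeFn_compLpL f

/-- Reflection at the origin on `L²`. -/
def reflL2 (f : CL2) : CL2 :=
  Lp.compMeasurePreserving Neg.neg (Measure.measurePreserving_neg volume) f

lemma reflL2_ae (f : CL2) : reflL2 f =ᵐ[volume] fun x => f (-x) :=
  Lp.coeFn_compMeasurePreserving f _

lemma continuous_reflL2 : Continuous reflL2 :=
  (Lp.isometry_compMeasurePreserving (Measure.measurePreserving_neg volume)).continuous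

lemma fourier_conj_schwartz (f : 𝓢(R3, ℂ)) (ξ : R3) :
    (𝓕 (f.postcompCLM (Complex.conjCLE : ℂ →L[ℝ] ℂ))) ξ = starRingEnd ℂ ((𝓕 f) (-ξ)) := by
  rw [SchwartzMap.fourier_coe, SchwartzMap.fourier_coe, Real.fourier_eq', Real.fourier_eq',
    ← integral_conj]
  refine integral_congr_ae (Filter.Eventually.of_forall fun x => ?_)
  simp only [SchwartzMap.postcompCLM_apply, smul_eq_mul, map_mul, ← Complex.exp_conj,
    Complex.conj_ofReal, Complex.conj_I, inner_neg_right]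
  refine congrArg₂ (· * ·) (congrArg Complex.exp ?_) rfl
  push_cast
  ring

lemma fourier_conjL2 (f : CL2) : (𝓕 (conjL2 f) : CL2) = conjL2 (reflL2 (𝓕 f : CL2)) := by
  refine DenseRange.induction_on (p := fun f : CL2 =>
    (𝓕 (conjL2 f) : CL2) = conjL2 (reflL2 (𝓕 f : CL2)))
    (SchwartzMap.denseRange_toLpCLM (p := 2) ENNReal.ofNat_ne_top) f (isClosed_eq ?_ ?_) fun f => ?_
  · exact (Lp.fourierTransformₗᵢ R3 ℂ).continuous.comp conjL2.continuous
  · exact conjL2.continuous.comp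
      (continuous_reflL2.comp (Lp.fourierTransformₗᵢ R3 ℂ).continuous)
  · simp only [SchwartzMap.toLpCLM_apply]
    have h1 : conjL2 (f.toLp 2) = (f.postcompCLM (Complex.conjCLE : ℂ →L[ℝ] ℂ)).toLp 2 := by
      refine Lp.ext ?_
      filter_upwards [conjL2_ae (f.toLp 2), f.coeFn_toLp 2 volume,
        (f.postcompCLM (Complex.conjCLE : ℂ →L[ℝ] ℂ)).coeFn_toLp 2 volume] with x h1 h2 h3
      rw [h1, h2, h3]
      rfl
    rw [h1, SchwartzMap.toLp_fourier_eq, SchwartzMap.toLp_fourier_eq]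
    refine Lp.ext ?_
    filter_upwards [(𝓕 (f.postcompCLM (Complex.conjCLE : ℂ →L[ℝ] ℂ))).coeFn_toLp 2 volume,
      conjL2_ae (reflL2 ((𝓕 f).toLp 2)), reflL2_ae ((𝓕 f).toLp 2),
      (Measure.measurePreserving_neg (volume : Measure R3)).quasiMeasurePreserving.ae
        ((𝓕 f).coeFn_toLp 2 volume)] with x h2 h3 h4 h5
    rw [h2, h3, h4, h5, fourier_conj_schwartz]

lemma toC_ae (u : Lp ℝ 2 (volume : Measure R3)) : toC u =ᵐ[volume] fun x => (u x : ℂ) :=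
  Complex.ofRealCLM.coeFn_compLp u

lemma toC_injective {u v : Lp ℝ 2 (volume : Measure R3)} (h : toC u = toC v) : u = v := by
  refine Lp.ext ?_
  filter_upwards [toC_ae u, toC_ae v] with x h1 h2
  rw [h, h2] at h1
  exact_mod_cast h1.symm

lemma fourier_injective_L2 {f g : CL2} (h : (𝓕 f : CL2) = 𝓕 g) : f = g :=
  (Lp.fourierTransformₗᵢ R3 ℂ).injective h

lemma fourier_toC_neg (u : Lp ℝ 2 (volume : Measure R3)) :
    ∀ᵐ ξ, (𝓕 (toC u) : CL2) (-ξ) = starRingEnd ℂ ((𝓕 (toC u) : CL2) ξ) := by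
  have h1 : conjL2 (toC u) = toC u := by
    refine Lp.ext ?_
    filter_upwards [conjL2_ae (toC u), toC_ae u] with x h1 h2
    rw [h1, h2, Complex.conj_ofReal]
  have h2 := fourier_conjL2 (toC u)
  rw [h1] at h2
  filter_upwards [conjL2_ae (reflL2 (𝓕 (toC u) : CL2)), reflL2_ae (𝓕 (toC u) : CL2)] with ξ h3 h4
  rw [← h2, h4] at h3
  rw [h3, Complex.conj_conj]

/-- The inverse transform of F is fixed by conjugation because the two have the same Fourier
transform; it therefore equals its real part. -/
lemma exists_fourier_toC_eq {F : CL2} (hF : ∀ᵐ ξ, F (-ξ) = starRingEnd ℂ (F ξ)) :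
    ∃ u : Lp ℝ 2 (volume : Measure R3), (𝓕 (toC u) : CL2) = F := by
  set f : CL2 := 𝓕⁻ F with hf
  have hf' : (𝓕 f : CL2) = F := FourierTransform.fourier_fourierInv_eq F
  have h1 : conjL2 f = f := by
    refine fourier_injective_L2 ?_
    rw [fourier_conjL2, hf']
    refine Lp.ext ?_
    filter_upwards [conjL2_ae (reflL2 F), reflL2_ae F, hF] with ξ h1 h2 h3
    rw [h1, h2, h3, Complex.conj_conj]
  refine ⟨Complex.reCLM.compLp f, ?_⟩
  rw [← hf']
  congr 1
  refine Lp.ext ?_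
  filter_upwards [toC_ae (Complex.reCLM.compLp f), Complex.reCLM.coeFn_compLp f, conjL2_ae f]
    with x h2 h3 h4
  rw [h1] at h4
  rw [h2, h3]
  exact Complex.conj_eq_iff_re.1 h4.symm

/-- The components of a vector valued `L²` function. -/
def compL2 (i : Fin 3) : VL2 →L[ℝ] CL2 :=
  ((EuclideanSpace.proj i : C3 →L[ℂ] ℂ).restrictScalars ℝ).compLpL 2 volume

lemma compL2_ae (i : Fin 3) (g : VL2) : compL2 i g =ᵐ[volume] fun ξ => g ξ i :=
  ((EuclideanSpace.proj i : C3 →L[ℂ] ℂ).restrictScalars ℝ).coeFn_compLpL g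

/-- The inclusion of the `i`-th coordinate axis. -/
def axis (i : Fin 3) : ℂ →L[ℝ] C3 :=
  (ContinuousLinearMap.toSpanSingleton ℂ (EuclideanSpace.single i (1 : ℂ) : C3)).restrictScalars ℝ

/-- The vector valued `L²` function with given components. -/
def packL2 (x : Fin 3 → CL2) : VL2 := ∑ i, (axis i).compLpL 2 volume (x i)

lemma packL2_ae (x : Fin 3 → CL2) : ∀ᵐ ξ, ∀ i, packL2 x ξ i = x i ξ := by
  have h : ∀ i, ∀ᵐ ξ, (axis i).compLpL 2 volume (x i) ξ = axis i (x i ξ) := fun i =>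
    (axis i).coeFn_compLpL (x i)
  rw [packL2, Fin.sum_univ_three]
  set A := (axis 0).compLpL 2 volume (x 0)
  set B := (axis 1).compLpL 2 volume (x 1)
  set C := (axis 2).compLpL 2 volume (x 2)
  filter_upwards [h 0, h 1, h 2, Lp.coeFn_add (A + B) C, Lp.coeFn_add A B] with ξ h0 h1 h2 h3 h4 i
  rw [h3, Pi.add_apply, h4, Pi.add_apply, h0, h1, h2]
  fin_cases i <;> simp [axis]

lemma continuousOn_packL2 {x : ℝ → Fin 3 → CL2} {S : Set ℝ}
    (hx : ∀ i, ContinuousOn (fun t => x t i) S) : ContinuousOn (fun t => packL2 (x t)) S :=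
  continuousOn_finsetSum _ fun i _ => ((axis i).compLpL 2 volume).continuous.comp_continuousOn (hx i)

/-! ### The dictionary between fields and weighted transforms -/

/-- `g / bw s` is the Fourier transform of `B`. -/
def IsHat (s : ℝ) (B : L2Field) (g : VL2) : Prop :=
  ∀ i, ∀ᵐ ξ, (𝓕 (toC (B i)) : CL2) ξ = fld s g ξ i

lemma IsHat.apply {s : ℝ} {B : L2Field} {g : VL2} (h : IsHat s B g) :
    ∀ᵐ ξ, ∀ i, g ξ i = (bw s ξ : ℂ) * (𝓕 (toC (B i)) : CL2) ξ := by
  rw [ae_all_iff]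
  intro i
  filter_upwards [h i] with ξ h1
  rw [h1, ← bw_smul_fld s g ξ, PiLp.smul_apply, Complex.real_smul, fld]

lemma IsHat.herm {s : ℝ} {B : L2Field} {g : VL2} (h : IsHat s B g) : Herm g := by
  have h1 : ∀ᵐ ξ, ∀ i, (𝓕 (toC (B i)) : CL2) (-ξ) = starRingEnd ℂ ((𝓕 (toC (B i)) : CL2) ξ) := by
    rw [ae_all_iff]
    exact fun i => fourier_toC_neg (B i)
  filter_upwards [h.apply, h1, (Measure.measurePreserving_neg
    (volume : Measure R3)).quasiMeasurePreserving.ae h.apply] with ξ h2 h3 h4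
  ext i
  rw [h4, h3, cj_apply, h2, bw_neg_arg, map_mul, Complex.conj_ofReal]

lemma isGivenBy_fourier_divergence (B : L2Field) :
    IsGivenBy (𝓕 (divergence fun i => toDist (B i)))
      fun ξ => ∑ i, dsym i ξ * (𝓕 (toC (B i)) : CL2) ξ := by
  have h : ∀ i, IsGivenBy (𝓕 (∂_{e i} (toDist (B i))))
      fun ξ => dsym i ξ * (𝓕 (toC (B i)) : CL2) ξ := fun i =>
    (isGivenBy_fourier_toDist (B i)).fourier_lineDeriv i
  simp only [divergence, Fin.sum_univ_three, fourier_add_dist]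
  exact ((h 0).add (h 1)).add (h 2)

lemma IsHat.isDivFree_iff {s : ℝ} {B : L2Field} {g : VL2} (h : IsHat s B g) :
    IsDivFree B ↔ DivFree g := by
  have h0 : ∀ᵐ ξ, (∑ i, dsym i ξ * (𝓕 (toC (B i)) : CL2) ξ) * bw s ξ =
      2 * Real.pi * Complex.I * dt (cv ξ) (g ξ) := by
    filter_upwards [h.apply] with ξ h1
    simp only [dt, dsym, cv_apply, h1, Finset.mul_sum, Finset.sum_mul]
    exact Finset.sum_congr rfl fun i _ => by ring
  have hG := isGivenBy_fourier_divergence B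
  constructor
  · intro h1
    rw [IsDivFree] at h1
    have e : 𝓕 (0 : 𝓢'(R3, ℂ)) = 0 := by ext φ; rfl
    rw [h1, e] at hG
    filter_upwards [h0, hG.ae_unique isGivenBy_zero] with ξ h2 h3
    rw [h3, zero_mul] at h2
    simpa [Real.pi_ne_zero, Complex.I_ne_zero] using h2.symm
  · intro h1
    refine fourier_injective_dist ?_
    have e : 𝓕 (0 : 𝓢'(R3, ℂ)) = 0 := by ext φ; rfl
    rw [e]
    refine hG.ext (isGivenBy_zero.congr ?_)
    filter_upwards [h0, h1] with ξ h2 h3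
    rw [h3, mul_zero] at h2
    have := (bw_pos s ξ).ne'
    have h4 : (∑ i, dsym i ξ * (𝓕 (toC (B i)) : CL2) ξ) = 0 := by simpa [this] using h2
    exact h4.symm

lemma IsHat.mem_solenoidal {s : ℝ} {B : L2Field} {g : VL2} (h : IsHat s B g) (hB : IsDivFree B) :
    g ∈ solenoidal := ⟨h.herm, h.isDivFree_iff.1 hB⟩

lemma IsHat.eq_field {s : ℝ} {B B' : L2Field} {g : VL2} (h : IsHat s B g) (h' : IsHat s B' g) :
    B = B' := by
  funext i
  refine toC_injective (fourier_injective_L2 (Lp.ext ?_))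
  filter_upwards [h i, h' i] with ξ h1 h2
  rw [h1, h2]

lemma IsHat.eq_hat {s : ℝ} {B : L2Field} {g g' : VL2} (h : IsHat s B g) (h' : IsHat s B g') :
    g = g' := by
  refine Lp.ext ?_
  filter_upwards [h.apply, h'.apply] with ξ h1 h2
  ext i
  rw [h1, h2]

lemma exists_isHat {s : ℝ} (hs : 0 ≤ s) {g : VL2} (hg : Herm g) : ∃ B : L2Field, IsHat s B g := by
  have hbw := bddBy_bw (s := -s) (by linarith)
  have key : ∀ i, ∃ u : Lp ℝ 2 (volume : Measure R3),
      (𝓕 (toC u) : CL2) = compL2 i (bmul (bw (-s)) g) := fun i => by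
    refine exists_fourier_toC_eq ?_
    have h1 : ∀ᵐ ξ, compL2 i (bmul (bw (-s)) g) ξ = (bw (-s) ξ : ℂ) * g ξ i := by
      filter_upwards [compL2_ae i (bmul (bw (-s)) g), bmul_ae hbw g] with ξ h1 h2
      rw [h1, h2, PiLp.smul_apply, Complex.real_smul]
    filter_upwards [h1, (Measure.measurePreserving_neg
      (volume : Measure R3)).quasiMeasurePreserving.ae h1, hg] with ξ h2 h3 h4
    rw [h2, h3, h4, bw_neg_arg, map_mul, Complex.conj_ofReal, cj_apply]
  choose B hB using key
  refine ⟨B, fun i => ?_⟩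
  filter_upwards [compL2_ae i (bmul (bw (-s)) g), bmul_ae hbw g] with ξ h1 h2
  rw [hB, h1, h2, fld]

lemma hasTemperateGrowth_bw (s : ℝ) : (fun ξ : R3 => ((bw s ξ : ℝ) : ℂ)).HasTemperateGrowth := by
  unfold bw
  fun_prop

lemma besselPotential_toDist_eq_iff {s : ℝ} {u : Lp ℝ 2 (volume : Measure R3)} {w : CL2} :
    TemperedDistribution.besselPotential R3 ℂ s (toDist u) = Lp.toTemperedDistribution w ↔
      ∀ᵐ ξ, (bw s ξ : ℂ) * (𝓕 (toC u) : CL2) ξ = (𝓕 w : CL2) ξ := by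
  have h1 : IsGivenBy (𝓕 (TemperedDistribution.besselPotential R3 ℂ s (toDist u)))
      fun ξ => (bw s ξ : ℂ) * (𝓕 (toC u) : CL2) ξ := by
    rw [TemperedDistribution.fourier_besselPotential_eq_smulLeftCLM_fourier_apply]
    exact (isGivenBy_fourier_toDist u).smulLeft (hasTemperateGrowth_bw s)
  have h2 : IsGivenBy (𝓕 (Lp.toTemperedDistribution w)) (𝓕 w : CL2) := by
    rw [Lp.fourier_toTemperedDistribution_eq]
    exact isGivenBy_toTemperedDistribution _
  constructor
  · intro h
    rw [h] at h1
    exact h1.ae_unique h2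
  · intro h
    exact fourier_injective_dist ((h1.congr h).ext h2)

/-- The weighted transform is the Fourier transform of the Bessel potential, so time continuity
passes through Plancherel. -/
lemma MemCHs.exists_isHat {s T : ℝ} {B : ℝ → L2Field} (h : MemCHs s T B) :
    ∃ g : ℝ → VL2, ContinuousOn g (Set.Icc 0 T) ∧ ∀ t ∈ Set.Icc 0 T, IsHat s (B t) (g t) := by
  choose w hw hw' using h
  refine ⟨fun t => packL2 fun i => (𝓕 (w i t) : CL2), continuousOn_packL2 fun i =>
    (Lp.fourierTransformₗᵢ R3 ℂ).continuous.comp_continuousOn (hw i), fun t ht i => ?_⟩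
  filter_upwards [packL2_ae fun i => (𝓕 (w i t) : CL2),
    besselPotential_toDist_eq_iff.1 (hw' i t ht)] with ξ h1 h2
  rw [fld, PiLp.smul_apply, h1, ← h2, Complex.real_smul, ← mul_assoc, ← Complex.ofReal_mul,
    bw_neg_mul, Complex.ofReal_one, one_mul]

lemma MemHs.exists_isHat {s : ℝ} {B : L2Field} (h : MemHs s B) : ∃ g : VL2, IsHat s B g := by
  choose w hw using h
  -- A single field is treated as a constant curve on the degenerate interval [0,0].
  obtain ⟨g, -, hg⟩ := MemCHs.exists_isHat (s := s) (T := 0) (B := fun _ => B)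
    fun i => ⟨fun _ => w i, continuousOn_const, fun _ _ => hw i⟩
  exact ⟨g 0, hg 0 ⟨le_rfl, le_rfl⟩⟩

lemma memCHs_of_isHat {s T : ℝ} {B : ℝ → L2Field} {g : ℝ → VL2}
    (hg : ContinuousOn g (Set.Icc 0 T)) (h : ∀ t ∈ Set.Icc 0 T, IsHat s (B t) (g t)) :
    MemCHs s T B := by
  intro i
  refine ⟨fun t => 𝓕⁻ (compL2 i (g t)), ?_, fun t ht => ?_⟩
  · exact (Lp.fourierTransformₗᵢ R3 ℂ).symm.continuous.comp_continuousOn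
      ((compL2 i).continuous.comp_continuousOn hg)
  · rw [besselPotential_toDist_eq_iff]
    have e : (𝓕 (𝓕⁻ (compL2 i (g t)) : CL2) : CL2) = compL2 i (g t) :=
      FourierTransform.fourier_fourierInv_eq _
    filter_upwards [(h t ht).apply, compL2_ae i (g t)] with ξ h1 h2
    rw [e, h2, h1]

/-! ### The equation on the Fourier side -/

lemma IsGivenBy.fourier_curl {A : Fin 3 → 𝓢'(R3, ℂ)} {h : R3 → C3}
    (hA : ∀ i, IsGivenBy (𝓕 (A i)) fun ξ => h ξ i) (i : Fin 3) :
    IsGivenBy (𝓕 (curl A i)) fun ξ => 2 * Real.pi * Complex.I * cr (cv ξ) (h ξ) i := by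
  rw [curl, fourier_sub_dist]
  refine (((hA (i + 2)).fourier_lineDeriv (i + 1)).sub
    ((hA (i + 1)).fourier_lineDeriv (i + 2))).congr (Filter.Eventually.of_forall fun ξ => ?_)
  simp only [dsym, cr_apply, cv_apply]
  ring

lemma integral_C3_apply {α : Type*} [MeasurableSpace α] {μ : Measure α} {F : α → C3}
    (hF : Integrable F μ) (i : Fin 3) : (∫ x, F x ∂μ) i = ∫ x, F x i ∂μ :=
  ((EuclideanSpace.proj i : C3 →L[ℂ] ℂ).integral_comp_comm hF).symm

/-- The frequency side of `∇ × Λ^{-a} B`, up to a constant. -/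
def Kop (a : ℝ) (f : R3 → C3) (η : R3) : C3 := (‖η‖ ^ (-a)) • cr (cv η) (f η)

/-- The constant in `∇ × Λ^{-a} B`. -/
def curlConst (a : ℝ) : ℂ := 2 * Real.pi * Complex.I * ((2 * Real.pi) ^ (-a) : ℝ)

lemma lam_eq (r : ℝ) (ξ : R3) : lam r ξ = (2 * Real.pi) ^ r * ‖ξ‖ ^ r :=
  Real.mul_rpow (by positivity) (norm_nonneg _)

/-- The two curls contribute i² = -1, so the minus sign in front of the nonlinearity becomes the
nonnegative constant κ = (2π)^(2-a). -/
lemma two_pi_I_mul_curlConst (a : ℝ) :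
    2 * Real.pi * Complex.I * curlConst a = -(((2 * Real.pi) ^ (2 - a) : ℝ) : ℂ) := by
  have h1 : (2 * Real.pi) ^ (2 - a) = (2 * Real.pi) ^ 2 * (2 * Real.pi) ^ (-a) := by
    rw [sub_eq_add_neg, Real.rpow_add (by positivity), Real.rpow_two]
  have h2 : Complex.I * Complex.I = -1 := Complex.I_mul_I
  rw [h1, curlConst]
  push_cast
  linear_combination (4 * (Real.pi : ℂ) ^ 2 * (((2 * Real.pi) ^ (-a) : ℝ) : ℂ)) * h2

lemma isGivenBy_fourier_curl_fracLaplacian {a s : ℝ} {B : L2Field} {g : VL2} (hB : IsHat s B g)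
    {A : Fin 3 → 𝓢'(R3, ℂ)} (hA : ∀ i, IsFracLaplacian (-a) (B i) (A i)) (i : Fin 3) :
    IsGivenBy (𝓕 (curl A i)) fun ξ => curlConst a * Kop a (fld s g) ξ i := by
  have h1 : ∀ i, IsGivenBy (𝓕 (A i)) fun ξ => (lam (-a) ξ • fld s g ξ) i := fun i => by
    refine IsGivenBy.congr (hA i) ?_
    filter_upwards [hB i] with ξ h2
    rw [h2, PiLp.smul_apply, Complex.real_smul, lam]
  refine (IsGivenBy.fourier_curl h1 i).congr (Filter.Eventually.of_forall fun ξ => ?_)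
  simp only [Kop, cr_rsmul_right, PiLp.smul_apply, Complex.real_smul, curlConst, lam_eq]
  push_cast
  ring

lemma isGivenBy_fourier_cross {a s : ℝ} (ha : a < 1) (hs : 1 - a ≤ s) {B G : L2Field} {g : VL2}
    (hB : IsHat s B g)
    (hG : ∀ i, ∀ᵐ ξ, (𝓕 (toC (G i)) : CL2) ξ = curlConst a * Kop a (fld s g) ξ i) (i : Fin 3) :
    IsGivenBy (𝓕 (cross G B i)) fun ξ =>
      (curlConst a • ∫ η, cr (Kop a (fld s g) η) (fld s g (ξ - η))) i := by
  rw [cross, fourier_sub_dist]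
  refine ((isGivenBy_fourier_mulDist (G (i + 1)) (B (i + 2))).sub
    (isGivenBy_fourier_mulDist (G (i + 2)) (B (i + 1)))).congr
    (Filter.Eventually.of_forall fun ξ => ?_)
  have hK : MemLp (Kop a (fld s g)) 2 volume := (hs_fld s g).memLp_K ha hs
  have hf : MemLp (fld s g) 2 volume := (hs_fld s g).memLp_self (by linarith)
  have hc : ∀ {h : R3 → C3}, MemLp h 2 volume → ∀ j, MemLp (fun η => h η j) 2 volume :=
    fun hh j => (EuclideanSpace.proj j : C3 →L[ℂ] ℂ).comp_memLp' hh
  have hint : ∀ j k, Integrable fun η => Kop a (fld s g) η j * fld s g (ξ - η) k := fun j k =>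
    integrable_mul_of_memLp (hc hK j) (MemLp.comp_sub_left (hc hf k) ξ)
  have e : ∀ j k, conv (𝓕 (toC (G j)) : CL2) (𝓕 (toC (B k)) : CL2) ξ =
      curlConst a * ∫ η, Kop a (fld s g) η j * fld s g (ξ - η) k := fun j k => by
    rw [conv_congr (hG j) (hB k), conv, ← integral_const_mul]
    simp only [mul_assoc]
  simp only [e]
  rw [PiLp.smul_apply, smul_eq_mul, integral_C3_apply (integrable_cr_sub hK hf ξ)]
  simp only [cr_apply]
  rw [integral_sub (hint _ _) (hint _ _), mul_sub]

/-- The frequency side of the right-hand side of the evolution equation. -/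
def rhsHat (a b : ℝ) (f : R3 → C3) (i : Fin 3) (ξ : R3) : ℂ :=
  ((2 * Real.pi) ^ (2 - a) : ℝ) * Nl a f f ξ i - lam b ξ * f ξ i

/-- The result involves B only: G is determined almost everywhere on the Fourier side by being the
curl of A. The choice of A, D, G in the notion of solution is therefore immaterial. -/
lemma isGivenBy_fourier_rhs {a b s : ℝ} (ha : a < 1) (hs : 1 - a ≤ s) {B G : L2Field} {g : VL2}
    (hB : IsHat s B g) {A D : Fin 3 → 𝓢'(R3, ℂ)}
    (hA : ∀ i, IsFracLaplacian (-a) (B i) (A i)) (hD : ∀ i, IsFracLaplacian b (B i) (D i))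
    (hG : ∀ i, toDist (G i) = curl A i) (i : Fin 3) :
    IsGivenBy (𝓕 (-(curl (cross G B) i) - D i)) (rhsHat a b (fld s g) i) := by
  have h1 : ∀ i, ∀ᵐ ξ, (𝓕 (toC (G i)) : CL2) ξ = curlConst a * Kop a (fld s g) ξ i := fun i => by
    have h2 := isGivenBy_fourier_toDist (G i)
    rw [hG i] at h2
    exact h2.ae_unique (isGivenBy_fourier_curl_fracLaplacian hB hA i)
  rw [fourier_sub_dist, fourier_neg_dist]
  refine ((IsGivenBy.fourier_curl (isGivenBy_fourier_cross ha hs hB h1) i).neg.sub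
    (hD i)).congr ?_
  filter_upwards [hB i] with ξ h2
  have h3 := two_pi_I_mul_curlConst a
  rw [h2, rhsHat, cr_smul_right, PiLp.smul_apply, smul_eq_mul, ← mul_assoc, h3, neg_mul, neg_neg]
  rfl

/-! ### Existence of the auxiliary fields A, D and G -/

lemma exists_isFracLaplacian_of_isGivenBy {r : ℝ} {u : Lp ℝ 2 (volume : Measure R3)}
    {v : 𝓢'(R3, ℂ)} (h : IsGivenBy v fun ξ => (lam r ξ : ℂ) * (𝓕 (toC u) : CL2) ξ) :
    ∃ w, IsFracLaplacian r u w := by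
  refine ⟨𝓕⁻ v, ?_⟩
  have e : 𝓕 (𝓕⁻ v) = v := FourierTransform.fourier_fourierInv_eq v
  rw [IsFracLaplacian, e]
  exact h

/-- The symbol |ξ|^b need not be smooth at the origin, so it cannot multiply distributions directly.
It is factored as a bounded function, harmless in L², times the smooth weight `bw b` of temperate
growth. -/
lemma exists_isFracLaplacian_nonneg {b : ℝ} (hb : 0 ≤ b) (u : Lp ℝ 2 (volume : Measure R3)) :
    ∃ w, IsFracLaplacian b u w := by
  set F : CL2 := 𝓕 (toC u) with hF
  have hm : MemLp (fun ξ => ((bw (-b) ξ * lam b ξ : ℝ) : ℂ) * F ξ) 2 volume := by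
    refine MemLp.of_le_mul (c := (2 * Real.pi) ^ b) (Lp.memLp F) ?_
      (Filter.Eventually.of_forall fun ξ => ?_)
    · exact (Complex.measurable_ofReal.comp
        ((measurable_bw (-b)).mul (measurable_lam b))).aestronglyMeasurable.mul
        (Lp.aestronglyMeasurable F)
    · rw [norm_mul, Complex.norm_real, Real.norm_of_nonneg
        (mul_nonneg (bw_nonneg _ _) (lam_nonneg _ _))]
      gcongr
      calc bw (-b) ξ * lam b ξ ≤ bw (-b) ξ * ((2 * Real.pi) ^ b * bw b ξ) :=
            mul_le_mul_of_nonneg_left (lam_le_bw hb ξ) (bw_nonneg _ _)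
        _ = (bw (-b) ξ * bw b ξ) * (2 * Real.pi) ^ b := by ring
        _ = _ := by rw [bw_neg_mul, one_mul]
  refine exists_isFracLaplacian_of_isGivenBy
    (((isGivenBy_toTemperedDistribution (hm.toLp _)).smulLeft (hasTemperateGrowth_bw b)).congr ?_)
  filter_upwards [hm.coeFn_toLp] with ξ h1
  rw [h1, ← mul_assoc, ← Complex.ofReal_mul, ← mul_assoc, bw_mul_neg, one_mul]

/-- In polar coordinates the squared symbol contributes r^(2-2a) near the origin, integrable because
2 - 2a > -1. -/
lemma memLp_cut_lam {a : ℝ} (ha : a < 3 / 2) :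
    MemLp (fun ξ => ((cut 1 ξ * lam (-a) ξ : ℝ) : ℂ)) 2 volume := by
  have hsm : AEStronglyMeasurable (fun ξ => ((cut 1 ξ * lam (-a) ξ : ℝ) : ℂ)) volume :=
    (Complex.measurable_ofReal.comp
      ((measurable_cut 1).mul (measurable_lam (-a)))).aestronglyMeasurable
  rw [memLp_two_iff_integrable_sq_norm hsm]
  set f : ℝ → ℝ := fun r => if r ≤ 1 then (2 * Real.pi * r) ^ (-a) * (2 * Real.pi * r) ^ (-a) else 0
    with hf
  have e : (fun ξ : R3 => ‖((cut 1 ξ * lam (-a) ξ : ℝ) : ℂ)‖ ^ 2) = fun ξ => f ‖ξ‖ := by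
    ext1 ξ
    rw [Complex.norm_real, Real.norm_eq_abs, sq_abs, hf, cut, lam]
    simp only
    split_ifs <;> ring
  rw [e, integrable_fun_norm_addHaar]
  simp only [finrank_euclideanSpace, Fintype.card_fin]
  have h1 : IntegrableOn (fun r : ℝ => (2 * Real.pi) ^ (-a + -a) * r ^ (2 + (-a + -a)))
      (Set.Ioc 0 1) := by
    have := (intervalIntegral.intervalIntegrable_rpow' (a := 0) (b := 1)
      (r := 2 + (-a + -a)) (by linarith)).const_mul ((2 * Real.pi) ^ (-a + -a))
    rwa [intervalIntegrable_iff_integrableOn_Ioc_of_le zero_le_one] at this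
  have h2 : IntegrableOn (fun y : ℝ => y ^ (3 - 1) • f y) (Set.Ioc 0 1) := by
    refine h1.congr_fun (fun r hr => ?_) measurableSet_Ioc
    simp only [hf, if_pos hr.2, smul_eq_mul]
    rw [← Real.rpow_add (by have := hr.1; positivity), Real.mul_rpow (by positivity) hr.1.le,
      Real.rpow_add hr.1 2, Real.rpow_two]
    ring
  have h3 : IntegrableOn (fun y : ℝ => y ^ (3 - 1) • f y) (Set.Ioi 1) := by
    have h4 : IntegrableOn (fun _ : ℝ => (0 : ℝ)) (Set.Ioi 1) := integrableOn_zero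
    refine h4.congr_fun (fun r hr => ?_) measurableSet_Ioi
    simp [hf, not_le.2 (Set.mem_Ioi.1 hr)]
  rw [← Set.Ioc_union_Ioi_eq_Ioi zero_le_one]
  exact h2.union h3

/-- Split at |ξ| = 1: near the origin the singular symbol is in L² and its product with the
transform is in L¹; away from it the symbol is at most 1 and the product stays in L². -/
lemma exists_isFracLaplacian_neg {a : ℝ} (ha₀ : 0 ≤ a) (ha : a < 3 / 2)
    (u : Lp ℝ 2 (volume : Measure R3)) : ∃ w, IsFracLaplacian (-a) u w := by
  set F : CL2 := 𝓕 (toC u) with hF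
  have h1 : MemLp (fun ξ => ((cut 1 ξ * lam (-a) ξ : ℝ) : ℂ) * F ξ) 1 volume :=
    memLp_one_iff_integrable.2 (integrable_mul_of_memLp (memLp_cut_lam ha) (Lp.memLp F))
  have h2 : MemLp (fun ξ => (((1 - cut 1 ξ) * lam (-a) ξ : ℝ) : ℂ) * F ξ) 2 volume := by
    refine MemLp.of_le_mul (c := 1) (Lp.memLp F) ?_ (Filter.Eventually.of_forall fun ξ => ?_)
    · exact (Complex.measurable_ofReal.comp (((measurable_cut 1).const_sub 1).mul
        (measurable_lam (-a)))).aestronglyMeasurable.mul (Lp.aestronglyMeasurable F)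
    · rw [norm_mul, Complex.norm_real, Real.norm_of_nonneg (mul_nonneg
        (by linarith [cut_le_one 1 ξ]) (lam_nonneg _ _))]
      gcongr
      unfold cut lam
      split_ifs with h
      · simp
      · rw [sub_zero, one_mul]
        refine Real.rpow_le_one_of_one_le_of_nonpos ?_ (by linarith)
        have := Real.pi_gt_three
        nlinarith [not_le.1 h]
  refine exists_isFracLaplacian_of_isGivenBy (((isGivenBy_toTemperedDistribution (h1.toLp _)).add
    (isGivenBy_toTemperedDistribution (h2.toLp _))).congr ?_)
  filter_upwards [h1.coeFn_toLp, h2.coeFn_toLp] with ξ h3 h4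
  rw [h3, h4]
  push_cast
  ring

/-- The curl symbol makes `Kop` Hermitian up to a sign, and the purely imaginary `curlConst`
compensates it, so the inverse transform is real. -/
lemma exists_curl_field {a s : ℝ} (ha : a < 1) (hs : 1 - a ≤ s) {B : L2Field} {g : VL2}
    (hB : IsHat s B g) {A : Fin 3 → 𝓢'(R3, ℂ)} (hA : ∀ i, IsFracLaplacian (-a) (B i) (A i)) :
    ∃ G : L2Field, ∀ i, toDist (G i) = curl A i := by
  have hK : MemLp (Kop a (fld s g)) 2 volume := (hs_fld s g).memLp_K ha hs
  have hKi : ∀ i, MemLp (fun ξ => curlConst a * Kop a (fld s g) ξ i) 2 volume := fun i =>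
    ((EuclideanSpace.proj i : C3 →L[ℂ] ℂ).comp_memLp' hK).const_mul _
  have hherm : Herm (fld s g) := hB.herm.rsmul (bw_neg_arg _)
  have key : ∀ i, ∃ u : Lp ℝ 2 (volume : Measure R3), (𝓕 (toC u) : CL2) = (hKi i).toLp _ :=
    fun i => by
      refine exists_fourier_toC_eq ?_
      filter_upwards [(hKi i).coeFn_toLp, (Measure.measurePreserving_neg
        (volume : Measure R3)).quasiMeasurePreserving.ae (hKi i).coeFn_toLp, hherm] with ξ h1 h2 h3
      rw [h1, h2]
      have e : Kop a (fld s g) (-ξ) i = -starRingEnd ℂ (Kop a (fld s g) ξ i) := by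
        simp only [Kop, norm_neg, PiLp.smul_apply, Complex.real_smul, h3, cr_apply, cv_apply,
          PiLp.neg_apply, cj_apply, map_mul, map_sub, Complex.conj_ofReal, Complex.ofReal_neg]
        ring
      rw [e, curlConst]
      simp only [map_mul, Complex.conj_ofReal, Complex.conj_I, Complex.conj_ofNat]
      ring
  choose G hG using key
  refine ⟨G, fun i => fourier_injective_dist ?_⟩
  refine (isGivenBy_fourier_toDist (G i)).ext
    ((isGivenBy_fourier_curl_fracLaplacian hB hA i).congr ?_)
  rw [hG i]
  exact (hKi i).coeFn_toLp.symm

/-! ### Equivalence of the distributional and the L² formulation -/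

/-- Pairing of the `i`-th component with a Schwartz function. -/
def testL (θ : 𝓢(R3, ℂ)) (i : Fin 3) : VL2 →L[ℝ] ℂ :=
  ((innerSL ℂ ((θ.postcompCLM (Complex.conjCLE : ℂ →L[ℝ] ℂ)).toLp 2 volume)).restrictScalars ℝ) ∘L
    compL2 i

lemma testL_apply (θ : 𝓢(R3, ℂ)) (i : Fin 3) (x : VL2) : testL θ i x = ∫ ξ, θ ξ * x ξ i := by
  change (inner ℂ ((θ.postcompCLM (Complex.conjCLE : ℂ →L[ℝ] ℂ)).toLp 2 volume) (compL2 i x) : ℂ) = _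
  rw [L2.inner_def]
  refine integral_congr_ae ?_
  filter_upwards [(θ.postcompCLM (Complex.conjCLE : ℂ →L[ℝ] ℂ)).coeFn_toLp 2 volume,
    compL2_ae i x] with ξ h1 h2
  rw [h1, h2, SchwartzMap.postcompCLM_apply, RCLike.inner_apply, mul_comm]
  congr 1
  exact Complex.conj_conj _

/-- Multiplication of a Schwartz function by `bw r`. -/
def bwS (r : ℝ) (ψ : 𝓢(R3, ℂ)) : 𝓢(R3, ℂ) :=
  SchwartzMap.smulLeftCLM ℂ (fun ξ : R3 => ((bw r ξ : ℝ) : ℂ)) ψ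

lemma bwS_apply (r : ℝ) (ψ : 𝓢(R3, ℂ)) (ξ : R3) : bwS r ψ ξ = bw r ξ * ψ ξ := by
  rw [bwS, SchwartzMap.smulLeftCLM_apply_apply (hasTemperateGrowth_bw r), smul_eq_mul]

lemma bwS_bwS_neg (r : ℝ) (ψ : 𝓢(R3, ℂ)) : bwS r (bwS (-r) ψ) = ψ := by
  ext ξ
  rw [bwS_apply, bwS_apply, ← mul_assoc, ← Complex.ofReal_mul, bw_mul_neg, Complex.ofReal_one,
    one_mul]

/-- The right-hand side of the evolution equation in a negative order space. -/
def strongRhs (b s κ : ℝ) (B : VL2 →L[ℝ] VL2 →L[ℝ] VL2) (g : VL2) : VL2 :=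
  κ • bmul (bw (-(b + 1))) (B g g) - bmul (fun ξ => bw (-(b + 1)) ξ * (lam b ξ * bw (-s) ξ)) g

/-- The factor `bw (b + 1)` put on the test function cancels the negative weight of the strong
equation and leaves the plain pairing of ψ with the field. -/
lemma testL_state {b s : ℝ} (hb : 0 ≤ b) (hs : 0 ≤ s) (ψ : 𝓢(R3, ℂ)) (i : Fin 3) (g : VL2) :
    testL (bwS (b + 1) ψ) i (bmul (bw (-(b + 1 + s))) g) = ∫ ξ, ψ ξ * fld s g ξ i := by
  rw [testL_apply]
  refine integral_congr_ae ?_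
  filter_upwards [bmul_ae (bddBy_bw (s := -(b + 1 + s)) (by linarith)) g] with ξ h1
  rw [h1, bwS_apply, fld, show -(b + 1 + s) = -(b + 1) + -s by ring, bw_add (-(b + 1)),
    PiLp.smul_apply, PiLp.smul_apply, Complex.real_smul, Complex.real_smul]
  have h2 : (bw (b + 1) ξ : ℂ) * bw (-(b + 1)) ξ = 1 := by
    rw [← Complex.ofReal_mul, bw_mul_neg, Complex.ofReal_one]
  push_cast
  linear_combination (ψ ξ * bw (-s) ξ * g ξ i) * h2

lemma testL_strongRhs {a b s : ℝ} (hb : 0 ≤ b) (hs : 0 ≤ s) {B : VL2 →L[ℝ] VL2 →L[ℝ] VL2}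
    (hB : IsBilin a s B) (ψ : 𝓢(R3, ℂ)) (i : Fin 3) (g : VL2) :
    testL (bwS (b + 1) ψ) i (strongRhs b s ((2 * Real.pi) ^ (2 - a)) B g) =
      ∫ ξ, ψ ξ * rhsHat a b (fld s g) i ξ := by
  rw [testL_apply]
  refine integral_congr_ae ?_
  have hb' := bddBy_bw (s := -(b + 1)) (by linarith)
  set κ : ℝ := (2 * Real.pi) ^ (2 - a) with hκ
  set X := bmul (bw (-(b + 1))) (B g g) with hX
  set Y := bmul (fun ξ => bw (-(b + 1)) ξ * (lam b ξ * bw (-s) ξ)) g with hY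
  filter_upwards [bmul_ae hb' (B g g), bmul_ae (bddBy_dissipation hb hs) g, hB g g,
    Lp.coeFn_sub (κ • X) Y, Lp.coeFn_smul κ X] with ξ h1 h2 h3 h4 h5
  rw [strongRhs, h4, Pi.sub_apply, h5, Pi.smul_apply, hX, hY, h1, h2, h3, bwS_apply, rhsHat]
  have h6 : fld s g ξ i = bw (-s) ξ * g ξ i := by
    rw [fld, PiLp.smul_apply, Complex.real_smul]
  simp only [PiLp.sub_apply, PiLp.smul_apply, Complex.real_smul, h6]
  have h2 : (bw (b + 1) ξ : ℂ) * bw (-(b + 1)) ξ = 1 := by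
    rw [← Complex.ofReal_mul, bw_mul_neg, Complex.ofReal_one]
  push_cast
  linear_combination (ψ ξ * (κ * Nl a (fld s g) (fld s g) ξ i -
    lam b ξ * bw (-s) ξ * g ξ i)) * h2

/-- A weakly differentiable curve in `L²` with continuous weak derivative is differentiable. -/
lemma hasDerivWithinAt_of_weak {T : ℝ} {y Φ : ℝ → CL2} (hΦ : ContinuousOn Φ (Set.Icc 0 T))
    (h : ∀ θ : 𝓢(R3, ℂ), ∀ t ∈ Set.Icc 0 T, HasDerivWithinAt
      (fun τ => (inner ℂ (θ.toLp 2 volume) (y τ) : ℂ)) (inner ℂ (θ.toLp 2 volume) (Φ t))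
      (Set.Icc 0 T) t) :
    ∀ t ∈ Set.Icc 0 T, HasDerivWithinAt y (Φ t) (Set.Icc 0 T) t := by
  intro t ht
  refine hasDerivWithinAt_of_forall_approx fun ε hε => ?_
  obtain ⟨ρ, hρ, h1⟩ := Metric.continuousWithinAt_iff.1 (hΦ t ht) ε hε
  refine ⟨ρ, hρ, fun τ hτ hτρ => ?_⟩
  set X := y τ - y t - (τ - t) • Φ t with hX
  -- The radius ρ comes from norm continuity of Φ and does not depend on the test function, so
  -- density extends the bound to all f; the choice f = X then bounds the norm of the remainder.
  have h2 : ∀ f : CL2, ‖(inner ℂ f X : ℂ)‖ ≤ ‖f‖ * ε * |τ - t| := fun f => by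
    refine DenseRange.induction_on (p := fun f : CL2 => ‖(inner ℂ f X : ℂ)‖ ≤ ‖f‖ * ε * |τ - t|)
      (SchwartzMap.denseRange_toLpCLM (p := 2) ENNReal.ofNat_ne_top) f
      (isClosed_le (by fun_prop) (by fun_prop)) fun θ => ?_
    simp only [SchwartzMap.toLpCLM_apply]
    set L : CL2 →L[ℝ] ℂ := (innerSL ℂ (θ.toLp 2 volume)).restrictScalars ℝ with hL
    have h3 := norm_sub_sub_smul_le (v := L (Φ t)) (ε := ‖θ.toLp 2 volume‖ * ε) ht hτ (h θ)
      (fun x hx hxρ => ?_) hτρ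
    · have e : (inner ℂ (θ.toLp 2 volume) X : ℂ) = L (y τ) - L (y t) - (τ - t) • L (Φ t) := by
        rw [← map_smul, ← map_sub, ← map_sub]; rfl
      rw [e]
      exact h3
    · have e : (inner ℂ (θ.toLp 2 volume) (Φ x) : ℂ) - L (Φ t) =
          inner ℂ (θ.toLp 2 volume) (Φ x - Φ t) := (inner_sub_right _ _ _).symm
      rw [e]
      refine (norm_inner_le_norm _ _).trans ?_
      have := (h1 hx hxρ).le
      rw [dist_eq_norm] at this
      gcongr
  have h3 := h2 X
  have e : ‖(inner ℂ X X : ℂ)‖ = ‖X‖ * ‖X‖ := by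
    rw [inner_self_eq_norm_sq_to_K, norm_pow, sq]
    simp
  rw [e, mul_assoc] at h3
  rcases (norm_nonneg X).eq_or_lt with h4 | h4
  · rw [← h4]; positivity
  · exact le_of_mul_le_mul_left h3 h4

lemma hasDerivWithinAt_of_comp {y : ℝ → VL2} {v : VL2} {S : Set ℝ} {t : ℝ}
    (h : ∀ i, HasDerivWithinAt (fun τ => compL2 i (y τ)) (compL2 i v) S t) :
    HasDerivWithinAt y v S t := by
  have e : ∀ x : VL2, x = ∑ i, (axis i).compLpL 2 volume (compL2 i x) := fun x => by
    refine Lp.ext ?_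
    have h1 : ∀ᵐ ξ, ∀ i, compL2 i x ξ = x ξ i := ae_all_iff.2 fun i => compL2_ae i x
    filter_upwards [packL2_ae fun i => compL2 i x, h1] with ξ h2 h3
    ext i
    rw [← h3 i, ← h2 i]
    rfl
  have h1 : HasDerivWithinAt (fun τ => ∑ i, (axis i).compLpL 2 volume (compL2 i (y τ)))
      (∑ i, (axis i).compLpL 2 volume (compL2 i v)) S t :=
    HasDerivWithinAt.fun_sum fun i _ =>
      ((axis i).compLpL 2 volume).hasFDerivAt.comp_hasDerivWithinAt t (h i)
  rw [← e v] at h1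
  simpa only [← e] using h1

lemma IsHat.toDist_fourier {s : ℝ} {B : L2Field} {g : VL2} (h : IsHat s B g) (i : Fin 3)
    (ψ : 𝓢(R3, ℂ)) : toDist (B i) (𝓕 ψ) = ∫ ξ, ψ ξ * fld s g ξ i :=
  (((isGivenBy_fourier_toDist (B i)).congr (h i)) ψ).2

lemma inner_toLp_compL2 (θ : 𝓢(R3, ℂ)) (i : Fin 3) (x : VL2) :
    (inner ℂ (θ.toLp 2 volume) (compL2 i x) : ℂ) =
      testL (θ.postcompCLM (Complex.conjCLE : ℂ →L[ℝ] ℂ)) i x := by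
  have e : (θ.postcompCLM (Complex.conjCLE : ℂ →L[ℝ] ℂ)).postcompCLM
      (Complex.conjCLE : ℂ →L[ℝ] ℂ) = θ := by
    ext ξ
    exact Complex.conj_conj _
  rw [testL, e]
  rfl

lemma continuousOn_strongRhs {b s κ : ℝ} (B : VL2 →L[ℝ] VL2 →L[ℝ] VL2) {g : ℝ → VL2} {S : Set ℝ}
    (hg : ContinuousOn g S) : ContinuousOn (fun t => strongRhs b s κ B (g t)) S :=
  (((bmul _).continuous.comp_continuousOn
    ((B.continuous.comp_continuousOn hg).clm_apply hg)).const_smul κ).sub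
    ((bmul _).continuous.comp_continuousOn hg)

/-- The distributional equation tested against Fourier transforms is a weak L² equation. Its
right-hand side is norm continuous in time because g is, so the weak derivative is a strong one. -/
lemma IsSolution.strongEq {a b s T : ℝ} (ha : a < 1) (hb : 0 ≤ b) (hs : 1 - a ≤ s)
    {Bl : VL2 →L[ℝ] VL2 →L[ℝ] VL2} (hBl : IsBilin a s Bl) {B₀ : L2Field} {B : ℝ → L2Field}
    (h : IsSolution a b s T B₀ B) {g : ℝ → VL2} (hg : ContinuousOn g (Set.Icc 0 T))
    (hB : ∀ t ∈ Set.Icc 0 T, IsHat s (B t) (g t)) :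
    StrongEq b s ((2 * Real.pi) ^ (2 - a)) Bl T g := by
  have hs0 : 0 ≤ s := by linarith
  intro t ht
  refine hasDerivWithinAt_of_comp (v := strongRhs b s ((2 * Real.pi) ^ (2 - a)) Bl (g t)) fun i => ?_
  refine hasDerivWithinAt_of_weak (y := fun τ => compL2 i (bmul (bw (-(b + 1 + s))) (g τ)))
    (Φ := fun t => compL2 i (strongRhs b s ((2 * Real.pi) ^ (2 - a)) Bl (g t)))
    ((compL2 i).continuous.comp_continuousOn (continuousOn_strongRhs Bl hg)) (fun θ t ht => ?_) t ht
  simp only [inner_toLp_compL2]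
  set η := θ.postcompCLM (Complex.conjCLE : ℂ →L[ℝ] ℂ)
  -- Every Schwartz function has the form `bwS (b + 1) ψ`, the shape in which the weights cancel.
  rw [← bwS_bwS_neg (b + 1) η]
  set ψ := bwS (-(b + 1)) η
  simp only [testL_state hb hs0, testL_strongRhs hb hs0 hBl]
  obtain ⟨A, D, G, hA, hD, hG, heq⟩ := h.equation t ht
  have h1 := heq i (𝓕 ψ)
  have h2 : (-(curl (cross G (B t)) i) - D i) (𝓕 ψ) = ∫ ξ, ψ ξ * rhsHat a b (fld s (g t)) i ξ :=
    (isGivenBy_fourier_rhs ha hs (hB t ht) hA hD hG i ψ).2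
  rw [h2] at h1
  exact h1.congr (fun τ hτ => ((hB τ hτ).toDist_fourier i ψ).symm)
    ((hB t ht).toDist_fourier i ψ).symm

lemma StrongEq.isSolution {a b s T : ℝ} (ha₀ : 0 ≤ a) (ha : a < 1) (hb : 0 ≤ b) (hs : 1 - a ≤ s)
    {Bl : VL2 →L[ℝ] VL2 →L[ℝ] VL2} (hBl : IsBilin a s Bl) {B : ℝ → L2Field} {g : ℝ → VL2}
    (hg : ContinuousOn g (Set.Icc 0 T)) (hgs : ∀ t ∈ Set.Icc 0 T, g t ∈ solenoidal)
    (hB : ∀ t ∈ Set.Icc 0 T, IsHat s (B t) (g t))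
    (h : StrongEq b s ((2 * Real.pi) ^ (2 - a)) Bl T g) : IsSolution a b s T (B 0) B := by
  have hs0 : 0 ≤ s := by linarith
  refine ⟨memCHs_of_isHat hg hB, rfl, fun t ht => (hB t ht).isDivFree_iff.2 (hgs t ht).2,
    fun t ht => ?_⟩
  choose A hA using fun i => exists_isFracLaplacian_neg ha₀ (by linarith) (B t i)
  choose D hD using fun i => exists_isFracLaplacian_nonneg hb (B t i)
  obtain ⟨G, hG⟩ := exists_curl_field ha hs (hB t ht) hA
  refine ⟨A, D, G, hA, hD, hG, fun i φ => ?_⟩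
  -- By Fourier inversion it is enough to test with Fourier transforms.
  obtain ⟨ψ, rfl⟩ : ∃ ψ : 𝓢(R3, ℂ), 𝓕 ψ = φ := ⟨𝓕⁻ φ, FourierTransform.fourier_fourierInv_eq φ⟩
  have h1 := (testL (bwS (b + 1) ψ) i).hasFDerivAt.comp_hasDerivWithinAt t (h t ht)
  have h2 : (-(curl (cross G (B t)) i) - D i) (𝓕 ψ) = ∫ ξ, ψ ξ * rhsHat a b (fld s (g t)) i ξ :=
    (isGivenBy_fourier_rhs ha hs (hB t ht) hA hD hG i ψ).2
  rw [h2, ← testL_strongRhs hb hs0 hBl]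
  have h3 : ∀ τ ∈ Set.Icc 0 T, toDist (B τ i) (𝓕 ψ) =
      testL (bwS (b + 1) ψ) i (bmul (bw (-(b + 1 + s))) (g τ)) := fun τ hτ => by
    rw [testL_state hb hs0, (hB τ hτ).toDist_fourier]
  exact h1.congr h3 (h3 t ht)

end ActiveVector

end

/-! ### Assembly: from the datum to its transform and back -/

theorem theoremB (a b s : ℝ) (ha₀ : 0 ≤ a) (ha₁ : a < 1) (hb : 1 - a < b)
    (hs : 7 / 2 - a < s) (B₀ : ActiveVector.L2Field) (hB₀ : ActiveVector.MemHs s B₀)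
    (hdiv : ActiveVector.IsDivFree B₀) :
    ∃ T : ℝ, 0 < T ∧ ∃ B : ℝ → ActiveVector.L2Field,
      ActiveVector.IsSolution a b s T B₀ B ∧
      ∀ B' : ℝ → ActiveVector.L2Field, ActiveVector.IsSolution a b s T B₀ B' →
        ∀ t ∈ Set.Icc 0 T, B' t = B t := by
  have hb0 : 0 ≤ b := by linarith
  have hs0 : 0 ≤ s := by linarith
  have hs1 : 1 - a ≤ s := by linarith
  have hκ : 0 ≤ (2 * Real.pi) ^ (2 - a) := by positivity
  obtain ⟨g₀, hg₀⟩ := ActiveVector.MemHs.exists_isHat hB₀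
  obtain ⟨Bl, hBl⟩ := ActiveVector.exists_isBilin ha₁ hs
  obtain ⟨T, hT, g, hg0, hgc, hgs, hg⟩ := ActiveVector.exists_strongEq ha₀ ha₁ hb hs hκ hBl
    (hg₀.mem_solenoidal hdiv)
  have h0 : (0 : ℝ) ∈ Set.Icc 0 T := ⟨le_rfl, hT.le⟩
  have hex : ∀ t, ∃ F : ActiveVector.L2Field, t ∈ Set.Icc 0 T → ActiveVector.IsHat s F (g t) :=
    fun t => by
      by_cases ht : t ∈ Set.Icc 0 T
      · obtain ⟨F, hF⟩ := ActiveVector.exists_isHat hs0 (hgs t ht).1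
        exact ⟨F, fun _ => hF⟩
      -- Outside [0,T] the value is arbitrary, as every condition refers to the interval.
      · exact ⟨B₀, fun h => absurd h ht⟩
  choose B hB using hex
  have hB0 : B 0 = B₀ := (hg0 ▸ hB 0 h0).eq_field hg₀
  refine ⟨T, hT, B, hB0 ▸ hg.isSolution ha₀ ha₁ hb0 hs1 hBl hgc hgs hB, fun B' hB' t ht => ?_⟩
  obtain ⟨g', hgc', hg'⟩ := hB'.memCHs.exists_isHat
  have h0' : ActiveVector.IsHat s B₀ (g' 0) := hB'.initial ▸ hg' 0 h0
  have e := ActiveVector.StrongEq.unique ha₀ ha₁ hb hs hκ hBl hgc' hgc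
    (fun t ht => (hg' t ht).mem_solenoidal (hB'.divFree t ht)) hgs
    (hB'.strongEq ha₁ hb0 hs1 hBl hgc' hg') hg ((h0'.eq_hat hg₀).trans hg0.symm) t ht
  exact (e ▸ hg' t ht).eq_field (hB t ht)
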